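/- Let $X$ be a compact complex manifold of dimension $n$ with a Kähler metric, with Kähler form $\omega$ and volume form $\omega^n/n!$. Let $\mathcal E$ be a holomorphic vector bundle of rank $r$ and $\mathcal L$ a holomorphic line bundle on $X$, and let $\varphi\in H^0(X,\mathcal E\otimes\mathcal L^*)$ be a holomorphic homomorphism $\mathcal L\to\mathcal E$. Let $t,t'\in C^\infty(X,\mathbb R)$ have averages $\bar t$, $\bar t'$ over $X$, and suppose that $\sigma=4\pi/(\bar t-\bar t')$ is positive. Let $p,q$ be the projections of $X\times\mathbb P^1$ to $X$ and $\mathbb P^1$, and let $\alpha$ be an $SU(2)$-invariant $\mathcal O(-2)$-valued $(0,1)$-form on $\mathbb P^1$ whose class generates $H^1(\mathbb P^1,\mathcal O(-2))$, given in the affine coordinate $a$ by $\alpha=(1+|a|^2)^{-2}\,d\bar a$. Let $$0\to p^*\mathcal E\to\mathcal F\to p^*\mathcal L\otimes q^*\mathcal O(2)\to 0$$ be the extension of holomorphic vector bundles on $X\times\mathbb P^1$ with class $[p^*\varphi\otimes q^*\alpha]$: the smooth bundle $p^*\mathcal E\oplus(p^*\mathcal L\otimes q^*\mathcal O(2))$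 with the direct sum $\bar\partial$-operator plus $p^*\varphi\otimes q^*\alpha$. The group $SU(2)$ acts on $X\times\mathbb P^1$, trivially on $X$ and in the standard way on $\mathbb P^1$, and on $\mathcal F$, trivially on $p^*\mathcal E$ and $p^*\mathcal L$ and in the standard way on $q^*\mathcal O(2)$. For a Hermitian metric $H$ on a holomorphic vector bundle let $F_H$ be the curvature of its Chern connection. Then the following are equivalent. 1. There are smooth Hermitian metrics $H$ on $\mathcal E$ and $K$ on $\mathcal L$ which satisfy the coupled vortex equations $$i\Lambda F_H+\varphi\otimes\varphi^*=t\,\mathbf I_{\mathcal E},\qquad i\Lambda F_K-|\varphi|^2=t',$$ where $\Lambda$ is the contraction with $\omega$, and $\varphi^*$ and $|\varphi|$ are taken with respect to $H$ and $K$. 2. There is a smooth $SU(2)$-invariant Hermitian metric $\mathbf H$ on $\mathcal F$ which satisfies the deformed Hermitian–Einstein equation $$i\Lambda_\sigma F_{\mathbf H}=\bar t\,\mathbf I+\begin{pmatrix}(t-\bar t)\,\mathbf I_1&0\\0&(t'-\bar t')\,\mathbf I_2\end{pmatrix},$$ where $\Lambda_\sigma$ is the contraction with the Kähler form $\omega_\sigma=p^*\omega+\sigma\,q^*\omega_{\mathbb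 P^1}$, with $\omega_{\mathbb P^1}$ the Fubini–Study form of volume $1$, and the blocks refer to the $\mathbf H$-orthogonal splitting of $\mathcal F$ into $p^*\mathcal E$ and its orthogonal complement. -/

import Mathlib

open Bundle Set MeasureTheory
open scoped Manifold ContDiff Matrix ComplexConjugate LinearAlgebra.Projectivization

noncomputable section

namespace CoupledVortex

/-! ### Wirtinger derivatives, Hermitian metrics and Chern curvature -/

section Calculus

variable {W : Type*} [NormedAddCommGroup W] [NormedSpace ℂ W]

/-- The `(1,0)`-derivative `∂_v f` at `z`: for `v = ∂/∂z_j` this is `∂f/∂z_j`. -/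
def del (f : W → ℂ) (z v : W) : ℂ :=
  (fderiv ℝ f z v - Complex.I * fderiv ℝ f z (Complex.I • v)) / 2

/-- The `(0,1)`-derivative of `f` at `z`: for `v = ∂/∂z_j` this is `∂f/∂z̄_j`. -/
def delbar (f : W → ℂ) (z v : W) : ℂ :=
  (fderiv ℝ f z v + Complex.I * fderiv ℝ f z (Complex.I • v)) / 2

variable {κ : Type*} [Fintype κ] [DecidableEq κ]

/-- The connection form `H⁻¹ ∂H` of the Chern connection, evaluated on `v`, where `H` is the Gram
matrix `H a b = h (e_a, e_b)` (conjugate linear in `e_a`) of a Hermitian metric in a holomorphic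
frame. -/
def chernForm (H : W → Matrix κ κ ℂ) (z v : W) : Matrix κ κ ℂ :=
  (H z)⁻¹ * Matrix.of fun a b => del (fun w => H w a b) z v

/-- The coefficient of `dz_u ∧ dz̄_v` in the Chern curvature `F = ∂̄ (H⁻¹ ∂H)`. -/
def chernCurvature (H : W → Matrix κ κ ℂ) (z u v : W) : Matrix κ κ ℂ :=
  - Matrix.of fun a b => delbar (fun w => chernForm H w u a b) z v

end Calculus

section Metrics

variable {W : Type*} [NormedAddCommGroup W] [NormedSpace ℂ W]
  {HM : Type*} [TopologicalSpace HM] (I : ModelWithCorners ℂ W HM)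
  {M : Type*} [TopologicalSpace M] [ChartedSpace HM M]
  (F : Type*) [NormedAddCommGroup F] [NormedSpace ℂ F]
  {V : M → Type*} [TopologicalSpace (TotalSpace F V)]
  [∀ x, AddCommGroup (V x)] [∀ x, Module ℂ (V x)] [∀ x, TopologicalSpace (V x)]
  [FiberBundle F V] [VectorBundle ℂ F V]

/-- The function `h (e_a, e_c)` in the preferred coordinates and the preferred (holomorphic)
trivialization of `V` at `x₀`; here `e_a` is the local section which is constantly equal to `a` in
that trivialization. -/
def localForm (h : ∀ x, V x →ₗ⋆[ℂ] V x →ₗ[ℂ] ℂ) (x₀ : M) (a c : F) (z : W) : ℂ :=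
  h ((extChartAt I x₀).symm z)
    ((trivializationAt F V x₀).symmₗ ℂ ((extChartAt I x₀).symm z) a)
    ((trivializationAt F V x₀).symmₗ ℂ ((extChartAt I x₀).symm z) c)

variable (V) in
/-- A smooth Hermitian metric on a holomorphic vector bundle `V` (conjugate linear in the first
variable). -/
structure HermitianMetric where
  form : ∀ x, V x →ₗ⋆[ℂ] V x →ₗ[ℂ] ℂ
  conj_symm : ∀ x u v, conj (form x u v) = form x v u
  pos : ∀ x v, v ≠ 0 → 0 < (form x v v).re
  smooth : ∀ x₀ a c, ContDiffAt ℝ ∞ (localForm I F form x₀ a c) (extChartAt I x₀ x₀)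

variable {F} {κ ι : Type*} [Fintype κ] [DecidableEq κ] [Fintype ι] [DecidableEq ι]

/-- The endomorphism `iΛF_h` of the fibre `V x₀`, where `F_h` is the Chern curvature of the
Hermitian metric `h` on `V` and `Λ` is the contraction with the Kähler form
`ω = i ∑ g_{jk̄} dz_j ∧ dz̄_k` of the Hermitian metric `g` on the tangent bundle, so that
`iΛF = ∑ g^{jk̄} F_{jk̄}`. It is computed in the preferred coordinates and the preferred holomorphic
trivialization at `x₀`; `c` is a basis of the model space of the manifold, `b` one of the model
fibre. -/
def meanCurvature (c : Module.Basis ι ℂ W) (b : Module.Basis κ ℂ F)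
    (g : ∀ x : M, TangentSpace I x →ₗ⋆[ℂ] TangentSpace I x →ₗ[ℂ] ℂ)
    (h : ∀ x, V x →ₗ⋆[ℂ] V x →ₗ[ℂ] ℂ) (x₀ : M) : V x₀ →ₗ[ℂ] V x₀ :=
  let G : Matrix ι ι ℂ :=
    Matrix.of fun k j => g x₀ (c k : TangentSpace I x₀) (c j : TangentSpace I x₀)
  let H : W → Matrix κ κ ℂ := fun z => Matrix.of fun a d => localForm I F h x₀ (b a) (b d) z
  (trivializationAt F V x₀).symmₗ ℂ x₀ ∘ₗ
    Matrix.toLin b b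
      (∑ j, ∑ k, G⁻¹ j k • chernCurvature H (extChartAt I x₀ x₀) (c j) (c k)) ∘ₗ
    (trivializationAt F V x₀).linearMapAt ℂ x₀

end Metrics

section Kaehler

variable {W : Type*} [NormedAddCommGroup W] [NormedSpace ℂ W]
  {HM : Type*} [TopologicalSpace HM] {I : ModelWithCorners ℂ W HM}
  {M : Type*} [TopologicalSpace M] [ChartedSpace HM M] [IsManifold I 1 M]

/-- A Hermitian metric on the tangent bundle is Kähler if `dω = 0`, that is, if
`∂_u g(w, v) = ∂_v g(w, u)` for coordinate vector fields `u`, `v`, `w`. -/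
def IsKaehler (g : HermitianMetric I W (TangentSpace I : M → Type _)) : Prop :=
  ∀ (x₀ : M) (u v w : W),
    del (localForm I W g.form x₀ w v) (extChartAt I x₀ x₀) u =
      del (localForm I W g.form x₀ w u) (extChartAt I x₀ x₀) v

end Kaehler

section Volume

variable {n : ℕ} {X : Type*} [TopologicalSpace X] [ChartedSpace (Fin n → ℂ) X]
  [IsManifold 𝓘(ℂ, Fin n → ℂ) 1 X] [MeasurableSpace X]

/-- The volume measure `ωⁿ/n!` of a Hermitian metric: in each chart it is `2ⁿ det(g_{jk̄})` times
Lebesgue measure on `ℂⁿ`. The measures on the chart domains agree on overlaps, and the measure on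
`X` glued from them is their supremum. -/
def kaehlerVolume
    (g : HermitianMetric 𝓘(ℂ, Fin n → ℂ) (Fin n → ℂ)
      (TangentSpace 𝓘(ℂ, Fin n → ℂ) : X → Type _)) : Measure X :=
  ⨆ x₀ : X,
    (((volume : Measure (Fin n → ℂ)).restrict (chartAt (Fin n → ℂ) x₀).target).withDensity
      fun z => ENNReal.ofReal (2 ^ n * (Matrix.det (Matrix.of fun k j : Fin n =>
        localForm 𝓘(ℂ, Fin n → ℂ) (Fin n → ℂ) g.form x₀ (Pi.single k 1) (Pi.single j 1) z)).re)).map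
      (chartAt (Fin n → ℂ) x₀).symm

end Volume

/-! ### The complex projective line -/

/-- The complex projective line: the space of lines through the origin in `ℂ²`. -/
abbrev ProjLine : Type := ℙ ℂ (Fin 2 → ℂ)

namespace ProjLine

/-- The point of `ℂ²` whose `i`-th coordinate is `1` and whose other coordinate is `z`. -/
def affinePoint (i : Fin 2) (z : ℂ) : Fin 2 → ℂ := fun j => if j = i then 1 else z

/-- The affine coordinate `v_{1-i} / v_i` of the line spanned by `v`. -/
def coord (i : Fin 2) (l : ProjLine) : ℂ := l.rep (1 - i) / l.rep i

/-- The section of the tautological line bundle which has `i`-th coordinate `1`. -/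
def tautSection (i : Fin 2) (l : ProjLine) : l.submodule :=
  ⟨(l.rep i)⁻¹ • l.rep, by
    rw [Projectivization.submodule_eq]
    exact Submodule.smul_mem _ _ (Submodule.mem_span_singleton_self _)⟩

theorem affinePoint_ne_zero (i : Fin 2) (z : ℂ) : affinePoint i z ≠ 0 := by
  intro h
  simpa [affinePoint] using congrFun h i

theorem coe_tautSection {i : Fin 2} {l : ProjLine} (hl : l.rep i ≠ 0) :
    (tautSection i l : Fin 2 → ℂ) = affinePoint i (coord i l) := by
  ext j
  by_cases hj : j = i
  · subst hj
    simp [tautSection, affinePoint, hl]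
  · have hj' : j = 1 - i := by omega
    subst hj'
    simp [tautSection, affinePoint, hj, coord, div_eq_inv_mul]

theorem rep_mk {v : Fin 2 → ℂ} (hv : v ≠ 0) :
    ∃ a : ℂ, a ≠ 0 ∧ (Projectivization.mk ℂ v hv).rep = a • v := by
  obtain ⟨a, ha⟩ := Projectivization.exists_smul_eq_mk_rep ℂ v hv
  exact ⟨a, a.ne_zero, ha.symm⟩

theorem coord_mk {v : Fin 2 → ℂ} (hv : v ≠ 0) (i : Fin 2) :
    coord i (Projectivization.mk ℂ v hv) = v (1 - i) / v i := by
  obtain ⟨a, ha, h⟩ := rep_mk hv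
  rw [coord, h, Pi.smul_apply, Pi.smul_apply, smul_eq_mul, smul_eq_mul, mul_div_mul_left _ _ ha]

theorem rep_mk_ne_zero_iff {v : Fin 2 → ℂ} (hv : v ≠ 0) (i : Fin 2) :
    (Projectivization.mk ℂ v hv).rep i ≠ 0 ↔ v i ≠ 0 := by
  obtain ⟨a, ha, h⟩ := rep_mk hv
  rw [h, Pi.smul_apply, smul_eq_mul]
  simp [ha]

theorem mk_affinePoint_coord {i : Fin 2} {l : ProjLine} (hl : l.rep i ≠ 0) :
    Projectivization.mk ℂ (affinePoint i (coord i l)) (affinePoint_ne_zero _ _) = l := by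
  conv_rhs => rw [← Projectivization.mk_rep l]
  rw [Projectivization.mk_eq_mk_iff']
  refine ⟨(l.rep i)⁻¹, ?_⟩
  rw [← coe_tautSection hl, tautSection]

/-- The standard affine chart of the projective line on the lines spanned by vectors with nonzero
`i`-th coordinate. -/
def affineChart (i : Fin 2) : PartialEquiv ProjLine ℂ where
  toFun := coord i
  invFun z := Projectivization.mk ℂ (affinePoint i z) (affinePoint_ne_zero i z)
  source := {l | l.rep i ≠ 0}
  target := univ
  map_source' _ _ := mem_univ _
  map_target' z _ := by
    rw [mem_ofPred_eq, rep_mk_ne_zero_iff]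
    simp [affinePoint]
  left_inv' _ hl := mk_affinePoint_coord hl
  right_inv' z _ := by
    rw [coord_mk]
    have : (1 : Fin 2) - i ≠ i := by omega
    simp [affinePoint, this]

/-- The index of the preferred chart at a point. -/
def chartIndex (l : ProjLine) : Fin 2 := if l.rep 0 ≠ 0 then 0 else 1

theorem rep_chartIndex (l : ProjLine) : l.rep (chartIndex l) ≠ 0 := by
  unfold chartIndex
  split_ifs with h
  · exact h
  · intro h1
    apply l.rep_nonzero
    ext j
    fin_cases j
    · simpa using h
    · simpa using h1

theorem affineChart_trans_source (i j : Fin 2) :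
    ((affineChart i).symm.trans (affineChart j)).source = {z | affinePoint i z j ≠ 0} := by
  ext z
  rw [PartialEquiv.trans_source]
  simp only [affineChart, PartialEquiv.symm, univ_inter, mem_preimage, mem_ofPred_eq]
  exact rep_mk_ne_zero_iff _ _

theorem affineChart_trans_apply (i j : Fin 2) (z : ℂ) :
    ((affineChart i).symm.trans (affineChart j)) z = affinePoint i z (1 - j) / affinePoint i z j :=
  coord_mk (affinePoint_ne_zero i z) j

theorem contDiff_affinePoint (i j : Fin 2) : ContDiff ℂ ω fun z => affinePoint i z j := by
  unfold affinePoint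
  split_ifs
  · exact contDiff_const
  · exact contDiff_id

theorem contDiffOn_affineChart_trans (i j : Fin 2) :
    ContDiffOn ℂ ω ((affineChart i).symm.trans (affineChart j))
      ((affineChart i).symm.trans (affineChart j)).source := by
  rw [affineChart_trans_source]
  exact ContDiffOn.congr
    ((contDiff_affinePoint i (1 - j)).contDiffOn.div (contDiff_affinePoint i j).contDiffOn
      fun z hz => hz) fun z _ => affineChart_trans_apply i j z

/-- The atlas of the projective line consisting of the two affine charts. -/
def chartedSpaceCore : ChartedSpaceCore ℂ ProjLine where
  atlas := range affineChart
  chartAt l := affineChart (chartIndex l)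
  mem_chart_source l := rep_chartIndex l
  chart_mem_atlas l := mem_range_self _
  open_source := by
    rintro _ _ ⟨i, rfl⟩ ⟨j, rfl⟩
    rw [affineChart_trans_source]
    exact isOpen_ne_fun (contDiff_affinePoint i j).continuous continuous_const
  continuousOn_toFun := by
    rintro _ _ ⟨i, rfl⟩ ⟨j, rfl⟩
    exact (contDiffOn_affineChart_trans i j).continuousOn

instance : TopologicalSpace ProjLine := chartedSpaceCore.toTopologicalSpace

instance : ChartedSpace ℂ ProjLine := chartedSpaceCore.toChartedSpace

theorem mem_atlas_iff (e : OpenPartialHomeomorph ProjLine ℂ) :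
    e ∈ atlas ℂ ProjLine ↔
      ∃ i, e = chartedSpaceCore.openPartialHomeomorph (affineChart i) (mem_range_self i) := by
  change e ∈ (⋃ (e : PartialEquiv ProjLine ℂ) (he : e ∈ chartedSpaceCore.atlas),
    {chartedSpaceCore.openPartialHomeomorph e he}) ↔ _
  simp only [mem_iUnion, mem_singleton_iff]
  constructor
  · rintro ⟨_, ⟨i, rfl⟩, h⟩
    exact ⟨i, h⟩
  · rintro ⟨i, h⟩
    exact ⟨_, mem_range_self i, h⟩

instance : IsManifold 𝓘(ℂ, ℂ) ω ProjLine := by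
  apply isManifold_of_contDiffOn
  intro e e' he he'
  obtain ⟨i, rfl⟩ := (mem_atlas_iff e).1 he
  obtain ⟨j, rfl⟩ := (mem_atlas_iff e').1 he'
  have h := contDiffOn_affineChart_trans i j
  simp only [modelWithCornersSelf_coe, modelWithCornersSelf_coe_symm, Function.id_comp,
    Function.comp_id, preimage_id, range_id, inter_univ]
  exact h

theorem isOpen_chart (i : Fin 2) : IsOpen {l : ProjLine | l.rep i ≠ 0} :=
  chartedSpaceCore.open_source' (mem_range_self i)

theorem contMDiffOn_coord (i : Fin 2) :
    ContMDiffOn 𝓘(ℂ, ℂ) 𝓘(ℂ, ℂ) ω (coord i) {l : ProjLine | l.rep i ≠ 0} :=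
  contMDiffOn_of_mem_maximalAtlas
    (IsManifold.subset_maximalAtlas ((mem_atlas_iff _).2 ⟨i, rfl⟩))

/-- The value at the point `l`, with affine coordinate `a = coord i l`, of the Fubini-Study metric
of volume `1`, whose Kähler form is `(i/2π) da ∧ dā / (1 + |a|²)²`; tangent vectors are expressed in
the preferred chart at `l`. -/
def fubiniStudy (l : ProjLine) :
    TangentSpace 𝓘(ℂ, ℂ) l →ₗ⋆[ℂ] TangentSpace 𝓘(ℂ, ℂ) l →ₗ[ℂ] ℂ :=
  (((2 * Real.pi * (1 + ‖coord (chartIndex l) l‖ ^ 2) ^ 2)⁻¹ : ℝ) : ℂ) •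
    (LinearMap.mul ℂ ℂ).comp (starLinearEquiv ℂ (A := ℂ)).toLinearMap

end ProjLine

/-- The Hermitian metric on `X × P¹` with Kähler form `p^*ω + σ q^*ω_{P¹}`, where `ω` is the Kähler
form of `g`. -/
def prodMetric {W : Type*} [NormedAddCommGroup W] [NormedSpace ℂ W]
    {HM : Type*} [TopologicalSpace HM] {I : ModelWithCorners ℂ W HM}
    {X : Type*} [TopologicalSpace X] [ChartedSpace HM X]
    (g : ∀ x : X, TangentSpace I x →ₗ⋆[ℂ] TangentSpace I x →ₗ[ℂ] ℂ) (σ : ℝ) (p : X × ProjLine) :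
    TangentSpace (I.prod 𝓘(ℂ, ℂ)) p →ₗ⋆[ℂ] TangentSpace (I.prod 𝓘(ℂ, ℂ)) p →ₗ[ℂ] ℂ :=
  let pr₁ : TangentSpace (I.prod 𝓘(ℂ, ℂ)) p →ₗ[ℂ] TangentSpace I p.1 := LinearMap.fst ℂ W ℂ
  let pr₂ : TangentSpace (I.prod 𝓘(ℂ, ℂ)) p →ₗ[ℂ] TangentSpace 𝓘(ℂ, ℂ) p.2 := LinearMap.snd ℂ W ℂ
  LinearMap.mk₂'ₛₗ (starRingEnd ℂ) (RingHom.id ℂ)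
    (fun u v => g p.1 (pr₁ u) (pr₁ v) + σ * ProjLine.fubiniStudy p.2 (pr₂ u) (pr₂ v))
    (fun u u' v => by simp only [map_add, LinearMap.add_apply]; ring)
    (fun c u v => by
      simp only [map_smul, LinearMap.map_smulₛₗ, LinearMap.smul_apply, smul_eq_mul]; ring)
    (fun u v v' => by simp only [map_add]; ring)
    (fun c u v => by simp only [map_smul, smul_eq_mul, RingHom.id_apply]; ring)

/-! ### Holomorphic triples and the extension bundle -/

section Extension

variable {W : Type*} [NormedAddCommGroup W] [NormedSpace ℂ W]
  {HM : Type*} [TopologicalSpace HM] (I : ModelWithCorners ℂ W HM)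
  {X : Type*} [TopologicalSpace X] [ChartedSpace HM X]
  (FE : Type*) [NormedAddCommGroup FE] [NormedSpace ℂ FE]
  (E : X → Type*) [TopologicalSpace (TotalSpace FE E)]
  [∀ x, AddCommGroup (E x)] [∀ x, Module ℂ (E x)] [∀ x, TopologicalSpace (E x)]
  [FiberBundle FE E] [VectorBundle ℂ FE E]
  (L : X → Type*) [TopologicalSpace (TotalSpace ℂ L)]
  [∀ x, AddCommGroup (L x)] [∀ x, Module ℂ (L x)] [∀ x, TopologicalSpace (L x)]
  [FiberBundle ℂ L] [VectorBundle ℂ ℂ L]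

/-- A holomorphic homomorphism from the line bundle `L` to the vector bundle `E`. -/
structure HolomorphicHom where
  toFun : ∀ x, L x →ₗ[ℂ] E x
  holomorphic : ContMDiff (I.prod 𝓘(ℂ, ℂ)) (I.prod 𝓘(ℂ, FE)) ω
    fun p : TotalSpace ℂ L => (⟨p.proj, toFun p.proj p.2⟩ : TotalSpace FE E)

variable {I FE E L}

/-- The fibres of the bundle `𝓕` on `X × P¹` determined by the triple `(E, L, φ)`. As a smooth
bundle `𝓕` is `p^*E ⊕ (p^*L ⊗ q^*O(2))`; here the fibre of `p^*L ⊗ q^*O(2)` at `(x, l)` is realized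
as the space of quadratic maps from the line `l ⊆ ℂ²` to `L x`. -/
def ExtFiber (_ : HolomorphicHom I FE E L) (p : X × ProjLine) : Type _ :=
  E p.1 × QuadraticMap ℂ p.2.submodule (L p.1)

namespace ExtFiber

variable (φ : HolomorphicHom I FE E L) (p : X × ProjLine)

instance : AddCommGroup (ExtFiber φ p) :=
  inferInstanceAs (AddCommGroup (E p.1 × QuadraticMap ℂ p.2.submodule (L p.1)))

instance : Module ℂ (ExtFiber φ p) :=
  inferInstanceAs (Module ℂ (E p.1 × QuadraticMap ℂ p.2.submodule (L p.1)))

/-- The element of the fibre of `𝓕` with given components. -/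
def mk (v : E p.1) (Q : QuadraticMap ℂ p.2.submodule (L p.1)) : ExtFiber φ p := (v, Q)

end ExtFiber

variable (φ : HolomorphicHom I FE E L)

/-- On the affine line `l.rep i ≠ 0` of `P¹`, with affine coordinate `a = coord i l`, this function
`f_i = ± ā / (1 + |a|²)` is a primitive: `∂̄ f_i = α`, of the invariant `O(-2)`-valued `(0,1)`-form
`α`, equal to `dā / (1 + |a|²)²` for `i = 0`, whose class generates `H¹(P¹, O(-2))`. -/
def extPrimitive (i : Fin 2) (l : ProjLine) : ℂ :=
  (if i = 0 then 1 else -1) * conj (ProjLine.coord i l) / (1 + ‖ProjLine.coord i l‖ ^ 2 : ℝ)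

/-- Evaluation of quadratic maps at a point. -/
def evalQuad {A B : Type*} [AddCommGroup A] [Module ℂ A] [AddCommGroup B] [Module ℂ B] (s : A) :
    QuadraticMap ℂ A B →ₗ[ℂ] B where
  toFun Q := Q s
  map_add' _ _ := rfl
  map_smul' _ _ := rfl

/-- The local section `q_i ⊗ w` of `p^*L ⊗ q^*O(2)` over `l.rep i ≠ 0`: the quadratic map on the line
`l` which is equal to `w` at the vector of `l` with `i`-th coordinate `1`. -/
def quadOf {B : Type*} [AddCommGroup B] [Module ℂ B] (i : Fin 2) (l : ProjLine) :
    B →ₗ[ℂ] QuadraticMap ℂ l.submodule B where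
  toFun w := (LinearMap.toSpanSingleton ℂ B w).compQuadraticMap
    ((QuadraticMap.proj i i).comp l.submodule.subtype)
  map_add' w w' := by
    ext v
    simp
  map_smul' c w := by
    ext v
    simp [smul_smul, mul_comm]

/-- Coordinates in the local holomorphic frames of `𝓕`. These frames consist of the local
holomorphic frames of `E` and of the sections `q_i ⊗ w - f_i φ(w)`, for `w` a local holomorphic
frame of `L`. Thus the Cauchy-Riemann operator of `𝓕` is that of `p^*E ⊕ (p^*L ⊗ q^*O(2))` plus
`p^*φ ⊗ q^*α`, and `𝓕` is the extension of `p^*L ⊗ q^*O(2)` by `p^*E` defined by the class of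
`p^*φ ⊗ q^*α`. -/
def extCoord (x₀ : X) (i : Fin 2) (p : X × ProjLine) : ExtFiber φ p →ₗ[ℂ] FE × ℂ :=
  let s := ProjLine.tautSection i p.2
  let pr₁ : ExtFiber φ p →ₗ[ℂ] E p.1 := LinearMap.fst ℂ _ _
  let pr₂ : ExtFiber φ p →ₗ[ℂ] QuadraticMap ℂ p.2.submodule (L p.1) := LinearMap.snd ℂ _ _
  ((trivializationAt FE E x₀).linearMapAt ℂ p.1 ∘ₗ
      (pr₁ + extPrimitive i p.2 • (φ.toFun p.1 ∘ₗ evalQuad s ∘ₗ pr₂))).prod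
    ((trivializationAt ℂ L x₀).linearMapAt ℂ p.1 ∘ₗ evalQuad s ∘ₗ pr₂)

/-- The inverse of `extCoord`. -/
def extFrame (x₀ : X) (i : Fin 2) (p : X × ProjLine) (u : FE × ℂ) : ExtFiber φ p :=
  let w := (trivializationAt ℂ L x₀).symmₗ ℂ p.1 u.2
  .mk φ p ((trivializationAt FE E x₀).symmₗ ℂ p.1 u.1 - extPrimitive i p.2 • φ.toFun p.1 w)
    (quadOf i p.2 w)

/-- The topology of the fibres of `𝓕`, as finite-dimensional vector spaces. -/
instance (p : X × ProjLine) : TopologicalSpace (ExtFiber φ p) :=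
  .induced (extCoord φ p.1 (ProjLine.chartIndex p.2) p) inferInstance

theorem extCoord_mk (x₀ : X) (i : Fin 2) (p : X × ProjLine) (v : E p.1)
    (Q : QuadraticMap ℂ p.2.submodule (L p.1)) :
    extCoord φ x₀ i p (.mk φ p v Q) =
      ((trivializationAt FE E x₀).linearMapAt ℂ p.1
        (v + extPrimitive i p.2 • φ.toFun p.1 (Q (ProjLine.tautSection i p.2))),
      (trivializationAt ℂ L x₀).linearMapAt ℂ p.1 (Q (ProjLine.tautSection i p.2))) :=
  rfl

theorem quadOf_apply {B : Type*} [AddCommGroup B] [Module ℂ B] (i : Fin 2) (l : ProjLine) (w : B)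
    (v : l.submodule) : quadOf i l w v = ((v : Fin 2 → ℂ) i * (v : Fin 2 → ℂ) i) • w :=
  rfl

theorem quadOf_tautSection {B : Type*} [AddCommGroup B] [Module ℂ B] {i : Fin 2} {l : ProjLine}
    (hl : l.rep i ≠ 0) (Q : QuadraticMap ℂ l.submodule B) :
    quadOf i l (Q (ProjLine.tautSection i l)) = Q := by
  ext v
  have hv : v = (v : Fin 2 → ℂ) i • ProjLine.tautSection i l := by
    obtain ⟨v, hv⟩ := v
    rw [Projectivization.submodule_eq] at hv
    obtain ⟨a, rfl⟩ := Submodule.mem_span_singleton.1 hv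
    apply Subtype.ext
    simp [ProjLine.tautSection, smul_smul, hl]
  rw [quadOf_apply]
  conv_rhs => rw [hv]
  rw [QuadraticMap.map_smul]

/-- The domain of the local frame `extFrame`. -/
def extBaseSet (x₀ : X) (i : Fin 2) : Set (X × ProjLine) :=
  ((trivializationAt FE E x₀).baseSet ∩ (trivializationAt ℂ L x₀).baseSet) ×ˢ
    {l : ProjLine | l.rep i ≠ 0}


/-- The local trivialization of `𝓕` given by its local holomorphic frames. -/
def extPretrivialization (x₀ : X) (i : Fin 2) :
    Pretrivialization (FE × ℂ) (π (FE × ℂ) (ExtFiber φ)) where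
  toFun q := (q.proj, extCoord φ x₀ i q.proj q.2)
  invFun q := ⟨q.1, extFrame φ x₀ i q.1 q.2⟩
  source := TotalSpace.proj ⁻¹' extBaseSet (FE := FE) (E := E) (L := L) x₀ i
  target := extBaseSet (FE := FE) (E := E) (L := L) x₀ i ×ˢ univ
  map_source' _ h := ⟨h, mem_univ _⟩
  map_target' _ h := h.1
  left_inv' := by
    rintro ⟨p, v, Q⟩ ⟨⟨hE, hL⟩, hl⟩
    change TotalSpace.mk' (FE × ℂ) p (extFrame φ x₀ i p (extCoord φ x₀ i p (.mk φ p v Q))) = _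
    rw [extCoord_mk]
    simp only [extFrame]
    rw [Trivialization.symmₗ_linearMapAt _ hE, Trivialization.symmₗ_linearMapAt _ hL,
      quadOf_tautSection hl, add_sub_cancel_right]
    rfl
  right_inv' := by
    rintro ⟨p, u, c⟩ ⟨⟨⟨hE, hL⟩, hl⟩, -⟩
    change (p, extCoord φ x₀ i p (extFrame φ x₀ i p (u, c))) = _
    simp only [extFrame]
    rw [extCoord_mk, quadOf_apply, ProjLine.coe_tautSection hl]
    simp [ProjLine.affinePoint, Trivialization.linearMapAt_symmₗ _ hE,
      Trivialization.linearMapAt_symmₗ _ hL]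
  open_target := by
    refine IsOpen.prod (IsOpen.prod ?_ (ProjLine.isOpen_chart i)) isOpen_univ
    exact (trivializationAt FE E x₀).open_baseSet.inter (trivializationAt ℂ L x₀).open_baseSet
  baseSet := extBaseSet (FE := FE) (E := E) (L := L) x₀ i
  open_baseSet := IsOpen.prod
    ((trivializationAt FE E x₀).open_baseSet.inter (trivializationAt ℂ L x₀).open_baseSet)
    (ProjLine.isOpen_chart i)
  source_eq := rfl
  target_eq := rfl
  proj_toFun _ _ := rfl

theorem extPretrivialization_symm (x₀ : X) (i : Fin 2) {p : X × ProjLine}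
    (hp : p ∈ extBaseSet (FE := FE) (E := E) (L := L) x₀ i) (u : FE × ℂ) :
    (extPretrivialization φ x₀ i).symm p u = extFrame φ x₀ i p u := by
  rw [Pretrivialization.symm_apply _ hp]
  rfl

instance (x₀ : X) (i : Fin 2) : (extPretrivialization φ x₀ i).IsLinear ℂ where
  linear p _ := (extCoord φ x₀ i p).isLinear

/-- The holomorphic function `f_j m² - f_i` of a point of `P¹`, where `m` is the `i`-th coordinate
of the vector with `j`-th coordinate `1`. -/
theorem extPrimitive_transition {i j : Fin 2} {l : ProjLine} (hi : l.rep i ≠ 0)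
    (hj : l.rep j ≠ 0) :
    extPrimitive j l * ProjLine.affinePoint j (ProjLine.coord j l) i ^ 2 - extPrimitive i l =
      if i = j then 0 else if i = 0 then -ProjLine.coord j l else ProjLine.coord j l := by
  by_cases hij : i = j
  · subst hij
    simp [ProjLine.affinePoint]
  · have hc : ProjLine.coord i l = (ProjLine.coord j l)⁻¹ := by
      have h1 : 1 - i = j := by omega
      have h2 : 1 - j = i := by omega
      rw [ProjLine.coord, ProjLine.coord, h1, h2, inv_div]
    have hne : ProjLine.coord j l ≠ 0 := by
      have h2 : 1 - j = i := by omega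
      rw [ProjLine.coord, h2]
      exact div_ne_zero hi hj
    have key : ∀ w : ℂ, w ≠ 0 →
        conj w * w ^ 2 / (1 + ‖w‖ ^ 2 : ℝ) + conj w⁻¹ / (1 + ‖w⁻¹‖ ^ 2 : ℝ) = w := by
      intro w hw
      have hw' : conj w ≠ 0 := by simpa using hw
      have hn : ((1 + ‖w‖ ^ 2 : ℝ) : ℂ) = 1 + w * conj w := by
        rw [Complex.mul_conj, Complex.normSq_eq_norm_sq]
        push_cast
        ring
      have hn' : ((1 + ‖w⁻¹‖ ^ 2 : ℝ) : ℂ) = 1 + w⁻¹ * (conj w)⁻¹ := by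
        rw [← map_inv₀, Complex.mul_conj, Complex.normSq_eq_norm_sq]
        push_cast
        ring
      have hne : 1 + w * conj w ≠ 0 := by
        rw [← hn]
        exact_mod_cast (by positivity : (1 + ‖w‖ ^ 2 : ℝ) ≠ 0)
      rw [hn, hn', map_inv₀]
      have h3 : 1 + w⁻¹ * (conj w)⁻¹ = (1 + w * conj w) / (w * conj w) := by
        field_simp
        ring
      have h4 : (conj w)⁻¹ * (w * conj w) = w := by
        field_simp
      rw [h3, div_div_eq_mul_div, h4, ← add_div, div_eq_iff hne]
      ring
    have hk := key _ hne
    rw [extPrimitive, extPrimitive, hc]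
    simp only [ProjLine.affinePoint, hij, if_false]
    rcases (by omega : i = 0 ∧ j = 1 ∨ i = 1 ∧ j = 0) with ⟨rfl, rfl⟩ | ⟨rfl, rfl⟩
    · simp only [one_ne_zero, if_true, if_false]
      linear_combination -hk
    · simp only [one_ne_zero, if_true, if_false]
      linear_combination hk

/-- The transition functions between the local holomorphic frames of `𝓕`. -/
def extTransition (x₀ x₁ : X) (i j : Fin 2) (p : X × ProjLine) : FE × ℂ →L[ℂ] FE × ℂ :=
  (ContinuousLinearMap.inl ℂ FE ℂ ∘L
      ((trivializationAt FE E x₀).coordChangeL ℂ (trivializationAt FE E x₁) p.1 : FE →L[ℂ] FE) ∘L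
      ContinuousLinearMap.fst ℂ FE ℂ) +
    (ContinuousLinearMap.snd ℂ FE ℂ).smulRight
      (((if i = j then 0 else if i = 0 then -ProjLine.coord j p.2 else ProjLine.coord j p.2) •
          (trivializationAt FE E x₁
            ⟨p.1, φ.toFun p.1 ((trivializationAt ℂ L x₀).symmₗ ℂ p.1 1)⟩).2,
        ProjLine.affinePoint j (ProjLine.coord j p.2) i ^ 2 *
          (trivializationAt ℂ L x₀).coordChangeL ℂ (trivializationAt ℂ L x₁) p.1 1) : FE × ℂ)

theorem extTransition_apply {x₀ x₁ : X} {i j : Fin 2} {p : X × ProjLine}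
    (hp : p ∈ extBaseSet (FE := FE) (E := E) (L := L) x₀ i)
    (hp' : p ∈ extBaseSet (FE := FE) (E := E) (L := L) x₁ j) (u : FE × ℂ) :
    extTransition φ x₀ x₁ i j p u = extCoord φ x₁ j p (extFrame φ x₀ i p u) := by
  obtain ⟨⟨hE, hL⟩, hl⟩ := hp
  obtain ⟨⟨hE', hL'⟩, hl'⟩ := hp'
  obtain ⟨u, c⟩ := u
  have hc : (trivializationAt ℂ L x₀).symmₗ ℂ p.1 c =
      c • (trivializationAt ℂ L x₀).symmₗ ℂ p.1 1 := by
    rw [← map_smul, smul_eq_mul, mul_one]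
  simp only [extFrame]
  rw [extCoord_mk, quadOf_apply, ProjLine.coe_tautSection hl', hc, extTransition,
    ← extPrimitive_transition hl hl']
  simp only [add_apply, ContinuousLinearMap.comp_apply,
    ContinuousLinearMap.smulRight_apply, ContinuousLinearMap.coe_fst', ContinuousLinearMap.coe_snd',
    ContinuousLinearMap.inl_apply, ContinuousLinearEquiv.coe_coe, map_smul, map_add, map_sub]
  rw [Trivialization.coordChangeL_apply _ _ ⟨hE, hE'⟩, Trivialization.coordChangeL_apply _ _ ⟨hL, hL'⟩]
  rw [← Trivialization.symmₗ_apply (R := ℂ) _ hE, ← Trivialization.symmₗ_apply (R := ℂ) _ hL]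
  simp only [Trivialization.coe_linearMapAt_of_mem _ hE', Trivialization.coe_linearMapAt_of_mem _ hL']
  ext
  · simp only [Prod.smul_mk, Prod.mk_add_mk]
    module
  · simp only [Prod.smul_mk, Prod.mk_add_mk, smul_eq_mul]
    ring

section

variable [ContMDiffVectorBundle ω FE E I] [ContMDiffVectorBundle ω ℂ L I]

theorem contMDiffOn_extTransition (x₀ x₁ : X) (i j : Fin 2) :
    ContMDiffOn (I.prod 𝓘(ℂ, ℂ)) 𝓘(ℂ, FE × ℂ →L[ℂ] FE × ℂ) ω (extTransition φ x₀ x₁ i j)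
      (extBaseSet (FE := FE) (E := E) (L := L) x₀ i ∩
        extBaseSet (FE := FE) (E := E) (L := L) x₁ j) := by
  set S := extBaseSet (FE := FE) (E := E) (L := L) x₀ i ∩
    extBaseSet (FE := FE) (E := E) (L := L) x₁ j with hS
  have hfst : ContMDiffOn (I.prod 𝓘(ℂ, ℂ)) I ω (Prod.fst : X × ProjLine → X) S := contMDiffOn_fst
  have hsnd : ContMDiffOn (I.prod 𝓘(ℂ, ℂ)) 𝓘(ℂ, ℂ) ω (Prod.snd : X × ProjLine → ProjLine) S :=
    contMDiffOn_snd
  have hcoord : ContMDiffOn (I.prod 𝓘(ℂ, ℂ)) 𝓘(ℂ, ℂ) ω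
      (fun p : X × ProjLine => ProjLine.coord j p.2) S :=
    (ProjLine.contMDiffOn_coord j).comp hsnd fun p hp => hp.2.2
  have hA : ContMDiffOn (I.prod 𝓘(ℂ, ℂ)) 𝓘(ℂ, FE →L[ℂ] FE) ω
      (fun p : X × ProjLine => ((trivializationAt FE E x₀).coordChangeL ℂ
        (trivializationAt FE E x₁) p.1 : FE →L[ℂ] FE)) S :=
    (contMDiffOn_coordChangeL (trivializationAt FE E x₀) (trivializationAt FE E x₁)).comp hfst
      fun p hp => ⟨hp.1.1.1, hp.2.1.1⟩
  have hB : ContMDiffOn (I.prod 𝓘(ℂ, ℂ)) 𝓘(ℂ, ℂ →L[ℂ] ℂ) ω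
      (fun p : X × ProjLine => ((trivializationAt ℂ L x₀).coordChangeL ℂ
        (trivializationAt ℂ L x₁) p.1 : ℂ →L[ℂ] ℂ)) S :=
    (contMDiffOn_coordChangeL (trivializationAt ℂ L x₀) (trivializationAt ℂ L x₁)).comp hfst
      fun p hp => ⟨hp.1.1.2, hp.2.1.2⟩
  have hφ : ContMDiffOn (I.prod 𝓘(ℂ, ℂ)) 𝓘(ℂ, FE) ω
      (fun p : X × ProjLine => (trivializationAt FE E x₁
        ⟨p.1, φ.toFun p.1 ((trivializationAt ℂ L x₀).symmₗ ℂ p.1 1)⟩).2) S := by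
    have h0 : ∀ p ∈ S, (trivializationAt ℂ L x₀).toOpenPartialHomeomorph.symm (p.1, 1) =
        (⟨p.1, (trivializationAt ℂ L x₀).symmₗ ℂ p.1 1⟩ : TotalSpace ℂ L) := fun p hp => by
      rw [Trivialization.symmₗ_apply (R := ℂ) _ hp.1.1.2, Trivialization.mk_symm _ hp.1.1.2]
    have h1 : ContMDiffOn (I.prod 𝓘(ℂ, ℂ)) (I.prod 𝓘(ℂ, ℂ)) ω
        (fun p : X × ProjLine =>
          (⟨p.1, (trivializationAt ℂ L x₀).symmₗ ℂ p.1 1⟩ : TotalSpace ℂ L)) S := by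
      refine ContMDiffOn.congr ?_ fun p hp => (h0 p hp).symm
      exact (Trivialization.contMDiffOn_symm (IB := I) (n := ω) (trivializationAt ℂ L x₀)).comp
        (hfst.prodMk (contMDiffOn_const (c := (1 : ℂ)))) fun p hp =>
          (trivializationAt ℂ L x₀).mem_target.2 hp.1.1.2
    have h2 := (Trivialization.contMDiffOn (IB := I) (n := ω) (trivializationAt FE E x₁)).comp
      (φ.holomorphic.comp_contMDiffOn h1) fun p hp =>
        (trivializationAt FE E x₁).mem_source.2 hp.2.1.1
    exact contMDiff_snd.comp_contMDiffOn h2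
  have hψ : ContMDiffOn (I.prod 𝓘(ℂ, ℂ)) 𝓘(ℂ, ℂ) ω (fun p : X × ProjLine =>
      if i = j then 0 else if i = 0 then -ProjLine.coord j p.2 else ProjLine.coord j p.2) S := by
    split_ifs
    · exact contMDiffOn_const
    · exact hcoord.neg
    · exact hcoord
  have hm : ContMDiffOn (I.prod 𝓘(ℂ, ℂ)) 𝓘(ℂ, ℂ) ω (fun p : X × ProjLine =>
      ProjLine.affinePoint j (ProjLine.coord j p.2) i ^ 2) S :=
    ((ProjLine.contDiff_affinePoint j i).contMDiff.comp_contMDiffOn hcoord).pow 2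
  have h1 : ContMDiffOn (I.prod 𝓘(ℂ, ℂ)) 𝓘(ℂ, FE × ℂ →L[ℂ] FE × ℂ) ω
      (fun p : X × ProjLine => ContinuousLinearMap.inl ℂ FE ℂ ∘L
        ((trivializationAt FE E x₀).coordChangeL ℂ (trivializationAt FE E x₁) p.1 : FE →L[ℂ] FE) ∘L
        ContinuousLinearMap.fst ℂ FE ℂ) S :=
    contMDiffOn_const.clm_comp (hA.clm_comp contMDiffOn_const)
  have h2 := (hψ.smul hφ).prodMk_space
    (hm.smul (hB.clm_apply (contMDiffOn_const (c := (1 : ℂ)))))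
  have h3 := ((ContinuousLinearMap.smulRightL ℂ (FE × ℂ) (FE × ℂ)
    (ContinuousLinearMap.snd ℂ FE ℂ)).contDiff (n := ω)).contMDiff.comp_contMDiffOn h2
  exact h1.add h3

/-- The local holomorphic frames make `𝓕` a holomorphic vector bundle on `X × P¹`. -/
def extPrebundle : VectorPrebundle ℂ (FE × ℂ) (ExtFiber φ) where
  pretrivializationAtlas := {e | ∃ (x₀ : X) (i : Fin 2), e = extPretrivialization φ x₀ i}
  pretrivialization_linear' := by
    rintro _ ⟨x₀, i, rfl⟩
    infer_instance
  pretrivializationAt p := extPretrivialization φ p.1 (ProjLine.chartIndex p.2)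
  mem_base_pretrivializationAt p :=
    ⟨⟨mem_baseSet_trivializationAt FE E p.1, mem_baseSet_trivializationAt ℂ L p.1⟩,
      ProjLine.rep_chartIndex p.2⟩
  pretrivialization_mem_atlas p := ⟨p.1, ProjLine.chartIndex p.2, rfl⟩
  exists_coordChange := by
    rintro _ ⟨x₀, i, rfl⟩ _ ⟨x₁, j, rfl⟩
    refine ⟨extTransition φ x₀ x₁ i j, (contMDiffOn_extTransition φ x₀ x₁ i j).continuousOn, ?_⟩
    intro p hp u
    rw [extPretrivialization_symm φ x₀ i hp.1, extTransition_apply φ hp.1 hp.2]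
    rfl
  totalSpaceMk_isInducing p :=
    ((isEmbedding_prodMkRight p).isInducing).comp ⟨rfl⟩

instance : (extPrebundle φ).IsContMDiff (I.prod 𝓘(ℂ, ℂ)) ω where
  exists_contMDiffCoordChange := by
    rintro _ ⟨x₀, i, rfl⟩ _ ⟨x₁, j, rfl⟩
    refine ⟨extTransition φ x₀ x₁ i j, contMDiffOn_extTransition φ x₀ x₁ i j, ?_⟩
    intro p hp u
    rw [extPretrivialization_symm φ x₀ i hp.1, extTransition_apply φ hp.1 hp.2]
    rfl

instance : TopologicalSpace (TotalSpace (FE × ℂ) (ExtFiber φ)) :=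
  (extPrebundle φ).totalSpaceTopology

instance : FiberBundle (FE × ℂ) (ExtFiber φ) := (extPrebundle φ).toFiberBundle

instance : VectorBundle ℂ (FE × ℂ) (ExtFiber φ) := (extPrebundle φ).toVectorBundle

instance : ContMDiffVectorBundle ω (FE × ℂ) (ExtFiber φ) (I.prod 𝓘(ℂ, ℂ)) :=
  (extPrebundle φ).contMDiffVectorBundle (I.prod 𝓘(ℂ, ℂ))

end

/-! ### The action of `SU(2)` -/

/-- The group `SU(2)`. -/
abbrev SU2 : Type := Matrix.specialUnitaryGroup (Fin 2) ℂ

theorem SU2.inv_mulVec_mulVec (k : SU2) (v : Fin 2 → ℂ) :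
    (k⁻¹ : SU2).1 *ᵥ (k.1 *ᵥ v) = v := by
  have h : (k⁻¹ : SU2).1 * k.1 = 1 := congrArg Subtype.val (inv_mul_cancel k)
  rw [Matrix.mulVec_mulVec, h, Matrix.one_mulVec]

/-- The standard action of `SU(2)` on `P¹`. -/
def su2Line (k : SU2) (l : ProjLine) : ProjLine :=
  l.map (Matrix.mulVecLin k.1) (Function.LeftInverse.injective (SU2.inv_mulVec_mulVec k))

theorem inv_mulVec_mem (k : SU2) (l : ProjLine) (v : Fin 2 → ℂ)
    (hv : v ∈ (su2Line k l).submodule) : Matrix.mulVecLin (k⁻¹ : SU2).1 v ∈ l.submodule := by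
  induction l using Projectivization.ind with | h u hu =>
  rw [su2Line, Projectivization.map_mk, Projectivization.submodule_mk] at hv
  obtain ⟨a, rfl⟩ := Submodule.mem_span_singleton.1 hv
  rw [map_smul, Projectivization.submodule_mk, Matrix.mulVecLin_apply, Matrix.mulVecLin_apply,
    SU2.inv_mulVec_mulVec]
  exact Submodule.smul_mem _ _ (Submodule.mem_span_singleton_self u)

/-- The lift to `𝓕` of the action of `SU(2)` on `X × P¹`: trivial on `p^*E` and `p^*L`, standard on
`q^*O(2)`, that is, a quadratic map `Q` on the line `l` is sent to `Q ∘ k⁻¹` on the line `k l`. -/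
def extAction (k : SU2) (p : X × ProjLine) (w : ExtFiber φ p) :
    ExtFiber φ (p.1, su2Line k p.2) :=
  .mk φ (p.1, su2Line k p.2) w.1
    (w.2.comp ((Matrix.mulVecLin (k⁻¹ : SU2).1).restrict (inv_mulVec_mem k p.2)))

end Extension

/-! ### The equations -/

section Equations

variable {n r : ℕ} {X : Type*} [TopologicalSpace X] [ChartedSpace (Fin n → ℂ) X]
  [IsManifold 𝓘(ℂ, Fin n → ℂ) ω X]
  {E : X → Type*} [TopologicalSpace (TotalSpace (Fin r → ℂ) E)]
  [∀ x, AddCommGroup (E x)] [∀ x, Module ℂ (E x)] [∀ x, TopologicalSpace (E x)]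
  [FiberBundle (Fin r → ℂ) E] [VectorBundle ℂ (Fin r → ℂ) E]
  {L : X → Type*} [TopologicalSpace (TotalSpace ℂ L)]
  [∀ x, AddCommGroup (L x)] [∀ x, Module ℂ (L x)] [∀ x, TopologicalSpace (L x)]
  [FiberBundle ℂ L] [VectorBundle ℂ ℂ L]

/-- The coupled vortex equations `iΛF_H + φ ⊗ φ^* = t I_E` and `iΛF_K - |φ|² = t'` for Hermitian
metrics `H` on `E` and `K` on `L`. Here `φ^*` is the adjoint of `φ` with respect to `H` and `K`, so
that `φ ⊗ φ^*` is the endomorphism `φ φ^*` of `E` and `|φ|²` is the endomorphism `φ^* φ` of `L`. -/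
def CoupledVortexEquations
    (g : HermitianMetric 𝓘(ℂ, Fin n → ℂ) (Fin n → ℂ) (TangentSpace 𝓘(ℂ, Fin n → ℂ) : X → Type _))
    (φ : HolomorphicHom 𝓘(ℂ, Fin n → ℂ) (Fin r → ℂ) E L) (t t' : X → ℝ)
    (H : HermitianMetric 𝓘(ℂ, Fin n → ℂ) (Fin r → ℂ) E)
    (K : HermitianMetric 𝓘(ℂ, Fin n → ℂ) ℂ L) : Prop :=
  ∃ φs : ∀ x, E x →ₗ[ℂ] L x,
    (∀ x v w, K.form x (φs x v) w = H.form x v (φ.toFun x w)) ∧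
    ∀ x,
      meanCurvature 𝓘(ℂ, Fin n → ℂ) (Pi.basisFun ℂ (Fin n)) (Pi.basisFun ℂ (Fin r)) g.form H.form x
          + φ.toFun x ∘ₗ φs x = (t x : ℂ) • LinearMap.id ∧
      meanCurvature 𝓘(ℂ, Fin n → ℂ) (Pi.basisFun ℂ (Fin n)) (Module.Basis.singleton Unit ℂ)
          g.form K.form x - φs x ∘ₗ φ.toFun x = (t' x : ℂ) • LinearMap.id

variable [ContMDiffVectorBundle ω (Fin r → ℂ) E 𝓘(ℂ, Fin n → ℂ)]
  [ContMDiffVectorBundle ω ℂ L 𝓘(ℂ, Fin n → ℂ)]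
  {φ : HolomorphicHom 𝓘(ℂ, Fin n → ℂ) (Fin r → ℂ) E L}

/-- The metric `h` on `𝓕` is invariant under the action of `SU(2)`. -/
def IsSU2Invariant
    (h : HermitianMetric (𝓘(ℂ, Fin n → ℂ).prod 𝓘(ℂ, ℂ)) ((Fin r → ℂ) × ℂ) (ExtFiber φ)) : Prop :=
  ∀ (k : SU2) (p : X × ProjLine) (w w' : ExtFiber φ p),
    h.form (p.1, su2Line k p.2) (extAction φ k p w) (extAction φ k p w') = h.form p w w'

/-- The deformed Hermitian-Einstein equation
`iΛ_σ F_h = s I + diag ((t - s) I₁, (t' - s') I₂)` for a Hermitian metric `h` on `𝓕`, with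
respect to the Kähler form `p^*ω + σ q^*ω_{P¹}`. The block form refers to the `h`-orthogonal
splitting of `𝓕` into `p^*E` (whose elements are `w₁`) and its complement (whose elements are
`w₂`). -/
def DeformedHermitianEinstein
    (g : HermitianMetric 𝓘(ℂ, Fin n → ℂ) (Fin n → ℂ) (TangentSpace 𝓘(ℂ, Fin n → ℂ) : X → Type _))
    (σ s s' : ℝ) (t t' : X → ℝ)
    (h : HermitianMetric (𝓘(ℂ, Fin n → ℂ).prod 𝓘(ℂ, ℂ)) ((Fin r → ℂ) × ℂ) (ExtFiber φ)) : Prop :=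
  ∀ (p : X × ProjLine) (w₁ w₂ : ExtFiber φ p),
    (∃ v : E p.1, w₁ = .mk φ p v 0) → (∀ v : E p.1, h.form p (.mk φ p v 0) w₂ = 0) →
      meanCurvature (𝓘(ℂ, Fin n → ℂ).prod 𝓘(ℂ, ℂ))
          ((Pi.basisFun ℂ (Fin n)).prod (Module.Basis.singleton Unit ℂ))
          ((Pi.basisFun ℂ (Fin r)).prod (Module.Basis.singleton Unit ℂ))
          (prodMetric g.form σ) h.form p (w₁ + w₂) =
        (s : ℂ) • (w₁ + w₂) +
          (((t p.1 - s : ℝ) : ℂ) • w₁ + ((t' p.1 - s' : ℝ) : ℂ) • w₂)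

end Equations

end CoupledVortex

end

/-!
The two metrics in the theorem determine each other: a pair `(H, K)` corresponds to the metric
`h = H ⊕ c (K ⊗ h₀)` on `p^*E ⊕ p^*L ⊗ q^*O(2)`, where `h₀` is the standard metric of `O(2)` and
`c = 2π/σ`. Everything is a pointwise computation.

Curvature. In the local holomorphic frame `e_a`, `q ⊗ w - f φ(w)` of the extension the Gram matrix
of `h` is `Pᴴ D P`, where `D` is the block diagonal matrix of the Gram matrices of `H` and
`c K ⊗ h₀`, and `P` is unipotent with off-diagonal block `-f Φ`; here `Φ` is the matrix of `φ` and
`f = ± ā / (1 + |a|²)` the primitive of `α`. In the directions of `X` the matrix `P` is holomorphic,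
so `F_h` is `P⁻¹ diag(F_H, F_K) P` (`chernCurvature_extGram_of_const`). In the direction of `P¹`
only `f` and the weight `(1 + |a|²)⁻²` vary and the curvature is computed explicitly
(`chernCurvature_extGram_vertical`): it consists of the curvature of `O(2)` and of the terms `φ φ^*`
and `-φ^* φ` produced by the second fundamental form `φ ⊗ α`. The form `ω_σ` has no mixed terms, so
only these two parts contribute to `iΛ_σ F_h`, and for `c = 2π/σ` the result is
`diag(iΛF_H + φ φ^*, iΛF_K - φ^* φ + 4π/σ)` with respect to the smooth splitting
(`meanCurvature_splitForm`). The splitting is `h`-orthogonal and `4π/σ` is the difference of the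
averages of `t` and `t'`, so the deformed Hermitian-Einstein equation for `h` is the system of
vortex equations for `(H, K)` (`deformedHermitianEinstein_iff`).

Invariance. The metric `h` is `SU(2)`-invariant (`isSU2Invariant_splitMetric`), and every
invariant metric is of this form (`IsSU2Invariant.exists_eq_splitForm`). Indeed the element
`diag(i, -i)` fixes the point `[1 : 0]` and acts by `-1` on the fibre of `O(2)` there, so the two
summands are orthogonal over `X × {[1 : 0]}`; the restriction of the metric to this slice defines
`H` and `K`, and transitivity of `SU(2)` on `P¹` determines the metric everywhere else.
-/

noncomputable section

namespace CoupledVortex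

open Filter Topology

/-! ### Wirtinger calculus -/

section Wirtinger

variable {W : Type*} [NormedAddCommGroup W] [NormedSpace ℂ W]

theorem del_congr {f g : W → ℂ} {z : W} (h : f =ᶠ[𝓝 z] g) (v : W) : del f z v = del g z v := by
  rw [del, del, h.fderiv_eq]

theorem delbar_congr {f g : W → ℂ} {z : W} (h : f =ᶠ[𝓝 z] g) (v : W) :
    delbar f z v = delbar g z v := by
  rw [delbar, delbar, h.fderiv_eq]

theorem del_const (c : ℂ) (z v : W) : del (fun _ => c) z v = 0 := by
  simp [del]

theorem delbar_const (c : ℂ) (z v : W) : delbar (fun _ => c) z v = 0 := by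
  simp [delbar]

theorem del_mul {f g : W → ℂ} {z : W} (hf : DifferentiableAt ℝ f z) (hg : DifferentiableAt ℝ g z)
    (v : W) : del (fun w => f w * g w) z v = del f z v * g z + f z * del g z v := by
  simp only [del, fderiv_fun_mul hf hg, _root_.add_apply, _root_.smul_apply, smul_eq_mul]
  ring

theorem delbar_mul {f g : W → ℂ} {z : W} (hf : DifferentiableAt ℝ f z)
    (hg : DifferentiableAt ℝ g z) (v : W) :
    delbar (fun w => f w * g w) z v = delbar f z v * g z + f z * delbar g z v := by
  simp only [delbar, fderiv_fun_mul hf hg, _root_.add_apply, _root_.smul_apply, smul_eq_mul]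
  ring

theorem del_add {f g : W → ℂ} {z : W} (hf : DifferentiableAt ℝ f z) (hg : DifferentiableAt ℝ g z)
    (v : W) : del (fun w => f w + g w) z v = del f z v + del g z v := by
  simp only [del, fderiv_fun_add hf hg, _root_.add_apply]
  ring

theorem delbar_add {f g : W → ℂ} {z : W} (hf : DifferentiableAt ℝ f z)
    (hg : DifferentiableAt ℝ g z) (v : W) :
    delbar (fun w => f w + g w) z v = delbar f z v + delbar g z v := by
  simp only [delbar, fderiv_fun_add hf hg, _root_.add_apply]
  ring

theorem del_sum {ι : Type*} (s : Finset ι) {f : ι → W → ℂ} {z : W}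
    (hf : ∀ i ∈ s, DifferentiableAt ℝ (f i) z) (v : W) :
    del (fun w => ∑ i ∈ s, f i w) z v = ∑ i ∈ s, del (f i) z v := by
  simp only [del, fderiv_fun_sum hf, sum_apply, Finset.mul_sum,
    ← Finset.sum_sub_distrib, Finset.sum_div]

theorem delbar_sum {ι : Type*} (s : Finset ι) {f : ι → W → ℂ} {z : W}
    (hf : ∀ i ∈ s, DifferentiableAt ℝ (f i) z) (v : W) :
    delbar (fun w => ∑ i ∈ s, f i w) z v = ∑ i ∈ s, delbar (f i) z v := by
  simp only [delbar, fderiv_fun_sum hf, sum_apply, Finset.mul_sum,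
    ← Finset.sum_add_distrib, Finset.sum_div]

theorem fderiv_conj (f : W → ℂ) (z v : W) :
    fderiv ℝ (fun w => conj (f w)) z v = conj (fderiv ℝ f z v) := by
  have h := Complex.conjCLE.comp_fderiv (f := f) (x := z)
  have h' : (fun w => conj (f w)) = Complex.conjCLE ∘ f := by
    ext w
    simp
  rw [h', h]
  simp

theorem del_conj (f : W → ℂ) (z v : W) :
    del (fun w => conj (f w)) z v = conj (delbar f z v) := by
  simp [del, delbar, fderiv_conj, sub_eq_add_neg, map_ofNat]

theorem delbar_conj (f : W → ℂ) (z v : W) :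
    delbar (fun w => conj (f w)) z v = conj (del f z v) := by
  simp [del, delbar, fderiv_conj, sub_eq_add_neg, map_ofNat]

theorem delbar_eq_zero {f : W → ℂ} {z : W} (hf : DifferentiableAt ℂ f z) (v : W) :
    delbar f z v = 0 := by
  simp only [delbar, hf.fderiv_restrictScalars ℝ, ContinuousLinearMap.coe_restrictScalars',
    map_smul, smul_eq_mul]
  linear_combination (fderiv ℂ f z v / 2) * Complex.I_mul_I

theorem del_eq_fderiv {f : W → ℂ} {z : W} (hf : DifferentiableAt ℂ f z) (v : W) :
    del f z v = fderiv ℂ f z v := by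
  simp only [del, hf.fderiv_restrictScalars ℝ, ContinuousLinearMap.coe_restrictScalars',
    map_smul, smul_eq_mul]
  linear_combination (-fderiv ℂ f z v / 2) * Complex.I_mul_I

theorem contDiffAt_del {f : W → ℂ} {z : W} {m n : WithTop ℕ∞} (hf : ContDiffAt ℝ n f z)
    (hmn : m + 1 ≤ n) (v : W) : ContDiffAt ℝ m (fun w => del f w v) z := by
  have h := hf.fderiv_right hmn
  have h1 (u : W) : ContDiffAt ℝ m (fun w => fderiv ℝ f w u) z := h.clm_apply contDiffAt_const
  exact ((h1 v).sub (contDiffAt_const.mul (h1 _))).div_const 2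

variable {W' : Type*} [NormedAddCommGroup W'] [NormedSpace ℂ W']

theorem fderiv_comp_affine {f : W → ℂ} (T : W' →L[ℂ] W) (c : W) {z : W'}
    (hf : DifferentiableAt ℝ f (T z + c)) (v : W') :
    fderiv ℝ (fun w => f (T w + c)) z v = fderiv ℝ f (T z + c) (T v) := by
  have h1 : HasFDerivAt (fun w => T w + c) (T.restrictScalars ℝ) z :=
    ((T.restrictScalars ℝ).hasFDerivAt).add_const c
  have h2 : HasFDerivAt (fun w => f (T w + c))
      ((fderiv ℝ f (T z + c)).comp (T.restrictScalars ℝ)) z :=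
    hf.hasFDerivAt.comp (f := fun w => T w + c) z h1
  rw [h2.fderiv]
  rfl

theorem del_comp_affine {f : W → ℂ} (T : W' →L[ℂ] W) (c : W) {z : W'}
    (hf : DifferentiableAt ℝ f (T z + c)) (v : W') :
    del (fun w => f (T w + c)) z v = del f (T z + c) (T v) := by
  simp only [del, fderiv_comp_affine T c hf, map_smul]

theorem delbar_comp_affine {f : W → ℂ} (T : W' →L[ℂ] W) (c : W) {z : W'}
    (hf : DifferentiableAt ℝ f (T z + c)) (v : W') :
    delbar (fun w => f (T w + c)) z v = delbar f (T z + c) (T v) := by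
  simp only [delbar, fderiv_comp_affine T c hf, map_smul]

end Wirtinger

/-! ### Matrix-valued functions -/

section MatrixCalculus

variable {W : Type*} [NormedAddCommGroup W] [NormedSpace ℂ W] {κ μ ν : Type*}

/-- The entrywise derivative `∂_v A` of a matrix-valued function. -/
def matDel (A : W → Matrix κ μ ℂ) (z v : W) : Matrix κ μ ℂ :=
  Matrix.of fun a b => del (fun w => A w a b) z v

/-- The entrywise derivative `∂̄_v A` of a matrix-valued function. -/
def matDelbar (A : W → Matrix κ μ ℂ) (z v : W) : Matrix κ μ ℂ :=
  Matrix.of fun a b => delbar (fun w => A w a b) z v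

/-- All entries of the matrix-valued function `A` are `Cⁿ` over `𝕜` at `z`. There is no preferred
norm on matrices, so smoothness is expressed through the entries. -/
def MatContDiffAt (𝕜 : Type*) [NontriviallyNormedField 𝕜] [NormedSpace 𝕜 W] [NormedSpace 𝕜 ℂ]
    (n : WithTop ℕ∞) (A : W → Matrix κ μ ℂ) (z : W) : Prop :=
  ∀ a b, ContDiffAt 𝕜 n (fun w => A w a b) z

variable {A : W → Matrix κ μ ℂ} {B : W → Matrix μ ν ℂ} {z : W} {m n : WithTop ℕ∞}

theorem matDel_congr {A' : W → Matrix κ μ ℂ} (h : A =ᶠ[𝓝 z] A') (v : W) :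
    matDel A z v = matDel A' z v := by
  ext a b
  exact del_congr (h.mono fun w hw => by rw [hw]) v

theorem matDelbar_congr {A' : W → Matrix κ μ ℂ} (h : A =ᶠ[𝓝 z] A') (v : W) :
    matDelbar A z v = matDelbar A' z v := by
  ext a b
  exact delbar_congr (h.mono fun w hw => by rw [hw]) v

theorem MatContDiffAt.congr {A' : W → Matrix κ μ ℂ} (hA : MatContDiffAt ℝ n A z)
    (h : A' =ᶠ[𝓝 z] A) : MatContDiffAt ℝ n A' z :=
  fun a b => (hA a b).congr_of_eventuallyEq (h.mono fun w hw => by simp only [hw])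

theorem MatContDiffAt.differentiableAt (hA : MatContDiffAt ℝ n A z) (hn : n ≠ 0) (a : κ) (b : μ) :
    DifferentiableAt ℝ (fun w => A w a b) z :=
  (hA a b).differentiableAt hn

theorem MatContDiffAt.const (C : Matrix κ μ ℂ) : MatContDiffAt ℝ n (fun _ : W => C) z :=
  fun _ _ => contDiffAt_const

theorem MatContDiffAt.of_le (hA : MatContDiffAt ℝ n A z) (h : m ≤ n) : MatContDiffAt ℝ m A z :=
  fun a b => (hA a b).of_le h

theorem MatContDiffAt.eventually [Finite κ] [Finite μ] (hA : MatContDiffAt ℝ n A z) (hn : n ≠ ∞) :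
    ∀ᶠ w in 𝓝 z, MatContDiffAt ℝ n A w := by
  simp only [MatContDiffAt, eventually_all]
  exact fun a b => (hA a b).eventually hn

theorem MatContDiffAt.restrict_scalars (hA : MatContDiffAt ℂ n A z) : MatContDiffAt ℝ n A z :=
  fun a b => (hA a b).restrict_scalars ℝ

theorem MatContDiffAt.mul [Fintype μ] (hA : MatContDiffAt ℝ n A z) (hB : MatContDiffAt ℝ n B z) :
    MatContDiffAt ℝ n (fun w => A w * B w) z := fun a b => by
  simp only [Matrix.mul_apply]
  exact ContDiffAt.sum fun c _ => (hA a c).mul (hB c b)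

theorem MatContDiffAt.smul {f : W → ℂ} (hf : ContDiffAt ℝ n f z) (hA : MatContDiffAt ℝ n A z) :
    MatContDiffAt ℝ n (fun w => f w • A w) z := fun a b => hf.mul (hA a b)

theorem MatContDiffAt.conjTranspose (hA : MatContDiffAt ℝ n A z) :
    MatContDiffAt ℝ n (fun w => (A w)ᴴ) z := fun a b =>
  Complex.conjCLE.contDiff.contDiffAt.comp z (hA b a)

theorem MatContDiffAt.fromBlocks {κ' μ' : Type*} {B : W → Matrix κ μ' ℂ} {C : W → Matrix κ' μ ℂ}
    {D : W → Matrix κ' μ' ℂ} (hA : MatContDiffAt ℝ n A z) (hB : MatContDiffAt ℝ n B z)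
    (hC : MatContDiffAt ℝ n C z) (hD : MatContDiffAt ℝ n D z) :
    MatContDiffAt ℝ n (fun w => Matrix.fromBlocks (A w) (B w) (C w) (D w)) z := by
  rintro (a | a) (b | b)
  exacts [hA a b, hB a b, hC a b, hD a b]

theorem MatContDiffAt.det [Fintype κ] [DecidableEq κ] {A : W → Matrix κ κ ℂ}
    (hA : MatContDiffAt ℝ n A z) : ContDiffAt ℝ n (fun w => (A w).det) z := by
  simp only [Matrix.det_apply']
  exact ContDiffAt.sum fun σ _ => contDiffAt_const.mul (contDiffAt_prod fun i _ => hA _ _)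

theorem MatContDiffAt.inv [Fintype κ] [DecidableEq κ] {A : W → Matrix κ κ ℂ}
    (hA : MatContDiffAt ℝ n A z) (h : (A z).det ≠ 0) :
    MatContDiffAt ℝ n (fun w => (A w)⁻¹) z := fun a b => by
  simp only [Matrix.inv_def, Ring.inverse_eq_inv', Matrix.smul_apply, smul_eq_mul,
    Matrix.adjugate_apply]
  refine (hA.det.inv h).mul (MatContDiffAt.det (A := fun w => (A w).updateRow b (Pi.single a 1))
    fun c d => ?_)
  rcases eq_or_ne c b with rfl | hc
  · simpa using contDiffAt_const
  · simpa [Matrix.updateRow_ne hc] using hA c d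

theorem MatContDiffAt.matDel (hA : MatContDiffAt ℝ n A z) (hmn : m + 1 ≤ n) (v : W) :
    MatContDiffAt ℝ m (fun w => matDel A w v) z :=
  fun a b => contDiffAt_del (hA a b) hmn v

theorem MatContDiffAt.eventually_det_ne_zero [Fintype κ] [DecidableEq κ] {A : W → Matrix κ κ ℂ}
    (hA : MatContDiffAt ℝ n A z) (h : (A z).det ≠ 0) : ∀ᶠ w in 𝓝 z, (A w).det ≠ 0 :=
  hA.det.continuousAt.eventually_ne h

theorem matDel_mul [Fintype μ] (hA : ∀ a b, DifferentiableAt ℝ (fun w => A w a b) z)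
    (hB : ∀ a b, DifferentiableAt ℝ (fun w => B w a b) z) (v : W) :
    matDel (fun w => A w * B w) z v = matDel A z v * B z + A z * matDel B z v := by
  ext a b
  simp only [matDel, Matrix.of_apply, Matrix.add_apply, Matrix.mul_apply]
  rw [del_sum _ fun c _ => (hA a c).fun_mul (hB c b), ← Finset.sum_add_distrib]
  exact Finset.sum_congr rfl fun c _ => del_mul (hA a c) (hB c b) v

theorem matDelbar_mul [Fintype μ] (hA : ∀ a b, DifferentiableAt ℝ (fun w => A w a b) z)
    (hB : ∀ a b, DifferentiableAt ℝ (fun w => B w a b) z) (v : W) :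
    matDelbar (fun w => A w * B w) z v = matDelbar A z v * B z + A z * matDelbar B z v := by
  ext a b
  simp only [matDelbar, Matrix.of_apply, Matrix.add_apply, Matrix.mul_apply]
  rw [delbar_sum _ fun c _ => (hA a c).fun_mul (hB c b), ← Finset.sum_add_distrib]
  exact Finset.sum_congr rfl fun c _ => delbar_mul (hA a c) (hB c b) v

theorem matDelbar_add {A' : W → Matrix κ μ ℂ} (hA : ∀ a b, DifferentiableAt ℝ (fun w => A w a b) z)
    (hA' : ∀ a b, DifferentiableAt ℝ (fun w => A' w a b) z) (v : W) :
    matDelbar (fun w => A w + A' w) z v = matDelbar A z v + matDelbar A' z v := by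
  ext a b
  exact delbar_add (hA a b) (hA' a b) v

theorem matDel_smul_const {f : W → ℂ} (hf : DifferentiableAt ℝ f z) (C : Matrix κ μ ℂ) (v : W) :
    matDel (fun w => f w • C) z v = del f z v • C := by
  ext a b
  exact (del_mul hf (differentiableAt_const _) v).trans (by simp [del_const])

theorem matDelbar_smul_const {f : W → ℂ} (hf : DifferentiableAt ℝ f z) (C : Matrix κ μ ℂ) (v : W) :
    matDelbar (fun w => f w • C) z v = delbar f z v • C := by
  ext a b
  exact (delbar_mul hf (differentiableAt_const _) v).trans (by simp [delbar_const])

theorem matDel_smul_add_smul {f g : W → ℂ} (hf : DifferentiableAt ℝ f z)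
    (hg : DifferentiableAt ℝ g z) (C C' : Matrix κ μ ℂ) (v : W) :
    matDel (fun w => f w • C + g w • C') z v = del f z v • C + del g z v • C' := by
  rw [← matDel_smul_const hf, ← matDel_smul_const hg]
  ext a b
  exact del_add (hf.fun_mul (differentiableAt_const _)) (hg.fun_mul (differentiableAt_const _)) v

theorem matDel_const (C : Matrix κ μ ℂ) (z v : W) : matDel (fun _ => C) z v = 0 := by
  ext a b
  exact del_const _ z v

theorem matDelbar_const (C : Matrix κ μ ℂ) (z v : W) : matDelbar (fun _ => C) z v = 0 := by
  ext a b
  exact delbar_const _ z v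

theorem matDel_fromBlocks {κ' μ' : Type*} (A : W → Matrix κ μ ℂ) (B : W → Matrix κ μ' ℂ)
    (C : W → Matrix κ' μ ℂ) (D : W → Matrix κ' μ' ℂ) (z v : W) :
    matDel (fun w => Matrix.fromBlocks (A w) (B w) (C w) (D w)) z v =
      Matrix.fromBlocks (matDel A z v) (matDel B z v) (matDel C z v) (matDel D z v) := by
  ext (a | a) (b | b) <;> rfl

theorem matDelbar_fromBlocks {κ' μ' : Type*} (A : W → Matrix κ μ ℂ) (B : W → Matrix κ μ' ℂ)
    (C : W → Matrix κ' μ ℂ) (D : W → Matrix κ' μ' ℂ) (z v : W) :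
    matDelbar (fun w => Matrix.fromBlocks (A w) (B w) (C w) (D w)) z v =
      Matrix.fromBlocks (matDelbar A z v) (matDelbar B z v) (matDelbar C z v)
        (matDelbar D z v) := by
  ext (a | a) (b | b) <;> rfl

theorem matDelbar_eq_zero (hA : MatContDiffAt ℂ n A z) (hn : n ≠ 0) (v : W) :
    matDelbar A z v = 0 := by
  ext a b
  exact delbar_eq_zero ((hA a b).differentiableAt hn) v

theorem matDel_conjTranspose (A : W → Matrix κ μ ℂ) (z v : W) :
    matDel (fun w => (A w)ᴴ) z v = (matDelbar A z v)ᴴ := by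
  ext a b
  exact del_conj (fun w => A w b a) z v

/-- A derivative `∂_u A` of a holomorphic matrix-valued function is holomorphic. -/
theorem matDelbar_matDel_eq_zero (hA : MatContDiffAt ℂ 2 A z) (u v : W) :
    matDelbar (fun w => matDel A w u) z v = 0 := by
  ext a b
  have h1 : (fun w => del (fun w => A w a b) w u) =ᶠ[𝓝 z]
      fun w => fderiv ℂ (fun w => A w a b) w u :=
    ((hA a b).eventually (by simp)).mono fun w hw =>
      del_eq_fderiv (hw.differentiableAt two_ne_zero) u
  refine (delbar_congr h1 v).trans (delbar_eq_zero ?_ v)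
  exact (((hA a b).fderiv_right (m := 1) (by norm_num [one_add_one_eq_two])).clm_apply
    contDiffAt_const).differentiableAt one_ne_zero

end MatrixCalculus

/-! ### Functoriality of the Chern curvature -/

section ChernCurvature

variable {W : Type*} [NormedAddCommGroup W] [NormedSpace ℂ W] {κ μ : Type*}
  [Fintype κ] [DecidableEq κ] [Fintype μ] [DecidableEq μ]

theorem chernForm_eq (H : W → Matrix κ κ ℂ) (z v : W) :
    chernForm H z v = (H z)⁻¹ * matDel H z v := rfl

theorem chernCurvature_eq (H : W → Matrix κ κ ℂ) (z u v : W) :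
    chernCurvature H z u v = -matDelbar (fun w => chernForm H w u) z v := rfl

theorem chernForm_congr {H H' : W → Matrix κ κ ℂ} {z : W} (h : H =ᶠ[𝓝 z] H') (v : W) :
    chernForm H z v = chernForm H' z v := by
  rw [chernForm_eq, chernForm_eq, matDel_congr h, h.self_of_nhds]

theorem chernCurvature_congr {H H' : W → Matrix κ κ ℂ} {z : W} (h : H =ᶠ[𝓝 z] H') (u v : W) :
    chernCurvature H z u v = chernCurvature H' z u v := by
  rw [chernCurvature_eq, chernCurvature_eq,
    matDelbar_congr (h.eventually_nhds.mono fun w hw => chernForm_congr hw u)]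

theorem MatContDiffAt.chernForm {H : W → Matrix κ κ ℂ} {z : W} (hH : MatContDiffAt ℝ 2 H z)
    (hdet : (H z).det ≠ 0) (v : W) : MatContDiffAt ℝ 1 (fun w => chernForm H w v) z :=
  ((hH.of_le one_le_two).inv hdet).mul (hH.matDel (by norm_num [one_add_one_eq_two]) v)

/-- The Chern curvature is compatible with restriction to an affine subspace. -/
theorem chernCurvature_comp_affine {W' : Type*} [NormedAddCommGroup W'] [NormedSpace ℂ W']
    {H : W → Matrix κ κ ℂ} (T : W' →L[ℂ] W) (c : W) {z : W'}
    (hH : MatContDiffAt ℝ 2 H (T z + c)) (hdet : (H (T z + c)).det ≠ 0) (u v : W') :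
    chernCurvature (fun w => H (T w + c)) z u v = chernCurvature H (T z + c) (T u) (T v) := by
  have hT : ContinuousAt (fun w => T w + c) z := by fun_prop
  have h1 : (fun w => CoupledVortex.chernForm (fun w => H (T w + c)) w u) =ᶠ[𝓝 z]
      fun w => CoupledVortex.chernForm H (T w + c) (T u) := by
    filter_upwards [hT.eventually (hH.eventually (by simp))] with w hw
    rw [chernForm_eq, chernForm_eq]
    congr 1
    ext a b
    exact del_comp_affine T c (hw.differentiableAt two_ne_zero a b) u
  rw [chernCurvature_eq, matDelbar_congr h1, chernCurvature_eq]
  congr 1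
  ext a b
  exact delbar_comp_affine T c ((hH.chernForm hdet (T u)).differentiableAt one_ne_zero a b) v

/-- The Chern curvature transforms by conjugation under a holomorphic change `P` of the frame, with
inverse `Q`. -/
theorem chernCurvature_gauge {D P Q : W → Matrix κ κ ℂ} {z : W} (hD : MatContDiffAt ℝ 2 D z)
    (hdet : (D z).det ≠ 0) (hP : MatContDiffAt ℂ 2 P z) (hQ : MatContDiffAt ℂ 2 Q z)
    (hPQ : ∀ w, P w * Q w = 1) (u v : W) :
    chernCurvature (fun w => (P w)ᴴ * D w * P w) z u v = Q z * chernCurvature D z u v * P z := by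
  have hPR := hP.restrict_scalars
  have hQR := hQ.restrict_scalars
  have hform : (fun w => CoupledVortex.chernForm (fun w => (P w)ᴴ * D w * P w) w u) =ᶠ[𝓝 z]
      fun w => Q w * CoupledVortex.chernForm D w u * P w + Q w * matDel P w u := by
    have hPe : ∀ᶠ w in 𝓝 z, ∀ a b, ContDiffAt ℂ 2 (fun w => P w a b) w := by
      simp only [eventually_all]
      exact fun a b => (hP a b).eventually (by simp)
    filter_upwards [hD.eventually (by simp), hD.eventually_det_ne_zero hdet, hPe]
      with w hDw hdw hPw
    have hPw : MatContDiffAt ℂ 2 P w := hPw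
    have hPwR := hPw.restrict_scalars
    have hinv : ((P w)ᴴ * D w * P w)⁻¹ = Q w * (D w)⁻¹ * (Q w)ᴴ := by
      apply Matrix.inv_eq_left_inv
      have h1 : (Q w)ᴴ * (P w)ᴴ = 1 := by
        rw [← Matrix.conjTranspose_mul, hPQ, Matrix.conjTranspose_one]
      have h2 : (D w)⁻¹ * D w = 1 := Matrix.nonsing_inv_mul _ (isUnit_iff_ne_zero.2 hdw)
      calc Q w * (D w)⁻¹ * (Q w)ᴴ * ((P w)ᴴ * D w * P w)
          = Q w * (D w)⁻¹ * ((Q w)ᴴ * (P w)ᴴ) * D w * P w := by simp only [Matrix.mul_assoc]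
        _ = Q w * ((D w)⁻¹ * D w) * P w := by rw [h1]; simp only [Matrix.mul_assoc, Matrix.one_mul]
        _ = 1 := by rw [h2, Matrix.mul_one, mul_eq_one_comm.1 (hPQ w)]
    rw [chernForm_eq, hinv, matDel_mul
      ((hPwR.conjTranspose.mul hDw).differentiableAt two_ne_zero)
      (hPwR.differentiableAt two_ne_zero), matDel_mul
      (hPwR.conjTranspose.differentiableAt two_ne_zero) (hDw.differentiableAt two_ne_zero),
      matDel_conjTranspose, matDelbar_eq_zero hPw two_ne_zero, chernForm_eq]
    have h1 : (Q w)ᴴ * (P w)ᴴ = 1 := by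
      rw [← Matrix.conjTranspose_mul, hPQ, Matrix.conjTranspose_one]
    have h2 : (D w)⁻¹ * D w = 1 := Matrix.nonsing_inv_mul _ (isUnit_iff_ne_zero.2 hdw)
    calc Q w * (D w)⁻¹ * (Q w)ᴴ * ((0ᴴ * D w + (P w)ᴴ * matDel D w u) * P w +
            (P w)ᴴ * D w * matDel P w u)
        = Q w * (D w)⁻¹ * ((Q w)ᴴ * (P w)ᴴ) * matDel D w u * P w +
            Q w * (D w)⁻¹ * ((Q w)ᴴ * (P w)ᴴ) * D w * matDel P w u := by
          simp only [Matrix.conjTranspose_zero, Matrix.zero_mul, zero_add, Matrix.mul_add,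
            Matrix.mul_assoc]
      _ = Q w * ((D w)⁻¹ * matDel D w u) * P w + Q w * ((D w)⁻¹ * D w) * matDel P w u := by
          rw [h1]; simp only [Matrix.mul_assoc, Matrix.one_mul]
      _ = _ := by rw [h2, Matrix.mul_one]
  have hc := hD.chernForm hdet u
  have hQ1 := hQR.of_le one_le_two
  have hP1 := hPR.of_le one_le_two
  have hdP := hPR.matDel (m := 1) (by norm_num [one_add_one_eq_two]) u
  rw [chernCurvature_eq, matDelbar_congr hform,
    matDelbar_add (((hQ1.mul hc).mul hP1).differentiableAt one_ne_zero)
      ((hQ1.mul hdP).differentiableAt one_ne_zero),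
    matDelbar_mul ((hQ1.mul hc).differentiableAt one_ne_zero) (hP1.differentiableAt one_ne_zero),
    matDelbar_mul (hQ1.differentiableAt one_ne_zero) (hc.differentiableAt one_ne_zero),
    matDelbar_mul (hQ1.differentiableAt one_ne_zero) (hdP.differentiableAt one_ne_zero),
    matDelbar_eq_zero hQ two_ne_zero, matDelbar_eq_zero hP two_ne_zero,
    matDelbar_matDel_eq_zero hP, chernCurvature_eq]
  simp

theorem inv_fromBlocks_diagonal {A : Matrix κ κ ℂ} {D : Matrix μ μ ℂ} (hA : A.det ≠ 0)
    (hD : D.det ≠ 0) :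
    (Matrix.fromBlocks A 0 0 D)⁻¹ = Matrix.fromBlocks A⁻¹ 0 0 D⁻¹ := by
  apply Matrix.inv_eq_right_inv
  rw [Matrix.fromBlocks_multiply, Matrix.mul_nonsing_inv _ (isUnit_iff_ne_zero.2 hA),
    Matrix.mul_nonsing_inv _ (isUnit_iff_ne_zero.2 hD)]
  simp

/-- The curvature of an orthogonal direct sum of metrics; a constant factor does not matter. -/
theorem chernCurvature_fromBlocks_diagonal {H : W → Matrix κ κ ℂ} {K : W → Matrix μ μ ℂ} {z : W}
    (hH : MatContDiffAt ℝ 2 H z) (hK : MatContDiffAt ℝ 2 K z) (hHd : (H z).det ≠ 0)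
    (hKd : (K z).det ≠ 0) {c : ℂ} (hc : c ≠ 0) (u v : W) :
    chernCurvature (fun w => Matrix.fromBlocks (H w) 0 0 (c • K w)) z u v =
      Matrix.fromBlocks (chernCurvature H z u v) 0 0 (chernCurvature K z u v) := by
  have h1 : (fun w => CoupledVortex.chernForm
      (fun w => Matrix.fromBlocks (H w) 0 0 (c • K w)) w u) =ᶠ[𝓝 z] fun w =>
      Matrix.fromBlocks (CoupledVortex.chernForm H w u) 0 0 (CoupledVortex.chernForm K w u) := by
    filter_upwards [hH.eventually_det_ne_zero hHd, hK.eventually_det_ne_zero hKd,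
      hK.eventually (by simp)] with w hHw hKw hK2
    have hcK : (c • K w).det ≠ 0 := by
      rw [Matrix.det_smul]
      exact mul_ne_zero (pow_ne_zero _ hc) hKw
    have hcd : matDel (fun w => c • K w) w u = c • matDel K w u := by
      ext a b
      exact (del_mul (differentiableAt_const _) (hK2.differentiableAt two_ne_zero a b) u).trans
        (by simp [del_const, matDel])
    have hci : (c • K w)⁻¹ = c⁻¹ • (K w)⁻¹ := by
      apply Matrix.inv_eq_right_inv
      rw [Matrix.smul_mul, Matrix.mul_smul, smul_smul, mul_inv_cancel₀ hc, one_smul,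
        Matrix.mul_nonsing_inv _ (isUnit_iff_ne_zero.2 hKw)]
    rw [chernForm_eq, inv_fromBlocks_diagonal hHw hcK, matDel_fromBlocks, matDel_const,
      matDel_const, hcd, hci, Matrix.fromBlocks_multiply, chernForm_eq, chernForm_eq]
    simp [smul_smul, hc]
  rw [chernCurvature_eq, matDelbar_congr h1, matDelbar_fromBlocks, matDelbar_const,
    matDelbar_const, Matrix.fromBlocks_neg, neg_zero, neg_zero, chernCurvature_eq,
    chernCurvature_eq]

end ChernCurvature

/-! ### The curvature of the metric on the extension in a holomorphic frame -/

section Gram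

variable {κ μ : Type*} [Fintype κ] [DecidableEq κ] [DecidableEq μ]

/-- The matrix which takes coordinates in the holomorphic frame `e_a`, `q ⊗ w - f φ(w)` of the
extension to coordinates in the frame `e_a`, `q ⊗ w` of the underlying direct sum; `Φ` is the matrix
of `φ`. -/
def extGauge (Φ : Matrix κ μ ℂ) (f : ℂ) : Matrix (κ ⊕ μ) (κ ⊕ μ) ℂ :=
  Matrix.fromBlocks 1 (-(f • Φ)) 0 1

/-- The Gram matrix, in the holomorphic frame of the extension, of the orthogonal sum of the metrics
with Gram matrices `H` and `c • K`. -/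
def extGram (H : Matrix κ κ ℂ) (K : Matrix μ μ ℂ) (Φ : Matrix κ μ ℂ) (f c : ℂ) :
    Matrix (κ ⊕ μ) (κ ⊕ μ) ℂ :=
  Matrix.fromBlocks H (-(f • (H * Φ))) (-(conj f • (Φᴴ * H)))
    ((conj f * f) • (Φᴴ * H * Φ) + c • K)

variable [Fintype μ]

theorem extGram_eq (H : Matrix κ κ ℂ) (K : Matrix μ μ ℂ) (Φ : Matrix κ μ ℂ) (f c : ℂ) :
    extGram H K Φ f c =
      (extGauge Φ f)ᴴ * Matrix.fromBlocks H 0 0 (c • K) * extGauge Φ f := by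
  simp [extGram, extGauge, Matrix.fromBlocks_conjTranspose, Matrix.fromBlocks_multiply, smul_smul,
    Matrix.mul_assoc, mul_comm]

theorem extGauge_mul_extGauge_neg (Φ : Matrix κ μ ℂ) (f : ℂ) :
    extGauge Φ f * extGauge Φ (-f) = 1 := by
  simp [extGauge, Matrix.fromBlocks_multiply]

theorem det_extGram_ne_zero {H : Matrix κ κ ℂ} {K : Matrix μ μ ℂ} (Φ : Matrix κ μ ℂ) (f : ℂ) {c : ℂ}
    (hH : H.det ≠ 0) (hK : K.det ≠ 0) (hc : c ≠ 0) : (extGram H K Φ f c).det ≠ 0 := by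
  rw [extGram_eq, Matrix.det_mul, Matrix.det_mul, Matrix.det_fromBlocks_zero₂₁, Matrix.det_smul]
  simp [extGauge, Matrix.det_conjTranspose, hH, hK, hc]

/-- The curvature of the metric on the extension in directions tangent to `X`: on the slices
`a = const` the change to the split frame is holomorphic. -/
theorem chernCurvature_extGram_of_const {W : Type*} [NormedAddCommGroup W] [NormedSpace ℂ W]
    {H : W → Matrix κ κ ℂ} {K : W → Matrix μ μ ℂ} {Φ : W → Matrix κ μ ℂ} {z : W}
    (hH : MatContDiffAt ℝ 2 H z) (hK : MatContDiffAt ℝ 2 K z) (hΦ : MatContDiffAt ℂ 2 Φ z)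
    (hHd : (H z).det ≠ 0) (hKd : (K z).det ≠ 0) (f : ℂ) {c : ℂ} (hc : c ≠ 0) (u v : W) :
    chernCurvature (fun w => extGram (H w) (K w) (Φ w) f c) z u v =
      extGauge (Φ z) (-f) *
        Matrix.fromBlocks (chernCurvature H z u v) 0 0 (chernCurvature K z u v) *
        extGauge (Φ z) f := by
  have hgauge (f : ℂ) : MatContDiffAt ℂ 2 (fun w => extGauge (Φ w) f) z := by
    rintro (a | a) (b | b)
    exacts [contDiffAt_const, (contDiffAt_const.mul (hΦ a b)).neg, contDiffAt_const,
      contDiffAt_const]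
  have hcK : MatContDiffAt ℝ 2 (fun w => c • K w) z := hK.smul contDiffAt_const
  simp only [extGram_eq]
  rw [chernCurvature_gauge (hH.fromBlocks (.const 0) (.const 0) hcK) ?_ (hgauge f) (hgauge (-f))
    (fun w => extGauge_mul_extGauge_neg _ f),
    chernCurvature_fromBlocks_diagonal hH hK hHd hKd hc]
  rw [Matrix.det_fromBlocks_zero₂₁, Matrix.det_smul]
  simp [hHd, hKd, hc]

/-- The primitive `± ā / (1 + |a|²)` of the form `α` in the affine coordinate `a`. -/
def affinePrimitive (ε a : ℂ) : ℂ := ε * conj a / (1 + ‖a‖ ^ 2 : ℝ)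

/-- The function `(1 + |a|²)⁻²`: the squared norm of the frame of `O(2)` over the affine line, and,
up to a constant, the coefficient of the Fubini-Study metric. -/
def affineWeight (a : ℂ) : ℂ := (((1 + ‖a‖ ^ 2) ^ 2 : ℝ) : ℂ)⁻¹

theorem one_add_norm_sq_eq (a : ℂ) : ((1 + ‖a‖ ^ 2 : ℝ) : ℂ) = 1 + a * conj a := by
  rw [Complex.mul_conj, Complex.normSq_eq_norm_sq]
  push_cast
  ring

theorem one_add_mul_conj_ne_zero (a : ℂ) : 1 + a * conj a ≠ 0 := by
  rw [← one_add_norm_sq_eq]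
  exact_mod_cast (by positivity : (1 + ‖a‖ ^ 2 : ℝ) ≠ 0)

theorem affinePrimitive_eq (ε a : ℂ) : affinePrimitive ε a = ε * conj a / (1 + a * conj a) := by
  rw [affinePrimitive, one_add_norm_sq_eq]

theorem affineWeight_eq (a : ℂ) : affineWeight a = ((1 + a * conj a) ^ 2)⁻¹ := by
  rw [affineWeight, ← one_add_norm_sq_eq]
  push_cast
  rfl

theorem affineWeight_ne_zero (a : ℂ) : affineWeight a ≠ 0 := by
  rw [affineWeight_eq]
  exact inv_ne_zero (pow_ne_zero _ (one_add_mul_conj_ne_zero a))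

theorem contDiff_conj {n : WithTop ℕ∞} : ContDiff ℝ n fun a : ℂ => conj a :=
  Complex.conjCLE.contDiff

theorem contDiff_one_add_mul_conj {n : WithTop ℕ∞} :
    ContDiff ℝ n fun a : ℂ => 1 + a * conj a :=
  contDiff_const.add (contDiff_id.mul contDiff_conj)

theorem contDiff_affinePrimitive {n : WithTop ℕ∞} (ε : ℂ) :
    ContDiff ℝ n (affinePrimitive ε) := by
  rw [funext (affinePrimitive_eq ε)]
  simp only [div_eq_mul_inv]
  exact (contDiff_const.mul contDiff_conj).mul
    (contDiff_one_add_mul_conj.inv one_add_mul_conj_ne_zero)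

theorem contDiff_affineWeight {n : WithTop ℕ∞} : ContDiff ℝ n affineWeight := by
  rw [funext affineWeight_eq]
  exact (contDiff_one_add_mul_conj.pow 2).inv fun a => pow_ne_zero _ (one_add_mul_conj_ne_zero a)

theorem del_id (a : ℂ) : del (fun a : ℂ => a) a 1 = 1 := by
  rw [del_eq_fderiv differentiableAt_fun_id, fderiv_fun_id, ContinuousLinearMap.id_apply]

theorem delbar_id (a : ℂ) : delbar (fun a : ℂ => a) a 1 = 0 :=
  delbar_eq_zero differentiableAt_fun_id 1

theorem del_conj_id (a : ℂ) : del (fun a : ℂ => conj a) a 1 = 0 := by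
  rw [del_conj, delbar_id, map_zero]

theorem delbar_conj_id (a : ℂ) : delbar (fun a : ℂ => conj a) a 1 = 1 := by
  rw [delbar_conj, del_id, map_one]

theorem del_one_add_mul_conj (a : ℂ) : del (fun a : ℂ => 1 + a * conj a) a 1 = conj a := by
  have h : DifferentiableAt ℝ (fun a : ℂ => conj a) a :=
    (contDiff_conj (n := 1)).differentiable one_ne_zero a
  rw [del_add (differentiableAt_const _) (differentiableAt_fun_id.fun_mul h), del_const]
  rw [del_mul differentiableAt_fun_id h, del_id, del_conj_id]
  ring

theorem delbar_one_add_mul_conj (a : ℂ) : delbar (fun a : ℂ => 1 + a * conj a) a 1 = a := by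
  have h : DifferentiableAt ℝ (fun a : ℂ => conj a) a :=
    (contDiff_conj (n := 1)).differentiable one_ne_zero a
  rw [delbar_add (differentiableAt_const _) (differentiableAt_fun_id.fun_mul h), delbar_const]
  rw [delbar_mul differentiableAt_fun_id h, delbar_id, delbar_conj_id]
  ring

theorem delbar_affinePrimitive (ε a : ℂ) :
    delbar (affinePrimitive ε) a 1 = ε * affineWeight a := by
  have hN := one_add_mul_conj_ne_zero a
  have h1 : (fun a : ℂ => affinePrimitive ε a * (1 + a * conj a)) = fun a => ε * conj a := by
    ext b
    rw [affinePrimitive_eq, div_mul_cancel₀ _ (one_add_mul_conj_ne_zero b)]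
  have h2 := congrArg (fun F => delbar F a 1) h1
  rw [delbar_mul ((contDiff_affinePrimitive ε (n := 1)).differentiable one_ne_zero a)
    ((contDiff_one_add_mul_conj (n := 1)).differentiable one_ne_zero a),
    delbar_one_add_mul_conj, delbar_mul (differentiableAt_const _)
    ((contDiff_conj (n := 1)).differentiable one_ne_zero a), delbar_const, delbar_conj_id,
    affinePrimitive_eq] at h2
  rw [affineWeight_eq, ← mul_left_inj' hN]
  field_simp at h2 ⊢
  linear_combination h2

theorem del_affinePrimitive {ε : ℂ} (hε : ε * ε = 1) (a : ℂ) :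
    del (affinePrimitive ε) a 1 = -(ε * affinePrimitive ε a ^ 2) := by
  have hN := one_add_mul_conj_ne_zero a
  have h1 : (fun a : ℂ => affinePrimitive ε a * (1 + a * conj a)) = fun a => ε * conj a := by
    ext b
    rw [affinePrimitive_eq, div_mul_cancel₀ _ (one_add_mul_conj_ne_zero b)]
  have h2 := congrArg (fun F => del F a 1) h1
  rw [del_mul ((contDiff_affinePrimitive ε (n := 1)).differentiable one_ne_zero a)
    ((contDiff_one_add_mul_conj (n := 1)).differentiable one_ne_zero a),
    del_one_add_mul_conj, del_mul (differentiableAt_const _)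
    ((contDiff_conj (n := 1)).differentiable one_ne_zero a), del_const, del_conj_id,
    affinePrimitive_eq] at h2
  rw [affinePrimitive_eq, ← mul_left_inj' hN]
  have h3 : ε * (ε * conj a / (1 + a * conj a)) ^ 2 * (1 + a * conj a) =
      (ε * ε) * (ε * conj a / (1 + a * conj a) * conj a) := by
    field_simp
  rw [neg_mul, h3, hε]
  linear_combination h2

theorem del_affineWeight {ε : ℂ} (hε : ε * ε = 1) (a : ℂ) :
    del affineWeight a 1 = -(2 * ε * affinePrimitive ε a * affineWeight a) := by
  have hN := one_add_mul_conj_ne_zero a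
  have hNd := (contDiff_one_add_mul_conj (n := 1)).differentiable one_ne_zero a
  have h1 : (fun a : ℂ => affineWeight a * ((1 + a * conj a) * (1 + a * conj a))) =
      fun _ => 1 := by
    ext b
    rw [affineWeight_eq, ← pow_two, inv_mul_cancel₀ (pow_ne_zero _ (one_add_mul_conj_ne_zero b))]
  have h2 := congrArg (fun F => del F a 1) h1
  rw [del_mul ((contDiff_affineWeight (n := 1)).differentiable one_ne_zero a) (hNd.fun_mul hNd),
    del_mul hNd hNd, del_one_add_mul_conj, del_const] at h2
  have h3 : ε * affinePrimitive ε a = conj a / (1 + a * conj a) := by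
    rw [affinePrimitive_eq, ← mul_div_assoc, ← mul_assoc, hε, one_mul]
  have h4 : -(2 * (conj a / (1 + a * conj a)) * affineWeight a) * (1 + a * conj a) *
      (1 + a * conj a) = -(2 * conj a * affineWeight a * (1 + a * conj a)) := by
    field_simp
  rw [mul_assoc 2 ε, h3, ← mul_left_inj' hN, ← mul_left_inj' hN, h4]
  linear_combination h2

/-- The curvature of the metric on the extension in the direction of `P¹`: this is the curvature
`2 / (1 + |a|²)²` of `O(2)`, corrected by the terms from the second fundamental form `φ ⊗ α`. -/
theorem chernCurvature_extGram_vertical {H : Matrix κ κ ℂ} {K : Matrix μ μ ℂ} (Φ : Matrix κ μ ℂ)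
    (hH : H.det ≠ 0) (hK : K.det ≠ 0) {c ε : ℂ} (hc : c ≠ 0) (hε : ε * ε = 1) (a : ℂ) :
    chernCurvature (fun a => extGram H K Φ (affinePrimitive ε a) (c * affineWeight a)) a 1 1 =
      affineWeight a • (extGauge Φ (-affinePrimitive ε a) *
        Matrix.fromBlocks (c⁻¹ • (Φ * (K⁻¹ * Φᴴ * H))) 0 0 (2 • 1 - c⁻¹ • (K⁻¹ * Φᴴ * H * Φ)) *
        extGauge Φ (affinePrimitive ε a)) := by
  set S := K⁻¹ * Φᴴ * H with hS
  have hKS : K * S = Φᴴ * H := by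
    rw [hS, Matrix.mul_assoc, ← Matrix.mul_assoc K, Matrix.mul_nonsing_inv _
      (isUnit_iff_ne_zero.2 hK), Matrix.one_mul]
  have hfd (b : ℂ) : DifferentiableAt ℝ (affinePrimitive ε) b :=
    (contDiff_affinePrimitive ε (n := 1)).differentiable one_ne_zero b
  have hcf (b : ℂ) : DifferentiableAt ℝ (fun b => conj (affinePrimitive ε b)) b :=
    (contDiff_conj (n := 1)).differentiable one_ne_zero _ |>.comp b (hfd b)
  have hwd (b : ℂ) : DifferentiableAt ℝ affineWeight b :=
    (contDiff_affineWeight (n := 1)).differentiable one_ne_zero b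
  have hε' : conj ε = ε := by
    rcases mul_self_eq_one_iff.1 hε with rfl | rfl <;> simp
  have hwc (b : ℂ) : conj (affineWeight b) = affineWeight b := by
    simp [affineWeight, Complex.conj_ofReal]
  have hdcf (b : ℂ) : del (fun b => conj (affinePrimitive ε b)) b 1 = ε * affineWeight b := by
    rw [del_conj, delbar_affinePrimitive, map_mul, hε', hwc]
  -- the connection form, found by solving `G B = ∂G` for the Gram matrix `G`
  have hform : (fun b => chernForm
      (fun a => extGram H K Φ (affinePrimitive ε a) (c * affineWeight a)) b 1) = fun b =>
      Matrix.fromBlocks (affinePrimitive ε b • (-(ε * c⁻¹) • (Φ * S)))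
        ((affinePrimitive ε b * affinePrimitive ε b) • (ε • (c⁻¹ • (Φ * S * Φ) - Φ)))
        (-(ε * c⁻¹) • S) (affinePrimitive ε b • (ε • (c⁻¹ • (S * Φ) - 2 • 1))) := by
    funext b
    have hdet := det_extGram_ne_zero Φ (affinePrimitive ε b) hH hK
      (mul_ne_zero hc (affineWeight_ne_zero b))
    have hG : (fun a => extGram H K Φ (affinePrimitive ε a) (c * affineWeight a)) = fun a =>
        Matrix.fromBlocks H (affinePrimitive ε a • -(H * Φ))
          (conj (affinePrimitive ε a) • -(Φᴴ * H))
          ((conj (affinePrimitive ε a) * affinePrimitive ε a) • (Φᴴ * H * Φ) +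
            affineWeight a • (c • K)) := by
      funext a
      simp only [extGram, smul_neg, smul_smul, mul_comm c]
    have hd := congrArg (fun G => matDel G b 1) hG
    rw [matDel_fromBlocks, matDel_const, matDel_smul_const (hfd b), matDel_smul_const (hcf b),
      matDel_smul_add_smul ((hcf b).fun_mul (hfd b)) (hwd b),
      del_mul (hcf b) (hfd b), hdcf, del_affinePrimitive hε, del_affineWeight hε] at hd
    rw [chernForm_eq, hd]
    have key : ∀ A B : Matrix (κ ⊕ μ) (κ ⊕ μ) ℂ,
        A = extGram H K Φ (affinePrimitive ε b) (c * affineWeight b) * B →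
        (extGram H K Φ (affinePrimitive ε b) (c * affineWeight b))⁻¹ * A = B := by
      rintro A B rfl
      rw [← Matrix.mul_assoc, Matrix.nonsing_inv_mul _ (isUnit_iff_ne_zero.2 hdet), Matrix.one_mul]
    apply key
    simp only [extGram, Matrix.fromBlocks_multiply]
    have e1 : Φᴴ * H * Φ * S = Φᴴ * H * (Φ * S) := Matrix.mul_assoc _ _ _
    have e2 : Φᴴ * H * Φ * (S * Φ) = Φᴴ * H * (Φ * S * Φ) := by simp only [Matrix.mul_assoc]
    have e3 : H * Φ * S = H * (Φ * S) := Matrix.mul_assoc _ _ _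
    have e4 : H * Φ * (S * Φ) = H * (Φ * S * Φ) := by simp only [Matrix.mul_assoc]
    have e5 : K * (S * Φ) = Φᴴ * H * Φ := by rw [← Matrix.mul_assoc, hKS]
    generalize affinePrimitive ε b = f
    generalize affineWeight b = ρ
    congr 1
    all_goals simp only [Matrix.mul_smul, Matrix.smul_mul, Matrix.neg_mul, Matrix.add_mul,
      Matrix.mul_sub, Matrix.mul_one, e1, e2, e3, e4, e5, hKS]
    · module
    · match_scalars
      · field_simp
        ring
      · field_simp
        ring
    · match_scalars
      all_goals field_simp
      all_goals ring
    · match_scalars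
      all_goals field_simp
      all_goals ring
  rw [chernCurvature_eq, hform, matDelbar_fromBlocks, matDelbar_const,
    matDelbar_smul_const (hfd a), matDelbar_smul_const (hfd a),
    matDelbar_smul_const ((hfd a).fun_mul (hfd a)), delbar_mul (hfd a) (hfd a),
    delbar_affinePrimitive]
  have e6 : Φ * (S * Φ) = Φ * S * Φ := (Matrix.mul_assoc _ _ _).symm
  generalize affinePrimitive ε a = f
  generalize affineWeight a = ρ
  simp only [extGauge, Matrix.fromBlocks_multiply, Matrix.fromBlocks_smul, Matrix.fromBlocks_neg]
  have hε2 : ε ^ 2 = 1 := by rw [pow_two, hε]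
  congr 1 <;> simp only [Matrix.mul_smul, Matrix.smul_mul, Matrix.neg_mul, Matrix.mul_neg,
      Matrix.one_mul, Matrix.zero_mul, Matrix.mul_zero, Matrix.mul_sub, Matrix.mul_one, add_zero,
      zero_add, e6]
  · match_scalars
    linear_combination (ρ * c⁻¹) * hε2
  · match_scalars
    · linear_combination (-2 * ρ * f * c⁻¹) * hε2
    · linear_combination (2 * ρ * f) * hε2
  · simp
  · match_scalars
    · linear_combination (-ρ * c⁻¹) * hε2
    · linear_combination (2 * ρ) * hε2

end Gram

section Smoothness

variable {W κ μ : Type*} [NormedAddCommGroup W] [NormedSpace ℂ W] {n : WithTop ℕ∞}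

theorem MatContDiffAt.comp_fst {A : W → Matrix κ μ ℂ} {z : W} (hA : MatContDiffAt ℝ n A z) (a : ℂ) :
    MatContDiffAt ℝ n (fun p : W × ℂ => A p.1) (z, a) := fun i j =>
  (hA i j).comp (f := fun p : W × ℂ => p.1) (z, a) contDiffAt_fst

theorem matContDiffAt_extGram [Fintype κ] {H : W → Matrix κ κ ℂ} {K : W → Matrix μ μ ℂ}
    {Φ : W → Matrix κ μ ℂ} {z : W}
    (hH : MatContDiffAt ℝ n H z) (hK : MatContDiffAt ℝ n K z) (hΦ : MatContDiffAt ℝ n Φ z)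
    (c ε a : ℂ) :
    MatContDiffAt ℝ n (fun p : W × ℂ => extGram (H p.1) (K p.1) (Φ p.1) (affinePrimitive ε p.2)
      (c * affineWeight p.2)) (z, a) := by
  have hf : ContDiffAt ℝ n (fun p : W × ℂ => affinePrimitive ε p.2) (z, a) :=
    (contDiff_affinePrimitive ε).contDiffAt.comp (f := fun p : W × ℂ => p.2) (z, a)
      contDiffAt_snd
  have hw : ContDiffAt ℝ n (fun p : W × ℂ => affineWeight p.2) (z, a) :=
    contDiff_affineWeight.contDiffAt.comp (f := fun p : W × ℂ => p.2) (z, a) contDiffAt_snd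
  have hcf : ContDiffAt ℝ n (fun p : W × ℂ => conj (affinePrimitive ε p.2)) (z, a) :=
    contDiff_conj.contDiffAt.comp (z, a) hf
  have hH' := hH.comp_fst a
  have hΦ' := hΦ.comp_fst a
  have h1 := MatContDiffAt.smul hf (hH'.mul hΦ')
  have h2 := MatContDiffAt.smul hcf (hΦ'.conjTranspose.mul hH')
  have h3 := MatContDiffAt.smul (hcf.mul hf) ((hΦ'.conjTranspose.mul hH').mul hΦ')
  have h4 := MatContDiffAt.smul ((contDiffAt_const (c := c)).mul hw) (hK.comp_fst a)
  exact hH'.fromBlocks (fun i j => (h1 i j).neg) (fun i j => (h2 i j).neg)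
    (fun i j => (h3 i j).add (h4 i j))

end Smoothness

section Gram

variable {κ μ : Type*} [Fintype κ] [DecidableEq κ] [Fintype μ] [DecidableEq μ]

/-- The contraction of the curvature of the metric on the extension with the product Kähler form.
The Gram matrix of the Kähler metric is block diagonal, so only the components of the curvature
along the two factors contribute. -/
theorem contraction_chernCurvature_extGram {W ι : Type*} [NormedAddCommGroup W] [NormedSpace ℂ W]
    [Fintype ι] [DecidableEq ι] (b : Module.Basis ι ℂ W) {g : Matrix ι ι ℂ} (hg : g.det ≠ 0)
    {H : W → Matrix κ κ ℂ} {K : W → Matrix μ μ ℂ} {Φ : W → Matrix κ μ ℂ} {z : W}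
    (hH : MatContDiffAt ℝ 2 H z) (hK : MatContDiffAt ℝ 2 K z) (hΦ : MatContDiffAt ℂ 2 Φ z)
    (hHd : (H z).det ≠ 0) (hKd : (K z).det ≠ 0) {c d ε : ℂ} (hc : c ≠ 0) (hd : d ≠ 0)
    (hε : ε * ε = 1) (a : ℂ) :
    ∑ j, ∑ k, (Matrix.fromBlocks g 0 0 (Matrix.of fun _ _ : Unit => d * affineWeight a))⁻¹ j k •
      chernCurvature (fun p : W × ℂ => extGram (H p.1) (K p.1) (Φ p.1) (affinePrimitive ε p.2)
        (c * affineWeight p.2)) (z, a) (b.prod (Module.Basis.singleton Unit ℂ) j)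
        (b.prod (Module.Basis.singleton Unit ℂ) k) =
    extGauge (Φ z) (-affinePrimitive ε a) *
      Matrix.fromBlocks
        (∑ j, ∑ k, g⁻¹ j k • chernCurvature H z (b j) (b k) +
          (d * c)⁻¹ • (Φ z * ((K z)⁻¹ * (Φ z)ᴴ * H z))) 0 0
        (∑ j, ∑ k, g⁻¹ j k • chernCurvature K z (b j) (b k) +
          d⁻¹ • (2 • 1 - c⁻¹ • ((K z)⁻¹ * (Φ z)ᴴ * H z * Φ z))) *
      extGauge (Φ z) (affinePrimitive ε a) := by
  obtain ⟨𝓗, h𝓗⟩ : ∃ 𝓗 : W × ℂ → Matrix (κ ⊕ μ) (κ ⊕ μ) ℂ, 𝓗 = fun p =>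
    extGram (H p.1) (K p.1) (Φ p.1) (affinePrimitive ε p.2) (c * affineWeight p.2) := ⟨_, rfl⟩
  rw [← h𝓗]
  have hρ := affineWeight_ne_zero a
  have hdet : (𝓗 (z, a)).det ≠ 0 := h𝓗 ▸ det_extGram_ne_zero _ _ hHd hKd (mul_ne_zero hc hρ)
  have hsmooth : MatContDiffAt ℝ 2 𝓗 (z, a) :=
    h𝓗 ▸ matContDiffAt_extGram hH hK hΦ.restrict_scalars c ε a
  have hhor (u v : W) : chernCurvature 𝓗 (z, a) (u, 0) (v, 0) =
      extGauge (Φ z) (-affinePrimitive ε a) *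
        Matrix.fromBlocks (chernCurvature H z u v) 0 0 (chernCurvature K z u v) *
        extGauge (Φ z) (affinePrimitive ε a) := by
    have h := chernCurvature_comp_affine (H := 𝓗) (ContinuousLinearMap.inl ℂ W ℂ) (0, a) (z := z)
      (by simpa using hsmooth) (by simpa using hdet) u v
    simp only [ContinuousLinearMap.inl_apply, Prod.mk_add_mk, add_zero, zero_add] at h
    have e : (fun w => 𝓗 (w, a)) = fun w => extGram (H w) (K w) (Φ w) (affinePrimitive ε a)
        (c * affineWeight a) := by rw [h𝓗]
    rw [← h, e, chernCurvature_extGram_of_const hH hK hΦ hHd hKd _ (mul_ne_zero hc hρ) u v]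
  have hver := chernCurvature_comp_affine (H := 𝓗) (ContinuousLinearMap.inr ℂ W ℂ) ((z, 0) : W × ℂ)
    (z := a) (by simpa using hsmooth) (by simpa using hdet) (1 : ℂ) (1 : ℂ)
  simp only [ContinuousLinearMap.inr_apply, Prod.mk_add_mk, add_zero, zero_add] at hver
  have hD : (Matrix.of fun _ _ : Unit => d * affineWeight a).det ≠ 0 := by
    simpa using ⟨hd, hρ⟩
  have hDi : (Matrix.of fun _ _ : Unit => d * affineWeight a)⁻¹ () () =
      (d * affineWeight a)⁻¹ := by
    simp
  rw [inv_fromBlocks_diagonal hg hD]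
  simp only [Fintype.sum_sum_type, Matrix.fromBlocks_apply₁₁, Matrix.fromBlocks_apply₁₂,
    Matrix.fromBlocks_apply₂₁, Matrix.fromBlocks_apply₂₂, Matrix.zero_apply, zero_smul,
    Finset.sum_const_zero, add_zero, zero_add, Finset.univ_unique, Finset.sum_singleton,
    PUnit.default_eq_unit, hDi, Module.Basis.prod_apply, Sum.elim_inl, Sum.elim_inr,
    Function.comp_apply, LinearMap.inl_apply, LinearMap.inr_apply, Module.Basis.singleton_apply]
  have hver' := chernCurvature_extGram_vertical (Φ z) hHd hKd hc hε a
  have e : (fun b => 𝓗 (z, b)) = fun b => extGram (H z) (K z) (Φ z) (affinePrimitive ε b)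
      (c * affineWeight b) := by rw [h𝓗]
  rw [← e, hver] at hver'
  have hsum (A : ι → ι → Matrix κ κ ℂ) (B : ι → ι → Matrix μ μ ℂ) :
      ∑ j, ∑ k, g⁻¹ j k • Matrix.fromBlocks (A j k) 0 0 (B j k) =
        Matrix.fromBlocks (∑ j, ∑ k, g⁻¹ j k • A j k) 0 0 (∑ j, ∑ k, g⁻¹ j k • B j k) := by
    ext (i | i) (j | j) <;> simp [Matrix.sum_apply]
  have e1 : (d * affineWeight a)⁻¹ * affineWeight a = d⁻¹ := by
    field_simp
  have hblocks : Matrix.fromBlocks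
      (∑ j, ∑ k, g⁻¹ j k • chernCurvature H z (b j) (b k) +
        (d * c)⁻¹ • (Φ z * ((K z)⁻¹ * (Φ z)ᴴ * H z))) 0 0
      (∑ j, ∑ k, g⁻¹ j k • chernCurvature K z (b j) (b k) +
        d⁻¹ • (2 • 1 - c⁻¹ • ((K z)⁻¹ * (Φ z)ᴴ * H z * Φ z))) =
      ∑ j, ∑ k, g⁻¹ j k • Matrix.fromBlocks (chernCurvature H z (b j) (b k)) 0 0
          (chernCurvature K z (b j) (b k)) +
        d⁻¹ • Matrix.fromBlocks (c⁻¹ • (Φ z * ((K z)⁻¹ * (Φ z)ᴴ * H z))) 0 0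
          (2 • 1 - c⁻¹ • ((K z)⁻¹ * (Φ z)ᴴ * H z * Φ z)) := by
    rw [hsum, Matrix.fromBlocks_smul, Matrix.fromBlocks_add, smul_smul, mul_inv, smul_zero,
      smul_zero, add_zero, add_zero]
  rw [hblocks]
  simp only [hhor, hver', Matrix.mul_add, Matrix.add_mul, Matrix.mul_sum, Matrix.sum_mul,
    Matrix.mul_smul, Matrix.smul_mul, smul_smul, e1]

end Gram

/-! ### Local coordinates on the projective line and on the extension bundle -/

namespace ProjLine

theorem coord_mk_affinePoint (i : Fin 2) (a : ℂ) :
    coord i (Projectivization.mk ℂ (affinePoint i a) (affinePoint_ne_zero i a)) = a := by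
  rw [coord_mk]
  have : (1 : Fin 2) - i ≠ i := by omega
  simp [affinePoint, this]

theorem rep_mk_affinePoint_ne_zero (i : Fin 2) (a : ℂ) :
    (Projectivization.mk ℂ (affinePoint i a) (affinePoint_ne_zero i a)).rep i ≠ 0 := by
  rw [rep_mk_ne_zero_iff]
  simp [affinePoint]

theorem tautSection_ne_zero {i : Fin 2} {l : ProjLine} (hl : l.rep i ≠ 0) :
    tautSection i l ≠ 0 := by
  intro h
  have h' := coe_tautSection hl
  rw [h] at h'
  exact affinePoint_ne_zero _ _ h'.symm

/-- The sign in the primitive of `α` on the `i`-th affine line. -/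
def chartSign (i : Fin 2) : ℂ := if i = 0 then 1 else -1

theorem chartSign_mul_self (i : Fin 2) : chartSign i * chartSign i = 1 := by
  unfold chartSign
  split_ifs <;> simp

/-- The squared Euclidean norm of a vector of `ℂ²`. -/
def normSq (v : Fin 2 → ℂ) : ℝ := ∑ j, ‖v j‖ ^ 2

theorem normSq_pos {v : Fin 2 → ℂ} (hv : v ≠ 0) : 0 < normSq v := by
  obtain ⟨j, hj⟩ := Function.ne_iff.1 hv
  exact Finset.sum_pos' (fun _ _ => by positivity)
    ⟨j, Finset.mem_univ j, by have : v j ≠ 0 := hj; positivity⟩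

theorem normSq_smul (a : ℂ) (v : Fin 2 → ℂ) : normSq (a • v) = ‖a‖ ^ 2 * normSq v := by
  simp [normSq, mul_pow, mul_add]

theorem normSq_affinePoint (i : Fin 2) (a : ℂ) : normSq (affinePoint i a) = 1 + ‖a‖ ^ 2 := by
  fin_cases i <;> simp [normSq, affinePoint, add_comm]

end ProjLine

section Geometry

variable {n r : ℕ} {X : Type*} [TopologicalSpace X] [ChartedSpace (Fin n → ℂ) X]
  {E : X → Type*} [TopologicalSpace (TotalSpace (Fin r → ℂ) E)]
  [∀ x, AddCommGroup (E x)] [∀ x, Module ℂ (E x)] [∀ x, TopologicalSpace (E x)]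
  [FiberBundle (Fin r → ℂ) E]
  {L : X → Type*} [TopologicalSpace (TotalSpace ℂ L)]
  [∀ x, AddCommGroup (L x)] [∀ x, Module ℂ (L x)] [∀ x, TopologicalSpace (L x)]
  [FiberBundle ℂ L]

/-- The metric on `E ⊕ L ⊗ O(2)` which is the orthogonal sum of `H` and of `c` times the tensor
product of `K` and the metric on `O(2)` induced by the standard metric of `ℂ²`: the squared norm of
a quadratic map `Q` on `l` is `|Q v|² / |v|⁴` for any nonzero `v ∈ l`. -/
def splitForm (φ : HolomorphicHom 𝓘(ℂ, Fin n → ℂ) (Fin r → ℂ) E L)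
    (H : ∀ x, E x →ₗ⋆[ℂ] E x →ₗ[ℂ] ℂ) (K : ∀ x, L x →ₗ⋆[ℂ] L x →ₗ[ℂ] ℂ) (c : ℝ)
    (p : X × ProjLine) : ExtFiber φ p →ₗ⋆[ℂ] ExtFiber φ p →ₗ[ℂ] ℂ :=
  let s : p.2.submodule := ⟨p.2.rep, by
    rw [Projectivization.submodule_eq]; exact Submodule.mem_span_singleton_self _⟩
  let pr₁ : ExtFiber φ p →ₗ[ℂ] E p.1 := LinearMap.fst ℂ _ _
  let pr₂ : ExtFiber φ p →ₗ[ℂ] QuadraticMap ℂ p.2.submodule (L p.1) := LinearMap.snd ℂ _ _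
  ((H p.1).comp pr₁).compl₂ pr₁ + ((c * (ProjLine.normSq p.2.rep ^ 2)⁻¹ : ℝ) : ℂ) •
    ((K p.1).comp (evalQuad s ∘ₗ pr₂)).compl₂ (evalQuad s ∘ₗ pr₂)

variable (φ : HolomorphicHom 𝓘(ℂ, Fin n → ℂ) (Fin r → ℂ) E L)
  (H : ∀ x, E x →ₗ⋆[ℂ] E x →ₗ[ℂ] ℂ) (K : ∀ x, L x →ₗ⋆[ℂ] L x →ₗ[ℂ] ℂ) (c : ℝ)

theorem splitForm_mk (p : X × ProjLine) (s : p.2.submodule) (hs : s ≠ 0) (v v' : E p.1)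
    (Q Q' : QuadraticMap ℂ p.2.submodule (L p.1)) :
    splitForm φ H K c p (.mk φ p v Q) (.mk φ p v' Q') =
      H p.1 v v' + ((c * (ProjLine.normSq s ^ 2)⁻¹ : ℝ) : ℂ) * K p.1 (Q s) (Q' s) := by
  obtain ⟨a, ha⟩ : ∃ a : ℂ, a • p.2.rep = s := by
    have h : (s : Fin 2 → ℂ) ∈ Submodule.span ℂ {p.2.rep} := by
      rw [← Projectivization.submodule_eq]
      exact s.2
    exact Submodule.mem_span_singleton.1 h
  have ha0 : a ≠ 0 := by
    rintro rfl
    exact hs (Subtype.ext (by rw [← ha, zero_smul]; rfl))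
  set s₀ : p.2.submodule := ⟨p.2.rep, by
    rw [Projectivization.submodule_eq]; exact Submodule.mem_span_singleton_self _⟩ with hs₀
  have hss : s = a • s₀ := Subtype.ext ha.symm
  have hN : ProjLine.normSq p.2.rep ≠ 0 := (ProjLine.normSq_pos p.2.rep_nonzero).ne'
  change H p.1 v v' + ((c * (ProjLine.normSq p.2.rep ^ 2)⁻¹ : ℝ) : ℂ) * K p.1 (Q s₀) (Q' s₀) = _
  rw [hss, QuadraticMap.map_smul, QuadraticMap.map_smul, map_smul, LinearMap.map_smulₛₗ,
    LinearMap.smul_apply, smul_eq_mul, smul_eq_mul]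
  have h1 : ProjLine.normSq ((a • s₀ : p.2.submodule) : Fin 2 → ℂ) =
      ‖a‖ ^ 2 * ProjLine.normSq p.2.rep := ProjLine.normSq_smul a _
  rw [h1]
  have h2 : ((‖a‖ ^ 2 : ℝ) : ℂ) = conj a * a := by
    rw [← Complex.normSq_eq_norm_sq, Complex.normSq_eq_conj_mul_self]
  have ha' : conj a ≠ 0 := by simpa using ha0
  have hN' : ((ProjLine.normSq p.2.rep : ℝ) : ℂ) ≠ 0 := by exact_mod_cast hN
  rw [Complex.ofReal_mul c, Complex.ofReal_mul c, Complex.ofReal_inv, Complex.ofReal_inv,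
    Complex.ofReal_pow, Complex.ofReal_pow, Complex.ofReal_mul, h2, map_mul]
  field_simp

/-- The metric `splitForm` in an affine chart of the projective line. -/
theorem splitForm_mk_tautSection (p : X × ProjLine) {i : Fin 2} (hi : p.2.rep i ≠ 0) (v v' : E p.1)
    (Q Q' : QuadraticMap ℂ p.2.submodule (L p.1)) :
    splitForm φ H K c p (.mk φ p v Q) (.mk φ p v' Q') =
      H p.1 v v' + c * affineWeight (ProjLine.coord i p.2) *
        K p.1 (Q (ProjLine.tautSection i p.2)) (Q' (ProjLine.tautSection i p.2)) := by
  rw [splitForm_mk φ H K c p _ (ProjLine.tautSection_ne_zero hi),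
    ProjLine.coe_tautSection hi, ProjLine.normSq_affinePoint,
    affineWeight]
  push_cast
  rfl

theorem extPrimitive_eq (i : Fin 2) (l : ProjLine) :
    extPrimitive i l = affinePrimitive (ProjLine.chartSign i) (ProjLine.coord i l) := rfl

theorem evalQuad_quadOf {B : Type*} [AddCommGroup B] [Module ℂ B] {i : Fin 2} {l : ProjLine}
    (hl : l.rep i ≠ 0) (w : B) : quadOf i l w (ProjLine.tautSection i l) = w := by
  rw [quadOf_apply, ProjLine.coe_tautSection hl]
  simp [ProjLine.affinePoint]

section

variable [VectorBundle ℂ (Fin r → ℂ) E] [VectorBundle ℂ ℂ L]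
  [ContMDiffVectorBundle ω (Fin r → ℂ) E 𝓘(ℂ, Fin n → ℂ)]
  [ContMDiffVectorBundle ω ℂ L 𝓘(ℂ, Fin n → ℂ)]

theorem symmₗ_ext {p₀ p : X × ProjLine}
    (hp : p ∈ (trivializationAt ((Fin r → ℂ) × ℂ) (ExtFiber φ) p₀).baseSet) (u : (Fin r → ℂ) × ℂ) :
    (trivializationAt ((Fin r → ℂ) × ℂ) (ExtFiber φ) p₀).symmₗ ℂ p u =
      extFrame φ p₀.1 (ProjLine.chartIndex p₀.2) p u := by
  rw [Trivialization.symmₗ_apply _ hp]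
  exact extPretrivialization_symm φ p₀.1 (ProjLine.chartIndex p₀.2) hp u

theorem linearMapAt_ext {p₀ p : X × ProjLine}
    (hp : p ∈ (trivializationAt ((Fin r → ℂ) × ℂ) (ExtFiber φ) p₀).baseSet) (w : ExtFiber φ p) :
    (trivializationAt ((Fin r → ℂ) × ℂ) (ExtFiber φ) p₀).linearMapAt ℂ p w =
      extCoord φ p₀.1 (ProjLine.chartIndex p₀.2) p w := by
  rw [Trivialization.coe_linearMapAt_of_mem _ hp]
  rfl

end

end Geometry

/-! ### Gram matrices in local holomorphic frames -/

/-- The Gram matrix of a definite sesquilinear form on linearly independent vectors is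
nonsingular. -/
theorem det_gram_ne_zero {V κ : Type*} [AddCommGroup V] [Module ℂ V] [Fintype κ] [DecidableEq κ]
    (B : V →ₗ⋆[ℂ] V →ₗ[ℂ] ℂ) (hB : ∀ v, v ≠ 0 → B v v ≠ 0) {b : κ → V}
    (hb : LinearIndependent ℂ b) : (Matrix.of fun a d => B (b a) (b d)).det ≠ 0 := by
  intro hdet
  obtain ⟨v, hv, h⟩ := Matrix.exists_mulVec_eq_zero_iff.2 hdet
  have hne : ∑ a, v a • b a ≠ 0 := by
    intro h0
    exact hv (funext fun a => Fintype.linearIndependent_iff.1 hb v h0 a)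
  apply hB _ hne
  have h1 (a : κ) : B (b a) (∑ d, v d • b d) = 0 := by
    have := congrFun h a
    simpa [Matrix.mulVec, dotProduct, mul_comm] using this
  have h2 (w : V) : B (∑ a, v a • b a) w = ∑ a, conj (v a) • B (b a) w := by
    simp
  rw [h2]
  refine Finset.sum_eq_zero fun a _ => ?_
  rw [h1, smul_zero]

section LocalGram

variable {W : Type*} [NormedAddCommGroup W] [NormedSpace ℂ W]
  {HM : Type*} [TopologicalSpace HM] {I : ModelWithCorners ℂ W HM}
  {M : Type*} [TopologicalSpace M] [ChartedSpace HM M]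
  {F : Type*} [NormedAddCommGroup F] [NormedSpace ℂ F]
  {V : M → Type*} [TopologicalSpace (TotalSpace F V)]
  [∀ x, AddCommGroup (V x)] [∀ x, Module ℂ (V x)] [∀ x, TopologicalSpace (V x)]
  [FiberBundle F V] [VectorBundle ℂ F V]
  {κ : Type*}

variable (I) in
/-- The Gram matrix of a sesquilinear form on a vector bundle in the preferred coordinates and the
preferred trivialization at `x₀`. -/
def localGram (b : Module.Basis κ ℂ F) (h : ∀ x, V x →ₗ⋆[ℂ] V x →ₗ[ℂ] ℂ) (x₀ : M) (z : W) :
    Matrix κ κ ℂ :=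
  Matrix.of fun a d => localForm I F h x₀ (b a) (b d) z

theorem HermitianMetric.apply_self_ne_zero (h : HermitianMetric I F V) {x : M} {v : V x}
    (hv : v ≠ 0) : h.form x v v ≠ 0 := by
  intro h0
  have := h.pos x v hv
  simp [h0] at this

theorem HermitianMetric.matContDiffAt (h : HermitianMetric I F V) (b : Module.Basis κ ℂ F)
    (x₀ : M) : MatContDiffAt ℝ ∞ (localGram I b h.form x₀) (extChartAt I x₀ x₀) :=
  fun a d => h.smooth x₀ (b a) (b d)

variable [Fintype κ] [DecidableEq κ]

theorem HermitianMetric.det_localGram_ne_zero (h : HermitianMetric I F V) (b : Module.Basis κ ℂ F)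
    (x₀ : M) : (localGram I b h.form x₀ (extChartAt I x₀ x₀)).det ≠ 0 := by
  have hx : (extChartAt I x₀).symm (extChartAt I x₀ x₀) ∈ (trivializationAt F V x₀).baseSet := by
    rw [extChartAt_to_inv]
    exact FiberBundle.mem_baseSet_trivializationAt' x₀
  refine det_gram_ne_zero (h.form _) (fun v hv => h.apply_self_ne_zero hv)
    (b := fun a => (trivializationAt F V x₀).symmₗ ℂ _ (b a)) (b.linearIndependent.map' _ ?_)
  exact LinearMap.ker_eq_bot_of_inverse (g := (trivializationAt F V x₀).linearMapAt ℂ _)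
    (LinearMap.ext fun y => Trivialization.linearMapAt_symmₗ _ hx y)

end LocalGram

section FrameDomain

variable {n : ℕ} {X : Type*} [TopologicalSpace X] [ChartedSpace (Fin n → ℂ) X]
  (r : ℕ) (E : X → Type*) [TopologicalSpace (TotalSpace (Fin r → ℂ) E)]
  [∀ x, TopologicalSpace (E x)] [FiberBundle (Fin r → ℂ) E]
  (L : X → Type*) [TopologicalSpace (TotalSpace ℂ L)]
  [∀ x, TopologicalSpace (L x)] [FiberBundle ℂ L]

/-- The points at which the preferred frames of `E` and `L` at `x₀` are both defined. -/
def frameDomain (x₀ : X) : Set X :=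
  (trivializationAt (Fin r → ℂ) E x₀).baseSet ∩ (trivializationAt ℂ L x₀).baseSet

theorem frameDomain_mem_nhds (x₀ : X) : frameDomain r E L x₀ ∈ 𝓝 x₀ :=
  ((trivializationAt (Fin r → ℂ) E x₀).open_baseSet.inter
    (trivializationAt ℂ L x₀).open_baseSet).mem_nhds
    ⟨FiberBundle.mem_baseSet_trivializationAt' x₀, FiberBundle.mem_baseSet_trivializationAt' x₀⟩

theorem eventually_mem_frameDomain (x₀ : X) :
    ∀ᶠ z in 𝓝 (extChartAt 𝓘(ℂ, Fin n → ℂ) x₀ x₀),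
      (extChartAt 𝓘(ℂ, Fin n → ℂ) x₀).symm z ∈ frameDomain r E L x₀ := by
  have h := continuousAt_extChartAt_symm (I := 𝓘(ℂ, Fin n → ℂ)) x₀
  apply h.eventually
  rw [extChartAt_to_inv]
  exact frameDomain_mem_nhds r E L x₀

end FrameDomain

section Geometry

variable {n r : ℕ} {X : Type*} [TopologicalSpace X] [ChartedSpace (Fin n → ℂ) X]
  {E : X → Type*} [TopologicalSpace (TotalSpace (Fin r → ℂ) E)]
  [∀ x, AddCommGroup (E x)] [∀ x, Module ℂ (E x)] [∀ x, TopologicalSpace (E x)]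
  [FiberBundle (Fin r → ℂ) E] [VectorBundle ℂ (Fin r → ℂ) E]
  {L : X → Type*} [TopologicalSpace (TotalSpace ℂ L)]
  [∀ x, AddCommGroup (L x)] [∀ x, Module ℂ (L x)] [∀ x, TopologicalSpace (L x)]
  [FiberBundle ℂ L] [VectorBundle ℂ ℂ L]
  (φ : HolomorphicHom 𝓘(ℂ, Fin n → ℂ) (Fin r → ℂ) E L)

/-- The matrix of `φ` in the preferred coordinates and the preferred trivializations at `x₀`. -/
def localHom (x₀ : X) (z : Fin n → ℂ) : Matrix (Fin r) Unit ℂ :=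
  Matrix.of fun a _ =>
    (trivializationAt (Fin r → ℂ) E x₀).linearMapAt ℂ ((extChartAt 𝓘(ℂ, Fin n → ℂ) x₀).symm z)
      (φ.toFun _ ((trivializationAt ℂ L x₀).symmₗ ℂ ((extChartAt 𝓘(ℂ, Fin n → ℂ) x₀).symm z) 1)) a

variable [ContMDiffVectorBundle ω (Fin r → ℂ) E 𝓘(ℂ, Fin n → ℂ)]
  [ContMDiffVectorBundle ω ℂ L 𝓘(ℂ, Fin n → ℂ)]

theorem matContDiffAt_localHom [IsManifold 𝓘(ℂ, Fin n → ℂ) ω X] (x₀ : X) :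
    MatContDiffAt ℂ ω (localHom φ x₀) (extChartAt 𝓘(ℂ, Fin n → ℂ) x₀ x₀) := by
  set S := frameDomain r E L x₀ with hS
  have hφ : ContMDiffOn 𝓘(ℂ, Fin n → ℂ) 𝓘(ℂ, Fin r → ℂ) ω (fun x : X =>
      (trivializationAt (Fin r → ℂ) E x₀).linearMapAt ℂ x
        (φ.toFun x ((trivializationAt ℂ L x₀).symmₗ ℂ x 1))) S := by
    have h0 : ∀ x ∈ S, (trivializationAt ℂ L x₀).toOpenPartialHomeomorph.symm (x, 1) =
        (⟨x, (trivializationAt ℂ L x₀).symmₗ ℂ x 1⟩ : TotalSpace ℂ L) := fun x hx => by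
      rw [Trivialization.symmₗ_apply (R := ℂ) _ hx.2, Trivialization.mk_symm _ hx.2]
    have h1 : ContMDiffOn 𝓘(ℂ, Fin n → ℂ) (𝓘(ℂ, Fin n → ℂ).prod 𝓘(ℂ, ℂ)) ω
        (fun x : X => (⟨x, (trivializationAt ℂ L x₀).symmₗ ℂ x 1⟩ : TotalSpace ℂ L)) S := by
      refine ContMDiffOn.congr ?_ fun x hx => (h0 x hx).symm
      exact (Trivialization.contMDiffOn_symm (IB := 𝓘(ℂ, Fin n → ℂ)) (n := ω)
        (trivializationAt ℂ L x₀)).comp (contMDiffOn_id.prodMk (contMDiffOn_const (c := (1 : ℂ))))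
          fun x hx => (trivializationAt ℂ L x₀).mem_target.2 hx.2
    have h2 := (Trivialization.contMDiffOn (IB := 𝓘(ℂ, Fin n → ℂ)) (n := ω)
      (trivializationAt (Fin r → ℂ) E x₀)).comp (φ.holomorphic.comp_contMDiffOn h1) fun x hx =>
        (trivializationAt (Fin r → ℂ) E x₀).mem_source.2 hx.1
    refine (contMDiff_snd.comp_contMDiffOn h2).congr fun x hx => ?_
    rw [Trivialization.coe_linearMapAt_of_mem _ hx.1]
    rfl
  have hφ0 := (hφ x₀ (mem_of_mem_nhds (frameDomain_mem_nhds r E L x₀))).contMDiffAt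
    (frameDomain_mem_nhds r E L x₀)
  have hsymm : ContMDiffAt 𝓘(ℂ, Fin n → ℂ) 𝓘(ℂ, Fin n → ℂ) ω
      (extChartAt 𝓘(ℂ, Fin n → ℂ) x₀).symm (extChartAt 𝓘(ℂ, Fin n → ℂ) x₀ x₀) :=
    (contMDiffOn_extChartAt_symm x₀).contMDiffAt (extChartAt_target_mem_nhds x₀)
  have h3 := contMDiffAt_iff_contDiffAt.1 (hφ0.comp_of_eq hsymm (extChartAt_to_inv x₀))
  exact fun a _ => contDiffAt_pi.1 h3 a

/-- In the holomorphic frame of the extension, the metric `splitForm` has Gram matrix `extGram`. -/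
theorem localGram_splitForm (H : ∀ x, E x →ₗ⋆[ℂ] E x →ₗ[ℂ] ℂ) (K : ∀ x, L x →ₗ⋆[ℂ] L x →ₗ[ℂ] ℂ)
    (c : ℝ) (p₀ : X × ProjLine) {z : Fin n → ℂ} (a : ℂ)
    (hz : (extChartAt 𝓘(ℂ, Fin n → ℂ) p₀.1).symm z ∈ frameDomain r E L p₀.1) :
    localGram (𝓘(ℂ, Fin n → ℂ).prod 𝓘(ℂ, ℂ))
      ((Pi.basisFun ℂ (Fin r)).prod (Module.Basis.singleton Unit ℂ)) (splitForm φ H K c) p₀ (z, a) =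
    extGram (localGram 𝓘(ℂ, Fin n → ℂ) (Pi.basisFun ℂ (Fin r)) H p₀.1 z)
      (localGram 𝓘(ℂ, Fin n → ℂ) (Module.Basis.singleton Unit ℂ) K p₀.1 z) (localHom φ p₀.1 z)
      (affinePrimitive (ProjLine.chartSign (ProjLine.chartIndex p₀.2)) a) (c * affineWeight a) := by
  set i := ProjLine.chartIndex p₀.2 with hi
  set x := (extChartAt 𝓘(ℂ, Fin n → ℂ) p₀.1).symm z with hx
  set l : ProjLine := Projectivization.mk ℂ (ProjLine.affinePoint i a)
    (ProjLine.affinePoint_ne_zero i a) with hl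
  have hrep : l.rep i ≠ 0 := ProjLine.rep_mk_affinePoint_ne_zero i a
  have hcoord : ProjLine.coord i l = a := ProjLine.coord_mk_affinePoint i a
  have hp : (extChartAt (𝓘(ℂ, Fin n → ℂ).prod 𝓘(ℂ, ℂ)) p₀).symm (z, a) = (x, l) := by
    rw [extChartAt_prod]
    rfl
  have hbase : (x, l) ∈ (trivializationAt ((Fin r → ℂ) × ℂ) (ExtFiber φ) p₀).baseSet :=
    ⟨hz, hrep⟩
  set eE := (trivializationAt (Fin r → ℂ) E p₀.1).symmₗ ℂ x
  set eL := (trivializationAt ℂ L p₀.1).symmₗ ℂ x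
  have key (u u' : (Fin r → ℂ) × ℂ) :
      localForm (𝓘(ℂ, Fin n → ℂ).prod 𝓘(ℂ, ℂ)) ((Fin r → ℂ) × ℂ) (splitForm φ H K c) p₀ u u'
        (z, a) =
      H x (eE u.1 - affinePrimitive (ProjLine.chartSign i) a • φ.toFun x (eL u.2))
        (eE u'.1 - affinePrimitive (ProjLine.chartSign i) a • φ.toFun x (eL u'.2)) +
      c * affineWeight a * K x (eL u.2) (eL u'.2) := by
    rw [localForm, hp, symmₗ_ext φ hbase, symmₗ_ext φ hbase]
    simp only [extFrame]
    rw [splitForm_mk_tautSection φ H K c (x, l) hrep, evalQuad_quadOf hrep, evalQuad_quadOf hrep,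
      extPrimitive_eq, hcoord]
  have hΦ : φ.toFun x (eL 1) =
      ∑ d, localHom φ p₀.1 z d () • eE (Pi.basisFun ℂ (Fin r) d) := by
    have h1 := Trivialization.symmₗ_linearMapAt (R := ℂ) (trivializationAt (Fin r → ℂ) E p₀.1) hz.1
      (φ.toFun x (eL 1))
    rw [← h1]
    conv_lhs => rw [← (Pi.basisFun ℂ (Fin r)).sum_repr
      ((trivializationAt (Fin r → ℂ) E p₀.1).linearMapAt ℂ x (φ.toFun x (eL 1)))]
    rw [map_sum]
    simp only [map_smul]
    rfl
  ext (b | b) (d | d)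
  · simp [localGram, key, extGram]
    rfl
  · simp [localGram, key, extGram, hΦ, Matrix.mul_apply]
    exact Or.inl (Finset.sum_congr rfl fun _ _ => mul_comm _ _)
  · simp [localGram, key, extGram, hΦ, Matrix.mul_apply]
    exact Or.inl rfl
  · simp [localGram, key, extGram, hΦ, Matrix.mul_apply]
    rw [← mul_assoc]
    refine congrArg₂ (fun s t : ℂ => s + t) (congrArg _ ?_) rfl
    exact Finset.sum_congr rfl fun _ _ => mul_comm _ _

end Geometry

/-! ### The mean curvature of the metric on the extension -/

theorem toLin_fromBlocks {κ μ U V : Type*} [Fintype κ] [DecidableEq κ] [Fintype μ] [DecidableEq μ]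
    [AddCommGroup U] [Module ℂ U] [AddCommGroup V] [Module ℂ V] (b : Module.Basis κ ℂ U)
    (b' : Module.Basis μ ℂ V) (A : Matrix κ κ ℂ) (B : Matrix κ μ ℂ) (C : Matrix μ κ ℂ)
    (D : Matrix μ μ ℂ) (u : U) (v : V) :
    Matrix.toLin (b.prod b') (b.prod b') (Matrix.fromBlocks A B C D) (u, v) =
      (Matrix.toLin b b A u + Matrix.toLin b' b B v,
        Matrix.toLin b b' C u + Matrix.toLin b' b' D v) := by
  have h1 : ⇑((b.prod b').repr (u, v)) ∘ Sum.inl = b.repr u := by ext; simp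
  have h2 : ⇑((b.prod b').repr (u, v)) ∘ Sum.inr = b'.repr v := by ext; simp
  simp only [Matrix.toLin_apply, Matrix.fromBlocks_mulVec, Fintype.sum_sum_type, Sum.elim_inl,
    Sum.elim_inr, Module.Basis.prod_apply, Function.comp_apply, LinearMap.inl_apply,
    LinearMap.inr_apply, h1, h2, Pi.add_apply, add_smul, Finset.sum_add_distrib]
  ext <;> simp [Prod.fst_sum, Prod.snd_sum]

theorem toLin_extGauge {κ μ U V : Type*} [Fintype κ] [DecidableEq κ] [Fintype μ] [DecidableEq μ]
    [AddCommGroup U] [Module ℂ U] [AddCommGroup V] [Module ℂ V] (b : Module.Basis κ ℂ U)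
    (b' : Module.Basis μ ℂ V) (Φ : Matrix κ μ ℂ) (f : ℂ) (u : U) (v : V) :
    Matrix.toLin (b.prod b') (b.prod b') (extGauge Φ f) (u, v) =
      (u - f • Matrix.toLin b' b Φ v, v) := by
  simp [extGauge, toLin_fromBlocks, sub_eq_add_neg]

section CurvatureMatrix

variable {W : Type*} [NormedAddCommGroup W] [NormedSpace ℂ W]
  {HM : Type*} [TopologicalSpace HM] {I : ModelWithCorners ℂ W HM}
  {M : Type*} [TopologicalSpace M] [ChartedSpace HM M]
  {F : Type*} [NormedAddCommGroup F] [NormedSpace ℂ F]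
  {V : M → Type*} [TopologicalSpace (TotalSpace F V)]
  [∀ x, AddCommGroup (V x)] [∀ x, Module ℂ (V x)] [∀ x, TopologicalSpace (V x)]
  [FiberBundle F V] [VectorBundle ℂ F V]
  {κ ι : Type*}

theorem localGram_self (b : Module.Basis κ ℂ F) (h : ∀ x, V x →ₗ⋆[ℂ] V x →ₗ[ℂ] ℂ) (x₀ : M)
    (a d : κ) : localGram I b h x₀ (extChartAt I x₀ x₀) a d =
      h x₀ ((trivializationAt F V x₀).symmₗ ℂ x₀ (b a))
        ((trivializationAt F V x₀).symmₗ ℂ x₀ (b d)) := by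
  rw [localGram, Matrix.of_apply, localForm, extChartAt_to_inv]

variable [Fintype κ] [DecidableEq κ] [Fintype ι] [DecidableEq ι]

variable (I) in
/-- The matrix of the mean curvature in the preferred trivialization at `x₀`. -/
def curvatureMatrix (c : Module.Basis ι ℂ W) (b : Module.Basis κ ℂ F)
    (g : ∀ x : M, TangentSpace I x →ₗ⋆[ℂ] TangentSpace I x →ₗ[ℂ] ℂ)
    (h : ∀ x, V x →ₗ⋆[ℂ] V x →ₗ[ℂ] ℂ) (x₀ : M) : Matrix κ κ ℂ :=
  ∑ j, ∑ k, (Matrix.of fun k j =>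
      g x₀ (c k : TangentSpace I x₀) (c j : TangentSpace I x₀))⁻¹ j k •
    chernCurvature (localGram I b h x₀) (extChartAt I x₀ x₀) (c j) (c k)

theorem meanCurvature_apply (c : Module.Basis ι ℂ W) (b : Module.Basis κ ℂ F)
    (g : ∀ x : M, TangentSpace I x →ₗ⋆[ℂ] TangentSpace I x →ₗ[ℂ] ℂ)
    (h : ∀ x, V x →ₗ⋆[ℂ] V x →ₗ[ℂ] ℂ) (x₀ : M) (v : V x₀) :
    meanCurvature I c b g h x₀ v = (trivializationAt F V x₀).symmₗ ℂ x₀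
      (Matrix.toLin b b (curvatureMatrix I c b g h x₀)
        ((trivializationAt F V x₀).linearMapAt ℂ x₀ v)) := rfl

end CurvatureMatrix

section Geometry

variable {n r : ℕ} {X : Type*} [TopologicalSpace X] [ChartedSpace (Fin n → ℂ) X]

/-- The coefficient matrix of the product Kähler metric is block diagonal. -/
theorem gram_prodMetric (g : ∀ x : X, TangentSpace 𝓘(ℂ, Fin n → ℂ) x →ₗ⋆[ℂ]
      TangentSpace 𝓘(ℂ, Fin n → ℂ) x →ₗ[ℂ] ℂ) (σ : ℝ) (p : X × ProjLine) :
    (Matrix.of fun k j => prodMetric g σ p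
      ((Pi.basisFun ℂ (Fin n)).prod (Module.Basis.singleton Unit ℂ) k :
        TangentSpace (𝓘(ℂ, Fin n → ℂ).prod 𝓘(ℂ, ℂ)) p)
      ((Pi.basisFun ℂ (Fin n)).prod (Module.Basis.singleton Unit ℂ) j :
        TangentSpace (𝓘(ℂ, Fin n → ℂ).prod 𝓘(ℂ, ℂ)) p)) =
    Matrix.fromBlocks (Matrix.of fun k j => g p.1
        (Pi.basisFun ℂ (Fin n) k : TangentSpace 𝓘(ℂ, Fin n → ℂ) p.1)
        (Pi.basisFun ℂ (Fin n) j : TangentSpace 𝓘(ℂ, Fin n → ℂ) p.1)) 0 0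
      (Matrix.of fun _ _ : Unit => ((σ / (2 * Real.pi) : ℝ) : ℂ) *
        affineWeight (ProjLine.coord (ProjLine.chartIndex p.2) p.2)) := by
  have key (u v : (Fin n → ℂ) × ℂ) : prodMetric g σ p
      (u : TangentSpace (𝓘(ℂ, Fin n → ℂ).prod 𝓘(ℂ, ℂ)) p)
      (v : TangentSpace (𝓘(ℂ, Fin n → ℂ).prod 𝓘(ℂ, ℂ)) p) =
      g p.1 (u.1 : TangentSpace 𝓘(ℂ, Fin n → ℂ) p.1) (v.1 : TangentSpace 𝓘(ℂ, Fin n → ℂ) p.1) +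
      σ * (((2 * Real.pi * (1 + ‖ProjLine.coord (ProjLine.chartIndex p.2) p.2‖ ^ 2) ^ 2)⁻¹ : ℝ) *
        (conj u.2 * v.2)) := rfl
  have h0 (v) : g p.1 v (0 : Fin n → ℂ) = 0 := map_zero (g p.1 v)
  have h0' (v) : g p.1 (0 : Fin n → ℂ) v = 0 := by
    have h := map_zero (g p.1)
    exact congrArg (fun T => T v) h
  ext (k | k) (j | j) <;> rw [Matrix.of_apply, key]
  · simp
  · simpa using h0 _
  · simpa using h0' _
  · simp only [Module.Basis.prod_apply, Sum.elim_inr, Function.comp_apply, LinearMap.inr_apply,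
      Matrix.fromBlocks_apply₂₂, Matrix.of_apply, Module.Basis.singleton_apply, affineWeight]
    refine (congrArg (fun s : ℂ => s + _) (h0 _)).trans ?_
    push_cast
    simp
    ring

variable {E : X → Type*} [TopologicalSpace (TotalSpace (Fin r → ℂ) E)]
  [∀ x, AddCommGroup (E x)] [∀ x, Module ℂ (E x)] [∀ x, TopologicalSpace (E x)]
  [FiberBundle (Fin r → ℂ) E] [VectorBundle ℂ (Fin r → ℂ) E]
  {L : X → Type*} [TopologicalSpace (TotalSpace ℂ L)]
  [∀ x, AddCommGroup (L x)] [∀ x, Module ℂ (L x)] [∀ x, TopologicalSpace (L x)]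
  [FiberBundle ℂ L] [VectorBundle ℂ ℂ L]
  (φ : HolomorphicHom 𝓘(ℂ, Fin n → ℂ) (Fin r → ℂ) E L)

theorem localHom_self (x₀ : X) (a : Fin r) (b : Unit) :
    localHom φ x₀ (extChartAt 𝓘(ℂ, Fin n → ℂ) x₀ x₀) a b =
      (trivializationAt (Fin r → ℂ) E x₀).linearMapAt ℂ x₀
        (φ.toFun x₀ ((trivializationAt ℂ L x₀).symmₗ ℂ x₀ 1)) a := by
  rw [localHom, extChartAt_to_inv, Matrix.of_apply]

theorem toLin_localHom (x₀ : X) :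
    Matrix.toLin (Module.Basis.singleton Unit ℂ) (Pi.basisFun ℂ (Fin r))
      (localHom φ x₀ (extChartAt 𝓘(ℂ, Fin n → ℂ) x₀ x₀)) =
    (trivializationAt (Fin r → ℂ) E x₀).linearMapAt ℂ x₀ ∘ₗ φ.toFun x₀ ∘ₗ
      (trivializationAt ℂ L x₀).symmₗ ℂ x₀ := by
  rw [← LinearEquiv.eq_symm_apply, Matrix.toLin_symm]
  ext a b
  rw [LinearMap.toMatrix_apply, localHom_self]
  simp

/-- The matrix of the adjoint of `φ` is `K⁻¹ Φᴴ H`. -/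
theorem toLin_adjoint_localHom (H : HermitianMetric 𝓘(ℂ, Fin n → ℂ) (Fin r → ℂ) E)
    (K : HermitianMetric 𝓘(ℂ, Fin n → ℂ) ℂ L) {φs : ∀ x, E x →ₗ[ℂ] L x}
    (hφs : ∀ x v w, K.form x (φs x v) w = H.form x v (φ.toFun x w)) (x₀ : X) :
    Matrix.toLin (Pi.basisFun ℂ (Fin r)) (Module.Basis.singleton Unit ℂ)
      ((localGram 𝓘(ℂ, Fin n → ℂ) (Module.Basis.singleton Unit ℂ) K.form x₀
          (extChartAt 𝓘(ℂ, Fin n → ℂ) x₀ x₀))⁻¹ *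
        (localHom φ x₀ (extChartAt 𝓘(ℂ, Fin n → ℂ) x₀ x₀))ᴴ *
        localGram 𝓘(ℂ, Fin n → ℂ) (Pi.basisFun ℂ (Fin r)) H.form x₀
          (extChartAt 𝓘(ℂ, Fin n → ℂ) x₀ x₀)) =
    (trivializationAt ℂ L x₀).linearMapAt ℂ x₀ ∘ₗ φs x₀ ∘ₗ
      (trivializationAt (Fin r → ℂ) E x₀).symmₗ ℂ x₀ := by
  have hE := FiberBundle.mem_baseSet_trivializationAt' (F := Fin r → ℂ) (E := E) x₀
  have hL := FiberBundle.mem_baseSet_trivializationAt' (F := ℂ) (E := L) x₀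
  have hadj (v w) : K.form x₀ w (φs x₀ v) = H.form x₀ (φ.toFun x₀ w) v := by
    rw [← K.conj_symm, hφs, H.conj_symm]
  have hdet := K.det_localGram_ne_zero (Module.Basis.singleton Unit ℂ) x₀
  rw [← LinearEquiv.eq_symm_apply, Matrix.toLin_symm, Matrix.mul_assoc]
  have key : (localHom φ x₀ (extChartAt 𝓘(ℂ, Fin n → ℂ) x₀ x₀))ᴴ *
      localGram 𝓘(ℂ, Fin n → ℂ) (Pi.basisFun ℂ (Fin r)) H.form x₀
        (extChartAt 𝓘(ℂ, Fin n → ℂ) x₀ x₀) =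
      localGram 𝓘(ℂ, Fin n → ℂ) (Module.Basis.singleton Unit ℂ) K.form x₀
        (extChartAt 𝓘(ℂ, Fin n → ℂ) x₀ x₀) *
      LinearMap.toMatrix (Pi.basisFun ℂ (Fin r)) (Module.Basis.singleton Unit ℂ)
        ((trivializationAt ℂ L x₀).linearMapAt ℂ x₀ ∘ₗ φs x₀ ∘ₗ
          (trivializationAt (Fin r → ℂ) E x₀).symmₗ ℂ x₀) := by
    ext a d
    have h1 := hadj ((trivializationAt (Fin r → ℂ) E x₀).symmₗ ℂ x₀ (Pi.single d 1))
      ((trivializationAt ℂ L x₀).symmₗ ℂ x₀ 1)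
    rw [← Trivialization.symmₗ_linearMapAt (R := ℂ) (trivializationAt (Fin r → ℂ) E x₀) hE
      (φ.toFun x₀ _), ← Trivialization.symmₗ_linearMapAt (R := ℂ) (trivializationAt ℂ L x₀) hL
      (φs x₀ _)] at h1
    set y := (trivializationAt ℂ L x₀).linearMapAt ℂ x₀
      (φs x₀ ((trivializationAt (Fin r → ℂ) E x₀).symmₗ ℂ x₀ (Pi.single d 1))) with hy
    have hy1 : (trivializationAt ℂ L x₀).symmₗ ℂ x₀ y =
        y • (trivializationAt ℂ L x₀).symmₗ ℂ x₀ 1 := by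
      rw [← map_smul, smul_eq_mul, mul_one]
    rw [hy1, map_smul, ← (Pi.basisFun ℂ (Fin r)).sum_repr
      ((trivializationAt (Fin r → ℂ) E x₀).linearMapAt ℂ x₀ _)] at h1
    simp only [map_sum, map_smul, LinearMap.map_smulₛₗ, LinearMap.sum_apply,
      LinearMap.smul_apply, smul_eq_mul, Pi.basisFun_repr, Pi.basisFun_apply] at h1
    simp only [Matrix.mul_apply, LinearMap.toMatrix_apply, localGram_self, localHom_self,
      Matrix.conjTranspose_apply, Finset.univ_unique, Finset.sum_singleton,
      Module.Basis.singleton_apply, Pi.basisFun_apply]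
    simp only [LinearMap.comp_apply, Module.Basis.singleton_repr]
    rw [← hy, mul_comm]
    exact h1.symm
  rw [key, ← Matrix.mul_assoc, Matrix.nonsing_inv_mul _ (isUnit_iff_ne_zero.2 hdet),
    Matrix.one_mul]

variable [IsManifold 𝓘(ℂ, Fin n → ℂ) ω X]
  [ContMDiffVectorBundle ω (Fin r → ℂ) E 𝓘(ℂ, Fin n → ℂ)]
  [ContMDiffVectorBundle ω ℂ L 𝓘(ℂ, Fin n → ℂ)]

/-- In the preferred holomorphic frame, the contraction of the curvature of the metric
`H ⊕ c K ⊗ (standard metric of O(2))`, for `c = 2π/σ`, is conjugate to a block diagonal matrix, by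
the change to the smooth frame of `p^*E ⊕ p^*L ⊗ q^*O(2)`. -/
theorem curvatureMatrix_splitForm
    (g : HermitianMetric 𝓘(ℂ, Fin n → ℂ) (Fin n → ℂ) (TangentSpace 𝓘(ℂ, Fin n → ℂ) : X → Type _))
    (H : HermitianMetric 𝓘(ℂ, Fin n → ℂ) (Fin r → ℂ) E)
    (K : HermitianMetric 𝓘(ℂ, Fin n → ℂ) ℂ L) {σ : ℝ} (hσ : 0 < σ) (x₀ : X) (l₀ : ProjLine)
    {Φ : Matrix (Fin r) Unit ℂ} (hΦ : Φ = localHom φ x₀ (extChartAt 𝓘(ℂ, Fin n → ℂ) x₀ x₀))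
    {S : Matrix Unit (Fin r) ℂ}
    (hS : S = (localGram 𝓘(ℂ, Fin n → ℂ) (Module.Basis.singleton Unit ℂ) K.form x₀
          (extChartAt 𝓘(ℂ, Fin n → ℂ) x₀ x₀))⁻¹ * Φᴴ *
        localGram 𝓘(ℂ, Fin n → ℂ) (Pi.basisFun ℂ (Fin r)) H.form x₀
          (extChartAt 𝓘(ℂ, Fin n → ℂ) x₀ x₀)) :
    curvatureMatrix (𝓘(ℂ, Fin n → ℂ).prod 𝓘(ℂ, ℂ))
      ((Pi.basisFun ℂ (Fin n)).prod (Module.Basis.singleton Unit ℂ))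
      ((Pi.basisFun ℂ (Fin r)).prod (Module.Basis.singleton Unit ℂ))
      (prodMetric g.form σ) (splitForm φ H.form K.form (2 * Real.pi / σ)) (x₀, l₀) =
    extGauge Φ (-extPrimitive (ProjLine.chartIndex l₀) l₀) *
      Matrix.fromBlocks
        (curvatureMatrix 𝓘(ℂ, Fin n → ℂ) (Pi.basisFun ℂ (Fin n)) (Pi.basisFun ℂ (Fin r)) g.form
          H.form x₀ + Φ * S) 0 0
        (curvatureMatrix 𝓘(ℂ, Fin n → ℂ) (Pi.basisFun ℂ (Fin n)) (Module.Basis.singleton Unit ℂ)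
          g.form K.form x₀ - S * Φ + ((4 * Real.pi / σ : ℝ) : ℂ) • 1) *
      extGauge Φ (extPrimitive (ProjLine.chartIndex l₀) l₀) := by
  have hπ : (Real.pi : ℂ) ≠ 0 := by exact_mod_cast Real.pi_ne_zero
  have hσ' : (σ : ℂ) ≠ 0 := by exact_mod_cast hσ.ne'
  set c : ℝ := 2 * Real.pi / σ with hc
  set d : ℂ := ((σ / (2 * Real.pi) : ℝ) : ℂ) with hd
  -- this choice of `c` gives `φ φ^*` and `φ^* φ` the coefficient `1`
  have hdc : d * c = 1 := by
    rw [hc, hd]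
    push_cast
    field_simp
  have hc0 : (c : ℂ) ≠ 0 := right_ne_zero_of_mul_eq_one hdc
  have hd0 : d ≠ 0 := left_ne_zero_of_mul_eq_one hdc
  have hd2 : d⁻¹ * 2 = ((4 * Real.pi / σ : ℝ) : ℂ) := by
    rw [hd]
    push_cast
    field_simp
    norm_num
  set i := ProjLine.chartIndex l₀ with hi
  have hchart : extChartAt (𝓘(ℂ, Fin n → ℂ).prod 𝓘(ℂ, ℂ)) (x₀, l₀) (x₀, l₀) =
      (extChartAt 𝓘(ℂ, Fin n → ℂ) x₀ x₀, ProjLine.coord i l₀) := by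
    rw [extChartAt_prod]
    rfl
  have hgram : localGram (𝓘(ℂ, Fin n → ℂ).prod 𝓘(ℂ, ℂ))
        ((Pi.basisFun ℂ (Fin r)).prod (Module.Basis.singleton Unit ℂ))
        (splitForm φ H.form K.form c) (x₀, l₀) =ᶠ[
          𝓝 (extChartAt 𝓘(ℂ, Fin n → ℂ) x₀ x₀, ProjLine.coord i l₀)]
      fun q : (Fin n → ℂ) × ℂ =>
        extGram (localGram 𝓘(ℂ, Fin n → ℂ) (Pi.basisFun ℂ (Fin r)) H.form x₀ q.1)
          (localGram 𝓘(ℂ, Fin n → ℂ) (Module.Basis.singleton Unit ℂ) K.form x₀ q.1)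
          (localHom φ x₀ q.1) (affinePrimitive (ProjLine.chartSign i) q.2)
          (c * affineWeight q.2) := by
    have h := (continuous_fst.tendsto
      (extChartAt 𝓘(ℂ, Fin n → ℂ) x₀ x₀, ProjLine.coord i l₀)).eventually
      (eventually_mem_frameDomain (n := n) r E L x₀)
    exact h.mono fun q hq => localGram_splitForm φ H.form K.form c (x₀, l₀) q.2 hq
  have hg : (Matrix.of fun k j => g.form x₀
      (Pi.basisFun ℂ (Fin n) k : TangentSpace 𝓘(ℂ, Fin n → ℂ) x₀)
      (Pi.basisFun ℂ (Fin n) j : TangentSpace 𝓘(ℂ, Fin n → ℂ) x₀)).det ≠ 0 :=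
    det_gram_ne_zero (g.form x₀) (fun v hv => g.apply_self_ne_zero hv)
      (Pi.basisFun ℂ (Fin n)).linearIndependent
  have h2 : (2 : WithTop ℕ∞) ≤ ∞ :=
    WithTop.coe_le_coe.2 (le_top : (2 : ℕ∞) ≤ ⊤)
  have hmain := contraction_chernCurvature_extGram (Pi.basisFun ℂ (Fin n)) hg
    ((H.matContDiffAt (Pi.basisFun ℂ (Fin r)) x₀).of_le h2)
    ((K.matContDiffAt (Module.Basis.singleton Unit ℂ) x₀).of_le h2)
    (fun b d => (matContDiffAt_localHom φ x₀ b d).of_le le_top)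
    (H.det_localGram_ne_zero (Pi.basisFun ℂ (Fin r)) x₀)
    (K.det_localGram_ne_zero (Module.Basis.singleton Unit ℂ) x₀) hc0 hd0
    (ProjLine.chartSign_mul_self i) (ProjLine.coord i l₀)
  rw [curvatureMatrix, gram_prodMetric, hchart]
  simp only [chernCurvature_congr hgram]
  rw [hmain, ← hΦ, ← hS, hdc, inv_one, one_smul]
  have e : d⁻¹ • (2 • (1 : Matrix Unit Unit ℂ) - (c : ℂ)⁻¹ • (S * Φ)) =
      ((4 * Real.pi / σ : ℝ) : ℂ) • 1 - S * Φ := by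
    have hdc' : d⁻¹ * (c : ℂ)⁻¹ = 1 := by rw [← mul_inv, hdc, inv_one]
    rw [smul_sub, smul_smul, hdc', one_smul, ← hd2, ← smul_smul]
    congr 2
    module
  rw [e, ← add_sub_assoc, add_sub_right_comm]
  rfl

/-- The endomorphism `iΛ_σ F` of the metric `H ⊕ c K ⊗ (standard metric of O(2))`, for `c = 2π/σ`,
preserves the splitting and is `iΛF_H + φ φ^*` on `p^*E` and `iΛF_K - φ^* φ + 4π/σ` on
`p^*L ⊗ q^*O(2)`. -/
theorem meanCurvature_splitForm
    (g : HermitianMetric 𝓘(ℂ, Fin n → ℂ) (Fin n → ℂ) (TangentSpace 𝓘(ℂ, Fin n → ℂ) : X → Type _))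
    (H : HermitianMetric 𝓘(ℂ, Fin n → ℂ) (Fin r → ℂ) E)
    (K : HermitianMetric 𝓘(ℂ, Fin n → ℂ) ℂ L) {φs : ∀ x, E x →ₗ[ℂ] L x}
    (hφs : ∀ x v w, K.form x (φs x v) w = H.form x v (φ.toFun x w)) {σ : ℝ} (hσ : 0 < σ)
    (p : X × ProjLine) (v : E p.1) (Q : QuadraticMap ℂ p.2.submodule (L p.1)) :
    meanCurvature (𝓘(ℂ, Fin n → ℂ).prod 𝓘(ℂ, ℂ))
      ((Pi.basisFun ℂ (Fin n)).prod (Module.Basis.singleton Unit ℂ))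
      ((Pi.basisFun ℂ (Fin r)).prod (Module.Basis.singleton Unit ℂ))
      (prodMetric g.form σ) (splitForm φ H.form K.form (2 * Real.pi / σ)) p (.mk φ p v Q) =
    .mk φ p
      (meanCurvature 𝓘(ℂ, Fin n → ℂ) (Pi.basisFun ℂ (Fin n)) (Pi.basisFun ℂ (Fin r)) g.form H.form
        p.1 v + φ.toFun p.1 (φs p.1 v))
      ((meanCurvature 𝓘(ℂ, Fin n → ℂ) (Pi.basisFun ℂ (Fin n)) (Module.Basis.singleton Unit ℂ)
          g.form K.form p.1 - φs p.1 ∘ₗ φ.toFun p.1 +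
        ((4 * Real.pi / σ : ℝ) : ℂ) • LinearMap.id).compQuadraticMap Q) := by
  obtain ⟨x₀, l₀⟩ := p
  have hE := FiberBundle.mem_baseSet_trivializationAt' (F := Fin r → ℂ) (E := E) x₀
  have hL := FiberBundle.mem_baseSet_trivializationAt' (F := ℂ) (E := L) x₀
  have hbase := FiberBundle.mem_baseSet_trivializationAt' (F := (Fin r → ℂ) × ℂ)
    (E := ExtFiber φ) (x₀, l₀)
  set Φ := localHom φ x₀ (extChartAt 𝓘(ℂ, Fin n → ℂ) x₀ x₀) with hΦ
  obtain ⟨S, hS⟩ : ∃ S, S = (localGram 𝓘(ℂ, Fin n → ℂ) (Module.Basis.singleton Unit ℂ) K.form x₀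
          (extChartAt 𝓘(ℂ, Fin n → ℂ) x₀ x₀))⁻¹ * Φᴴ *
        localGram 𝓘(ℂ, Fin n → ℂ) (Pi.basisFun ℂ (Fin r)) H.form x₀
          (extChartAt 𝓘(ℂ, Fin n → ℂ) x₀ x₀) := ⟨_, rfl⟩
  have hΦl := toLin_localHom φ x₀
  have hSl := toLin_adjoint_localHom φ H K hφs x₀
  rw [← hΦ] at hΦl hSl
  rw [← hS] at hSl
  rw [meanCurvature_apply, curvatureMatrix_splitForm φ g H K hσ x₀ l₀ hΦ hS,
    linearMapAt_ext φ hbase, symmₗ_ext φ hbase, extCoord_mk]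
  rw [Matrix.toLin_mul _ ((Pi.basisFun ℂ (Fin r)).prod (Module.Basis.singleton Unit ℂ)),
    Matrix.toLin_mul _ ((Pi.basisFun ℂ (Fin r)).prod (Module.Basis.singleton Unit ℂ)),
    LinearMap.comp_apply, LinearMap.comp_apply]
  set f := extPrimitive (ProjLine.chartIndex l₀) l₀ with hf
  set q := Q (ProjLine.tautSection (ProjLine.chartIndex l₀) l₀) with hq
  have hgauge (f : ℂ) (u : Fin r → ℂ) (w : ℂ) :
      Matrix.toLin ((Pi.basisFun ℂ (Fin r)).prod (Module.Basis.singleton Unit ℂ))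
        ((Pi.basisFun ℂ (Fin r)).prod (Module.Basis.singleton Unit ℂ)) (extGauge Φ f) (u, w) =
      (u - f • (trivializationAt (Fin r → ℂ) E x₀).linearMapAt ℂ x₀
        (φ.toFun x₀ ((trivializationAt ℂ L x₀).symmₗ ℂ x₀ w)), w) := by
    rw [toLin_extGauge, hΦl]
    rfl
  have hu := hgauge f ((trivializationAt (Fin r → ℂ) E x₀).linearMapAt ℂ x₀ (v + f • φ.toFun x₀ q))
    ((trivializationAt ℂ L x₀).linearMapAt ℂ x₀ q)
  rw [Trivialization.symmₗ_linearMapAt _ hL, map_add, map_smul, add_sub_cancel_right] at hu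
  simp only [map_add, map_smul]
  rw [hu, toLin_fromBlocks]
  set T := meanCurvature 𝓘(ℂ, Fin n → ℂ) (Pi.basisFun ℂ (Fin n)) (Module.Basis.singleton Unit ℂ)
    g.form K.form x₀ - φs x₀ ∘ₗ φ.toFun x₀ + ((4 * Real.pi / σ : ℝ) : ℂ) • LinearMap.id with hT
  have hw : (trivializationAt ℂ L x₀).symmₗ ℂ x₀
      (Matrix.toLin (Module.Basis.singleton Unit ℂ) (Module.Basis.singleton Unit ℂ)
        (curvatureMatrix 𝓘(ℂ, Fin n → ℂ) (Pi.basisFun ℂ (Fin n)) (Module.Basis.singleton Unit ℂ)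
          g.form K.form x₀ - S * Φ + ((4 * Real.pi / σ : ℝ) : ℂ) • 1)
        ((trivializationAt ℂ L x₀).linearMapAt ℂ x₀ q)) = T q := by
    rw [map_add, map_sub, map_smul, Matrix.toLin_one, Matrix.toLin_mul _ (Pi.basisFun ℂ (Fin r)),
      hΦl, hSl, hT]
    simp only [LinearMap.add_apply, LinearMap.sub_apply, LinearMap.smul_apply, LinearMap.comp_apply,
      LinearMap.id_apply, map_add, map_sub, map_smul, Trivialization.symmₗ_linearMapAt _ hL,
      Trivialization.symmₗ_linearMapAt _ hE, meanCurvature_apply]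
  have hv : (trivializationAt (Fin r → ℂ) E x₀).symmₗ ℂ x₀
      (Matrix.toLin (Pi.basisFun ℂ (Fin r)) (Pi.basisFun ℂ (Fin r))
        (curvatureMatrix 𝓘(ℂ, Fin n → ℂ) (Pi.basisFun ℂ (Fin n)) (Pi.basisFun ℂ (Fin r)) g.form
          H.form x₀ + Φ * S) ((trivializationAt (Fin r → ℂ) E x₀).linearMapAt ℂ x₀ v)) =
      meanCurvature 𝓘(ℂ, Fin n → ℂ) (Pi.basisFun ℂ (Fin n)) (Pi.basisFun ℂ (Fin r)) g.form H.form
        x₀ v + φ.toFun x₀ (φs x₀ v) := by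
    rw [map_add, Matrix.toLin_mul _ (Module.Basis.singleton Unit ℂ), hΦl, hSl]
    simp only [LinearMap.add_apply, LinearMap.comp_apply, map_add,
      Trivialization.symmₗ_linearMapAt _ hL, Trivialization.symmₗ_linearMapAt _ hE,
      meanCurvature_apply]
  simp only [map_zero, LinearMap.zero_apply, add_zero, zero_add]
  rw [hgauge, extFrame]
  simp only
  rw [hw, map_sub, hv, map_smul, Trivialization.symmₗ_linearMapAt _ hE, neg_smul, sub_neg_eq_add,
    ← hf, add_sub_cancel_right]
  exact congrArg _ (quadOf_tautSection (ProjLine.rep_chartIndex l₀) (T.compQuadraticMap Q))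

end Geometry

/-! ### The action of `SU(2)` on the projective line -/

namespace ProjLine

theorem normSq_mulVec (k : SU2) (v : Fin 2 → ℂ) : normSq (k.1 *ᵥ v) = normSq v := by
  have h (v : Fin 2 → ℂ) : ((normSq v : ℝ) : ℂ) = star v ⬝ᵥ v := by
    simp [normSq, dotProduct, Complex.conj_mul']
  have hk : k.1ᴴ * k.1 = 1 := (Matrix.mem_unitaryGroup_iff').1 k.2.1
  apply Complex.ofReal_injective
  rw [h, h, Matrix.star_mulVec, Matrix.dotProduct_mulVec, Matrix.vecMul_vecMul, hk,
    Matrix.vecMul_one]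

theorem mulVec_mem (k : SU2) {l : ProjLine} {v : Fin 2 → ℂ} (hv : v ∈ l.submodule) :
    k.1 *ᵥ v ∈ (su2Line k l).submodule := by
  induction l using Projectivization.ind with | h u hu =>
  rw [Projectivization.submodule_mk] at hv
  obtain ⟨a, rfl⟩ := Submodule.mem_span_singleton.1 hv
  rw [su2Line, Projectivization.map_mk, Projectivization.submodule_mk, Matrix.mulVec_smul]
  exact Submodule.smul_mem _ _ (Submodule.mem_span_singleton_self _)

/-- The line spanned by `(1, 0)`. -/
def origin : ProjLine := Projectivization.mk ℂ (affinePoint 0 0) (affinePoint_ne_zero 0 0)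

theorem coord_origin : coord 0 origin = 0 := coord_mk_affinePoint 0 0

theorem rep_origin_ne_zero : origin.rep 0 ≠ 0 := rep_mk_affinePoint_ne_zero 0 0

theorem chartIndex_origin : chartIndex origin = 0 := if_pos rep_origin_ne_zero

theorem extPrimitive_origin : extPrimitive 0 origin = 0 := by
  simp [extPrimitive, coord_origin]

theorem coe_eq_smul_affinePoint (s : origin.submodule) :
    (s : Fin 2 → ℂ) = (s : Fin 2 → ℂ) 0 • affinePoint 0 0 := by
  obtain ⟨s, hs⟩ := s
  rw [origin, Projectivization.submodule_mk] at hs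
  obtain ⟨a, rfl⟩ := Submodule.mem_span_singleton.1 hs
  simp [affinePoint]

/-- `SU(2)` acts transitively on the projective line. -/
theorem exists_su2Line_origin (l : ProjLine) : ∃ k : SU2, su2Line k origin = l := by
  induction l using Projectivization.ind with | h v hv =>
  have hpos := normSq_pos hv
  set N : ℝ := Real.sqrt (normSq v) with hN
  have hN0 : (N : ℂ) ≠ 0 := by exact_mod_cast (Real.sqrt_pos.2 hpos).ne'
  have hNN : (N : ℂ) * N = v 0 * conj (v 0) + v 1 * conj (v 1) := by
    rw [← Complex.ofReal_mul, hN, Real.mul_self_sqrt hpos.le, normSq]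
    simp [Complex.mul_conj']
  have hmem : (!![v 0 / N, -conj (v 1) / N; v 1 / N, conj (v 0) / N] : Matrix (Fin 2) (Fin 2) ℂ) ∈
      Matrix.specialUnitaryGroup (Fin 2) ℂ := by
    rw [Matrix.mem_specialUnitaryGroup_iff, Matrix.mem_unitaryGroup_iff]
    constructor
    · ext i j
      fin_cases i <;> fin_cases j <;>
        simp [Matrix.mul_apply, Fin.sum_univ_two, Matrix.star_apply] <;> field_simp
      · linear_combination -hNN
      · ring
      · ring
      · linear_combination -hNN
    · rw [Matrix.det_fin_two_of]
      field_simp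
      linear_combination -hNN
  refine ⟨⟨_, hmem⟩, ?_⟩
  rw [su2Line, origin, Projectivization.map_mk, Projectivization.mk_eq_mk_iff']
  refine ⟨(N : ℂ)⁻¹, ?_⟩
  ext j
  fin_cases j <;> simp [affinePoint, Matrix.mulVec, dotProduct, div_eq_inv_mul]

/-- The element `diag(i, -i)` of `SU(2)`, which fixes the line spanned by `(1, 0)`. -/
def diagI : SU2 := ⟨!![Complex.I, 0; 0, -Complex.I], by
  rw [Matrix.mem_specialUnitaryGroup_iff, Matrix.mem_unitaryGroup_iff]
  constructor
  · ext i j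
    fin_cases i <;> fin_cases j <;> simp [Matrix.mul_apply, Fin.sum_univ_two, Matrix.star_apply]
  · simp [Matrix.det_fin_two_of]⟩

theorem diagI_mulVec (s : origin.submodule) :
    diagI.1 *ᵥ (s : Fin 2 → ℂ) = Complex.I • (s : Fin 2 → ℂ) := by
  rw [coe_eq_smul_affinePoint s]
  ext j
  fin_cases j <;> simp [diagI, affinePoint, Matrix.mulVec, dotProduct]

theorem su2Line_diagI : su2Line diagI origin = origin := by
  rw [su2Line, origin, Projectivization.map_mk, Projectivization.mk_eq_mk_iff']
  refine ⟨Complex.I, ?_⟩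
  ext j
  fin_cases j <;> simp [diagI, affinePoint, Matrix.mulVec, dotProduct]

end ProjLine

/-! ### Invariant metrics on the extension -/

section Smoothness

variable {W : Type*} [NormedAddCommGroup W] [NormedSpace ℂ W]
  {HM : Type*} [TopologicalSpace HM] {I : ModelWithCorners ℂ W HM}
  {M : Type*} [TopologicalSpace M] [ChartedSpace HM M]
  {F : Type*} [NormedAddCommGroup F] [NormedSpace ℂ F]
  {V : M → Type*} [TopologicalSpace (TotalSpace F V)]
  [∀ x, AddCommGroup (V x)] [∀ x, Module ℂ (V x)] [∀ x, TopologicalSpace (V x)]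
  [FiberBundle F V] [VectorBundle ℂ F V]
  {κ : Type*} [Fintype κ]

theorem contDiffAt_localForm {b : Module.Basis κ ℂ F} {h : ∀ x, V x →ₗ⋆[ℂ] V x →ₗ[ℂ] ℂ} {x₀ : M}
    {n : WithTop ℕ∞} {z : W} (hb : MatContDiffAt ℝ n (localGram I b h x₀) z) (a c : F) :
    ContDiffAt ℝ n (localForm I F h x₀ a c) z := by
  have key : localForm I F h x₀ a c = fun z =>
      ∑ i, ∑ j, conj (b.repr a i) * b.repr c j * localGram I b h x₀ z i j := by
    funext z
    conv_lhs => rw [localForm, ← b.sum_repr a, ← b.sum_repr c]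
    simp only [map_sum, map_smul, LinearMap.map_smulₛₗ, LinearMap.sum_apply, LinearMap.smul_apply,
      smul_eq_mul, Finset.mul_sum]
    rw [Finset.sum_comm]
    refine Finset.sum_congr rfl fun i _ => Finset.sum_congr rfl fun j _ => ?_
    simp only [localGram, Matrix.of_apply, localForm]
    ring
  rw [key]
  exact ContDiffAt.sum fun i _ => ContDiffAt.sum fun j _ => contDiffAt_const.mul (hb i j)

end Smoothness

section Geometry

variable {n r : ℕ} {X : Type*} [TopologicalSpace X] [ChartedSpace (Fin n → ℂ) X]
  {E : X → Type*} [TopologicalSpace (TotalSpace (Fin r → ℂ) E)]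
  [∀ x, AddCommGroup (E x)] [∀ x, Module ℂ (E x)] [∀ x, TopologicalSpace (E x)]
  [FiberBundle (Fin r → ℂ) E] [VectorBundle ℂ (Fin r → ℂ) E]
  {L : X → Type*} [TopologicalSpace (TotalSpace ℂ L)]
  [∀ x, AddCommGroup (L x)] [∀ x, Module ℂ (L x)] [∀ x, TopologicalSpace (L x)]
  [FiberBundle ℂ L] [VectorBundle ℂ ℂ L]
  [ContMDiffVectorBundle ω (Fin r → ℂ) E 𝓘(ℂ, Fin n → ℂ)]
  [ContMDiffVectorBundle ω ℂ L 𝓘(ℂ, Fin n → ℂ)]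

variable {φ : HolomorphicHom 𝓘(ℂ, Fin n → ℂ) (Fin r → ℂ) E L}

/-- Invariance under `SU(2)` in terms of the components: `k` sends `(v, Q)` to `(v, Q₁)` if
`Q₁ (k s) = Q s`. -/
theorem IsSU2Invariant.form_mk_eq
    {h : HermitianMetric (𝓘(ℂ, Fin n → ℂ).prod 𝓘(ℂ, ℂ)) ((Fin r → ℂ) × ℂ) (ExtFiber φ)}
    (hinv : IsSU2Invariant h) (k : SU2) (x : X) {l l₁ : ProjLine} (hl : su2Line k l = l₁)
    (v v' : E x) {Q Q' : QuadraticMap ℂ l.submodule (L x)}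
    {Q₁ Q₁' : QuadraticMap ℂ l₁.submodule (L x)}
    (hQ : ∀ (s : l.submodule) (s₁ : l₁.submodule), (s₁ : Fin 2 → ℂ) = k.1 *ᵥ s → Q₁ s₁ = Q s)
    (hQ' : ∀ (s : l.submodule) (s₁ : l₁.submodule), (s₁ : Fin 2 → ℂ) = k.1 *ᵥ s → Q₁' s₁ = Q' s) :
    h.form (x, l₁) (.mk φ (x, l₁) v Q₁) (.mk φ (x, l₁) v' Q₁') =
      h.form (x, l) (.mk φ (x, l) v Q) (.mk φ (x, l) v' Q') := by
  subst hl
  have hcomp (s₁ : (su2Line k l).submodule) : (s₁ : Fin 2 → ℂ) =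
      k.1 *ᵥ ((Matrix.mulVecLin (k⁻¹ : SU2).1).restrict (inv_mulVec_mem k l) s₁ : Fin 2 → ℂ) := by
    have e := SU2.inv_mulVec_mulVec k⁻¹ (s₁ : Fin 2 → ℂ)
    rw [inv_inv] at e
    exact e.symm
  have e : Q₁ = Q.comp ((Matrix.mulVecLin (k⁻¹ : SU2).1).restrict (inv_mulVec_mem k l)) :=
    QuadraticMap.ext fun s₁ => hQ _ _ (hcomp s₁)
  have e' : Q₁' = Q'.comp ((Matrix.mulVecLin (k⁻¹ : SU2).1).restrict (inv_mulVec_mem k l)) :=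
    QuadraticMap.ext fun s₁ => hQ' _ _ (hcomp s₁)
  rw [e, e']
  exact hinv k (x, l) (.mk φ (x, l) v Q) (.mk φ (x, l) v' Q')

/-- The stabilizer of a point of the projective line acts on the fibre of `O(2)` without nonzero
fixed vectors, so an invariant metric makes `p^*E` and `p^*L ⊗ q^*O(2)` orthogonal. -/
theorem IsSU2Invariant.orthogonal
    {h : HermitianMetric (𝓘(ℂ, Fin n → ℂ).prod 𝓘(ℂ, ℂ)) ((Fin r → ℂ) × ℂ) (ExtFiber φ)}
    (hinv : IsSU2Invariant h) (x : X) (v : E x)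
    (Q : QuadraticMap ℂ ProjLine.origin.submodule (L x)) :
    h.form (x, ProjLine.origin) (.mk φ _ v 0) (.mk φ _ 0 Q) = 0 := by
  have key := hinv.form_mk_eq ProjLine.diagI x ProjLine.su2Line_diagI v 0
    (Q := 0) (Q' := Q) (Q₁ := 0) (Q₁' := -Q) (fun _ _ _ => rfl) (by
      intro s s₁ hs
      have e : s₁ = Complex.I • s := Subtype.ext (hs.trans (ProjLine.diagI_mulVec s))
      rw [neg_apply, e, QuadraticMap.map_smul, Complex.I_mul_I, neg_one_smul, neg_neg])
  have hneg : (ExtFiber.mk φ (x, ProjLine.origin) 0 (-Q)) =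
      -(ExtFiber.mk φ (x, ProjLine.origin) 0 Q) := Prod.ext neg_zero.symm rfl
  rw [hneg, map_neg] at key
  exact self_eq_neg.1 key.symm

/-- The metric on a bundle over `X` induced from `c • h` by a linear embedding `ι` into the
restriction of the extension to `X × {[1 : 0]}`, which in the preferred holomorphic frames is a
constant map `j`. -/
def HermitianMetric.pullback
    (h : HermitianMetric (𝓘(ℂ, Fin n → ℂ).prod 𝓘(ℂ, ℂ)) ((Fin r → ℂ) × ℂ) (ExtFiber φ))
    {F : Type*} [NormedAddCommGroup F] [NormedSpace ℂ F]
    {V : X → Type*} [TopologicalSpace (TotalSpace F V)]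
    [∀ x, AddCommGroup (V x)] [∀ x, Module ℂ (V x)] [∀ x, TopologicalSpace (V x)]
    [FiberBundle F V] [VectorBundle ℂ F V]
    (ι : ∀ x, V x →ₗ[ℂ] ExtFiber φ (x, ProjLine.origin))
    (hι : ∀ x, Function.Injective (ι x)) (j : F → (Fin r → ℂ) × ℂ)
    (hj : ∀ x₀, ∀ x ∈ frameDomain r E L x₀, ∀ a,
      ι x ((trivializationAt F V x₀).symmₗ ℂ x a) = extFrame φ x₀ 0 (x, ProjLine.origin) (j a))
    {c : ℝ} (hc : 0 < c) : HermitianMetric 𝓘(ℂ, Fin n → ℂ) F V where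
  form x := (c : ℂ) • ((h.form (x, ProjLine.origin)).comp (ι x)).compl₂ (ι x)
  conj_symm x u v := by
    change conj ((c : ℂ) * h.form _ (ι x u) (ι x v)) = (c : ℂ) * h.form _ (ι x v) (ι x u)
    rw [map_mul, Complex.conj_ofReal, h.conj_symm]
  pos x v hv := by
    change 0 < ((c : ℂ) * h.form _ (ι x v) (ι x v)).re
    rw [Complex.re_ofReal_mul]
    exact mul_pos hc (h.pos _ _ ((map_ne_zero_iff _ (hι x)).2 hv))
  smooth x₀ a a' := by
    have hchart : extChartAt (𝓘(ℂ, Fin n → ℂ).prod 𝓘(ℂ, ℂ)) (x₀, ProjLine.origin)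
        (x₀, ProjLine.origin) =
        (extChartAt 𝓘(ℂ, Fin n → ℂ) x₀ x₀, extChartAt 𝓘(ℂ, ℂ) ProjLine.origin ProjLine.origin) := by
      rw [extChartAt_prod]
      rfl
    have h1 := h.smooth (x₀, ProjLine.origin) (j a) (j a')
    rw [hchart] at h1
    have h2 := contDiffAt_const (c := (c : ℂ)).mul (h1.comp (extChartAt 𝓘(ℂ, Fin n → ℂ) x₀ x₀)
      (contDiffAt_id.prodMk contDiffAt_const))
    refine h2.congr_of_eventuallyEq ?_
    filter_upwards [eventually_mem_frameDomain (n := n) r E L x₀] with z hz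
    have hp : (extChartAt (𝓘(ℂ, Fin n → ℂ).prod 𝓘(ℂ, ℂ)) (x₀, ProjLine.origin)).symm
        (z, extChartAt 𝓘(ℂ, ℂ) ProjLine.origin ProjLine.origin) =
        ((extChartAt 𝓘(ℂ, Fin n → ℂ) x₀).symm z, ProjLine.origin) := by
      conv_rhs => rw [← extChartAt_to_inv (I := 𝓘(ℂ, ℂ)) ProjLine.origin]
      rw [extChartAt_prod]
      rfl
    have hbase : ((extChartAt 𝓘(ℂ, Fin n → ℂ) x₀).symm z, ProjLine.origin) ∈
        (trivializationAt ((Fin r → ℂ) × ℂ) (ExtFiber φ) (x₀, ProjLine.origin)).baseSet :=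
      ⟨hz, ProjLine.rep_chartIndex _⟩
    change (c : ℂ) * h.form _ (ι _ _) (ι _ _) = (c : ℂ) * localForm _ _ _ _ _ _ (z, _)
    rw [hj x₀ _ hz, hj x₀ _ hz, localForm, hp, symmₗ_ext φ hbase, symmₗ_ext φ hbase,
      ProjLine.chartIndex_origin]

/-- Every invariant metric is of the form `H ⊕ c K ⊗ (standard metric of O(2))`, with `H` and `K`
given by its restriction to `X × {[1 : 0]}`. -/
theorem IsSU2Invariant.exists_eq_splitForm
    {h : HermitianMetric (𝓘(ℂ, Fin n → ℂ).prod 𝓘(ℂ, ℂ)) ((Fin r → ℂ) × ℂ) (ExtFiber φ)}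
    (hinv : IsSU2Invariant h) {c : ℝ} (hc : 0 < c) :
    ∃ (H : HermitianMetric 𝓘(ℂ, Fin n → ℂ) (Fin r → ℂ) E)
      (K : HermitianMetric 𝓘(ℂ, Fin n → ℂ) ℂ L), h.form = splitForm φ H.form K.form c := by
  set l₀ := ProjLine.origin with hl₀
  let ι₁ (x : X) : E x →ₗ[ℂ] ExtFiber φ (x, l₀) :=
    LinearMap.inl ℂ (E x) (QuadraticMap ℂ l₀.submodule (L x))
  let ι₂ (x : X) : L x →ₗ[ℂ] ExtFiber φ (x, l₀) :=
    LinearMap.inr ℂ (E x) (QuadraticMap ℂ l₀.submodule (L x)) ∘ₗ quadOf 0 l₀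
  have hquad (x : X) : Function.Injective (quadOf (B := L x) 0 l₀) := fun w w' hw => by
    rw [← evalQuad_quadOf ProjLine.rep_origin_ne_zero w, hw,
      evalQuad_quadOf ProjLine.rep_origin_ne_zero w']
  let H := h.pullback ι₁ (fun x => LinearMap.inl_injective) (fun a => (a, 0)) (by
    intro x₀ x hx a
    simp only [extFrame, map_zero, smul_zero, sub_zero]
    rfl) one_pos
  let K := h.pullback ι₂ (fun x => LinearMap.inr_injective.comp (hquad x)) (fun a => (0, a)) (by
    intro x₀ x hx a
    simp only [extFrame, ProjLine.extPrimitive_origin, map_zero, zero_smul, sub_zero]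
    rfl) (inv_pos.2 hc)
  refine ⟨H, K, ?_⟩
  have hc' : (c : ℂ) ≠ 0 := by exact_mod_cast hc.ne'
  have hH (x : X) (v v' : E x) : H.form x v v' =
      h.form (x, l₀) (.mk φ _ v 0) (.mk φ _ v' 0) := by
    change ((1 : ℝ) : ℂ) * h.form (x, l₀) (.mk φ _ v 0) (.mk φ _ v' 0) = _
    rw [Complex.ofReal_one, one_mul]
  have hK (x : X) (w w' : L x) : c * K.form x w w' =
      h.form (x, l₀) (.mk φ _ 0 (quadOf 0 l₀ w)) (.mk φ _ 0 (quadOf 0 l₀ w')) := by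
    change c * ((c⁻¹ : ℝ) * h.form (x, l₀) (.mk φ _ 0 (quadOf 0 l₀ w))
      (.mk φ _ 0 (quadOf 0 l₀ w'))) = _
    rw [Complex.ofReal_inv, mul_inv_cancel_left₀ hc']
  funext p
  obtain ⟨x, l⟩ := p
  refine LinearMap.ext fun w => LinearMap.ext fun w' => ?_
  obtain ⟨v, Q⟩ := w
  obtain ⟨v', Q'⟩ := w'
  obtain ⟨k, hk⟩ := ProjLine.exists_su2Line_origin l
  -- the unit vector `s₁ = k (1, 0)` spans the line `l`
  set s₀ := ProjLine.tautSection 0 l₀ with hs₀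
  have hs₀c : (s₀ : Fin 2 → ℂ) = ProjLine.affinePoint 0 0 := by
    rw [hs₀, ProjLine.coe_tautSection ProjLine.rep_origin_ne_zero, ProjLine.coord_origin]
  set s₁ : l.submodule := ⟨k.1 *ᵥ (s₀ : Fin 2 → ℂ), hk ▸ ProjLine.mulVec_mem k s₀.2⟩ with hs₁
  have hN : ProjLine.normSq (s₁ : Fin 2 → ℂ) = 1 := by
    rw [hs₁, ProjLine.normSq_mulVec, hs₀c, ProjLine.normSq_affinePoint]
    simp
  have hs₁0 : s₁ ≠ 0 := by
    intro h0
    rw [h0] at hN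
    simp [ProjLine.normSq] at hN
  have hQ (Q : QuadraticMap ℂ l.submodule (L x)) (s : l₀.submodule) (s' : l.submodule)
      (hs : (s' : Fin 2 → ℂ) = k.1 *ᵥ s) : Q s' = quadOf 0 l₀ (Q s₁) s := by
    have e : s' = (s : Fin 2 → ℂ) 0 • s₁ := Subtype.ext (by
      rw [hs, ProjLine.coe_eq_smul_affinePoint s, Matrix.mulVec_smul, ← hs₀c]
      simp [hs₁, hs₀c, ProjLine.affinePoint])
    rw [e, QuadraticMap.map_smul, quadOf_apply]
  have hdec (R R' : QuadraticMap ℂ l₀.submodule (L x)) :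
      h.form (x, l₀) (.mk φ _ v R) (.mk φ _ v' R') =
        h.form (x, l₀) (.mk φ _ v 0) (.mk φ _ v' 0) +
          h.form (x, l₀) (.mk φ _ 0 R) (.mk φ _ 0 R') := by
    have hsum (v : E x) (R : QuadraticMap ℂ l₀.submodule (L x)) :
        ExtFiber.mk φ (x, l₀) v R = ExtFiber.mk φ (x, l₀) v 0 + ExtFiber.mk φ (x, l₀) 0 R :=
      Prod.ext (add_zero v).symm (zero_add R).symm
    have h0 : h.form (x, l₀) (.mk φ _ 0 R) (.mk φ _ v' 0) = 0 := by
      rw [← h.conj_symm, hinv.orthogonal, map_zero]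
    rw [hsum v, hsum v', map_add, LinearMap.map_add₂, LinearMap.map_add₂, hinv.orthogonal, h0,
      add_zero, zero_add]
  refine (hinv.form_mk_eq k x hk v v' (hQ Q) (hQ Q')).trans ((hdec _ _).trans (Eq.trans ?_
    (splitForm_mk φ H.form K.form c (x, l) s₁ hs₁0 v v' Q Q').symm))
  rw [hN, ← hH, ← hK]
  simp

variable [IsManifold 𝓘(ℂ, Fin n → ℂ) ω X]

variable (φ) in
/-- The Hermitian metric `H ⊕ c K ⊗ (standard metric of O(2))` on the extension. -/
def splitMetric
    (H : HermitianMetric 𝓘(ℂ, Fin n → ℂ) (Fin r → ℂ) E)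
    (K : HermitianMetric 𝓘(ℂ, Fin n → ℂ) ℂ L) {c : ℝ} (hc : 0 < c) :
    HermitianMetric (𝓘(ℂ, Fin n → ℂ).prod 𝓘(ℂ, ℂ)) ((Fin r → ℂ) × ℂ) (ExtFiber φ) where
  form := splitForm φ H.form K.form c
  conj_symm := by
    rintro p ⟨v, Q⟩ ⟨v', Q'⟩
    have h := splitForm_mk φ H.form K.form c p _
      (ProjLine.tautSection_ne_zero (ProjLine.rep_chartIndex p.2))
    refine (congrArg conj (h v v' Q Q')).trans (Eq.trans ?_ (h v' v Q' Q).symm)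
    rw [map_add, map_mul, Complex.conj_ofReal, H.conj_symm, K.conj_symm]
  pos := by
    rintro p ⟨v, Q⟩ hw
    have hl := ProjLine.rep_chartIndex p.2
    set s := ProjLine.tautSection (ProjLine.chartIndex p.2) p.2 with hs
    have hs0 : s ≠ 0 := ProjLine.tautSection_ne_zero hl
    have hN : 0 < c * (ProjLine.normSq (s : Fin 2 → ℂ) ^ 2)⁻¹ :=
      mul_pos hc (inv_pos.2 (pow_pos (ProjLine.normSq_pos fun h => hs0 (Subtype.ext h)) 2))
    have h := congrArg Complex.re (splitForm_mk φ H.form K.form c p s hs0 v v Q Q)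
    rw [Complex.add_re, Complex.re_ofReal_mul] at h
    refine lt_of_lt_of_eq ?_ h.symm
    have h1 : 0 ≤ (H.form p.1 v v).re := by
      by_cases hv : v = 0
      · simp [hv]
      · exact (H.pos _ _ hv).le
    have h2 : 0 ≤ (K.form p.1 (Q s) (Q s)).re := by
      by_cases hq : Q s = 0
      · simp [hq]
      · exact (K.pos _ _ hq).le
    by_cases hv : v = 0
    · have hq : Q s ≠ 0 := by
        intro hq
        have hQ := quadOf_tautSection hl Q
        rw [← hs, hq, map_zero] at hQ
        subst hv
        rw [← hQ] at hw
        exact hw rfl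
      exact add_pos_of_nonneg_of_pos h1 (mul_pos hN (K.pos _ _ hq))
    · exact add_pos_of_pos_of_nonneg (H.pos _ _ hv) (mul_nonneg hN.le h2)
  smooth := by
    rintro ⟨x₀, l₀⟩
    refine contDiffAt_localForm
      (b := (Pi.basisFun ℂ (Fin r)).prod (Module.Basis.singleton Unit ℂ)) ?_
    have hchart : extChartAt (𝓘(ℂ, Fin n → ℂ).prod 𝓘(ℂ, ℂ)) (x₀, l₀) (x₀, l₀) =
        (extChartAt 𝓘(ℂ, Fin n → ℂ) x₀ x₀, ProjLine.coord (ProjLine.chartIndex l₀) l₀) := by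
      rw [extChartAt_prod]
      rfl
    rw [hchart]
    refine (matContDiffAt_extGram (H.matContDiffAt (Pi.basisFun ℂ (Fin r)) x₀)
      (K.matContDiffAt (Module.Basis.singleton Unit ℂ) x₀)
      ((matContDiffAt_localHom φ x₀).restrict_scalars.of_le le_top) c
      (ProjLine.chartSign (ProjLine.chartIndex l₀))
      (ProjLine.coord (ProjLine.chartIndex l₀) l₀)).congr ?_
    have h := (continuous_fst.tendsto (extChartAt 𝓘(ℂ, Fin n → ℂ) x₀ x₀,
      ProjLine.coord (ProjLine.chartIndex l₀) l₀)).eventually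
      (eventually_mem_frameDomain (n := n) r E L x₀)
    exact h.mono fun q hq => localGram_splitForm φ H.form K.form c (x₀, l₀) q.2 hq

theorem isSU2Invariant_splitMetric (H : HermitianMetric 𝓘(ℂ, Fin n → ℂ) (Fin r → ℂ) E)
    (K : HermitianMetric 𝓘(ℂ, Fin n → ℂ) ℂ L) {c : ℝ} (hc : 0 < c) :
    IsSU2Invariant (splitMetric φ H K hc) := by
  rintro k p ⟨v, Q⟩ ⟨v', Q'⟩
  set s := ProjLine.tautSection (ProjLine.chartIndex p.2) p.2
  have hs0 : s ≠ 0 := ProjLine.tautSection_ne_zero (ProjLine.rep_chartIndex p.2)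
  set ks : (su2Line k p.2).submodule := ⟨k.1 *ᵥ (s : Fin 2 → ℂ), ProjLine.mulVec_mem k s.2⟩ with hks
  have hk : (Matrix.mulVecLin (k⁻¹ : SU2).1).restrict (inv_mulVec_mem k p.2) ks = s :=
    Subtype.ext (SU2.inv_mulVec_mulVec k s)
  have hks0 : ks ≠ 0 := by
    intro h
    rw [h, map_zero] at hk
    exact hs0 hk.symm
  refine (splitForm_mk φ H.form K.form c (p.1, su2Line k p.2) ks hks0 v v' _ _).trans
    (Eq.trans ?_ (splitForm_mk φ H.form K.form c p s hs0 v v' Q Q').symm)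
  rw [QuadraticMap.comp_apply, QuadraticMap.comp_apply, hk]
  have hN : ProjLine.normSq (ks : Fin 2 → ℂ) = ProjLine.normSq s := ProjLine.normSq_mulVec k s
  rw [hN]

end Geometry

/-! ### The vortex equations and the deformed Hermitian-Einstein equation -/

section Geometry

variable {n r : ℕ} {X : Type*} [TopologicalSpace X] [ChartedSpace (Fin n → ℂ) X]
  {E : X → Type*} [TopologicalSpace (TotalSpace (Fin r → ℂ) E)]
  [∀ x, AddCommGroup (E x)] [∀ x, Module ℂ (E x)] [∀ x, TopologicalSpace (E x)]
  [FiberBundle (Fin r → ℂ) E] [VectorBundle ℂ (Fin r → ℂ) E]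
  {L : X → Type*} [TopologicalSpace (TotalSpace ℂ L)]
  [∀ x, AddCommGroup (L x)] [∀ x, Module ℂ (L x)] [∀ x, TopologicalSpace (L x)]
  [FiberBundle ℂ L] [VectorBundle ℂ ℂ L]

theorem exists_adjoint (φ : HolomorphicHom 𝓘(ℂ, Fin n → ℂ) (Fin r → ℂ) E L)
    (H : HermitianMetric 𝓘(ℂ, Fin n → ℂ) (Fin r → ℂ) E)
    (K : HermitianMetric 𝓘(ℂ, Fin n → ℂ) ℂ L) :
    ∃ φs : ∀ x, E x →ₗ[ℂ] L x,
      ∀ x v w, K.form x (φs x v) w = H.form x v (φ.toFun x w) := by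
  -- the fibre of `L` is spanned by the value `e` of the local frame
  let e (x : X) : L x := (trivializationAt ℂ L x).symmₗ ℂ x 1
  have hspan (x : X) (w : L x) : ∃ b : ℂ, w = b • e x := by
    refine ⟨(trivializationAt ℂ L x).linearMapAt ℂ x w, ?_⟩
    rw [← map_smul, smul_eq_mul, mul_one, Trivialization.symmₗ_linearMapAt _
      (FiberBundle.mem_baseSet_trivializationAt' x)]
  have he (x : X) : e x ≠ 0 := by
    intro h0
    have h1 := Trivialization.linearMapAt_symmₗ (R := ℂ) (trivializationAt ℂ L x)
      (FiberBundle.mem_baseSet_trivializationAt' (F := ℂ) (E := L) x) 1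
    change (trivializationAt ℂ L x).linearMapAt ℂ x (e x) = 1 at h1
    rw [h0, map_zero] at h1
    exact zero_ne_one h1
  refine ⟨fun x => ((K.form x (e x) (e x))⁻¹ • H.form x (φ.toFun x (e x))).smulRight (e x), ?_⟩
  intro x v w
  have hK := K.apply_self_ne_zero (he x)
  obtain ⟨b, rfl⟩ := hspan x w
  simp only [LinearMap.smulRight_apply, LinearMap.smul_apply, LinearMap.map_smulₛₗ, map_smul,
    smul_eq_mul, map_mul, map_inv₀, K.conj_symm, H.conj_symm]
  field_simp

variable [IsManifold 𝓘(ℂ, Fin n → ℂ) ω X]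
  [ContMDiffVectorBundle ω (Fin r → ℂ) E 𝓘(ℂ, Fin n → ℂ)]
  [ContMDiffVectorBundle ω ℂ L 𝓘(ℂ, Fin n → ℂ)]
  {φ : HolomorphicHom 𝓘(ℂ, Fin n → ℂ) (Fin r → ℂ) E L}

/-- For a split metric, whose mean curvature is block diagonal, the deformed Hermitian-Einstein
equation says that `iΛF_H + φ φ^* = t` and `iΛF_K - φ^* φ + 4π/σ = s + (t' - s')`; with
`4π/σ = s - s'` these are the vortex equations. -/
theorem deformedHermitianEinstein_iff
    (g : HermitianMetric 𝓘(ℂ, Fin n → ℂ) (Fin n → ℂ) (TangentSpace 𝓘(ℂ, Fin n → ℂ) : X → Type _))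
    (t t' : X → ℝ) {s s' σ : ℝ} (hσ : 0 < σ) (hss : 4 * Real.pi / σ = s - s')
    (H : HermitianMetric 𝓘(ℂ, Fin n → ℂ) (Fin r → ℂ) E)
    (K : HermitianMetric 𝓘(ℂ, Fin n → ℂ) ℂ L)
    {h : HermitianMetric (𝓘(ℂ, Fin n → ℂ).prod 𝓘(ℂ, ℂ)) ((Fin r → ℂ) × ℂ) (ExtFiber φ)}
    (hh : h.form = splitForm φ H.form K.form (2 * Real.pi / σ)) :
    DeformedHermitianEinstein g σ s s' t t' h ↔ CoupledVortexEquations g φ t t' H K := by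
  have hmk (p : X × ProjLine) (v u : E p.1) (Q R : QuadraticMap ℂ p.2.submodule (L p.1)) :
      ExtFiber.mk φ p v Q + ExtFiber.mk φ p u R = ExtFiber.mk φ p (v + u) (Q + R) := rfl
  have hsmul (p : X × ProjLine) (a : ℂ) (v : E p.1) (Q : QuadraticMap ℂ p.2.submodule (L p.1)) :
      a • ExtFiber.mk φ p v Q = ExtFiber.mk φ p (a • v) (a • Q) := rfl
  have hform (p : X × ProjLine) (v u : E p.1) (Q : QuadraticMap ℂ p.2.submodule (L p.1)) :
      h.form p (.mk φ p v 0) (.mk φ p u Q) = H.form p.1 v u := by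
    rw [hh, splitForm_mk φ H.form K.form _ p _
      (ProjLine.tautSection_ne_zero (ProjLine.rep_chartIndex p.2))]
    simp
  constructor
  · intro hDHE
    obtain ⟨φs, hφs⟩ := exists_adjoint φ H K
    refine ⟨φs, hφs, fun x => ⟨LinearMap.ext fun v => ?_, LinearMap.ext fun w => ?_⟩⟩
    · have key := hDHE (x, ProjLine.origin) (.mk φ _ v 0) (.mk φ _ 0 0) ⟨v, rfl⟩
        fun u => map_zero _
      rw [hh, hmk, meanCurvature_splitForm φ g H K hφs hσ] at key
      have key₁ := congrArg Prod.fst key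
      change _ = (s : ℂ) • (v + 0) + (((t x - s : ℝ) : ℂ) • v + ((t' x - s' : ℝ) : ℂ) • (0 : E x))
        at key₁
      rw [add_zero] at key₁
      refine key₁.trans ?_
      rw [LinearMap.smul_apply, LinearMap.id_apply]
      push_cast
      module
    · have key := hDHE (x, ProjLine.origin) (.mk φ _ 0 0)
        (.mk φ _ 0 (quadOf 0 ProjLine.origin w)) ⟨0, rfl⟩ fun u => by rw [hform, map_zero]
      rw [hh, hmk, meanCurvature_splitForm φ g H K hφs hσ] at key
      simp only [zero_add] at key
      have key₂ := congrArg (fun q => q.2 (ProjLine.tautSection 0 ProjLine.origin)) key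
      have hw : quadOf 0 ProjLine.origin w (ProjLine.tautSection 0 ProjLine.origin) = w :=
        evalQuad_quadOf ProjLine.rep_origin_ne_zero w
      change (_ + ((4 * Real.pi / σ : ℝ) : ℂ) • LinearMap.id : L x →ₗ[ℂ] L x)
          (quadOf 0 ProjLine.origin w (ProjLine.tautSection 0 ProjLine.origin)) =
        (s : ℂ) • quadOf 0 ProjLine.origin w (ProjLine.tautSection 0 ProjLine.origin) +
          (((t x - s : ℝ) : ℂ) • (0 : L x) + ((t' x - s' : ℝ) : ℂ) •
            quadOf 0 ProjLine.origin w (ProjLine.tautSection 0 ProjLine.origin)) at key₂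
      rw [hw, hss, LinearMap.add_apply, ← eq_sub_iff_add_eq] at key₂
      refine key₂.trans ?_
      rw [LinearMap.smul_apply, LinearMap.smul_apply, LinearMap.id_apply]
      push_cast
      module
  · rintro ⟨φs, hφs, hCVE⟩ p w₁ w₂ ⟨v, rfl⟩ horth
    obtain ⟨hE, hL⟩ := hCVE p.1
    obtain ⟨u, Q⟩ := w₂
    have hu : u = 0 := by
      by_contra hu
      exact H.apply_self_ne_zero hu ((hform p u u Q).symm.trans (horth u))
    subst hu
    change meanCurvature _ _ _ _ _ p (ExtFiber.mk φ p v 0 + ExtFiber.mk φ p 0 Q) =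
      (s : ℂ) • (ExtFiber.mk φ p v 0 + ExtFiber.mk φ p 0 Q) +
        (((t p.1 - s : ℝ) : ℂ) • ExtFiber.mk φ p v 0 +
          ((t' p.1 - s' : ℝ) : ℂ) • ExtFiber.mk φ p 0 Q)
    rw [hh]
    simp only [hmk, hsmul, smul_zero, add_zero, zero_add]
    rw [meanCurvature_splitForm φ g H K hφs hσ, hL, hss]
    have hv := LinearMap.congr_fun hE v
    rw [LinearMap.add_apply, LinearMap.comp_apply, LinearMap.smul_apply, LinearMap.id_apply] at hv
    rw [hv]
    congr 1
    · push_cast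
      module
    · ext y
      change ((t' p.1 : ℂ) • LinearMap.id + ((s - s' : ℝ) : ℂ) • LinearMap.id : L p.1 →ₗ[ℂ] L p.1)
        (Q y) = (s : ℂ) • Q y + ((t' p.1 - s' : ℝ) : ℂ) • Q y
      rw [LinearMap.add_apply, LinearMap.smul_apply, LinearMap.smul_apply, LinearMap.id_apply]
      push_cast
      module

end Geometry

end CoupledVortex

end

theorem mainTheorem4 {n r : ℕ}
    -- a compact complex manifold `X` of dimension `n`
    {X : Type*} [TopologicalSpace X] [T2Space X] [CompactSpace X] [ChartedSpace (Fin n → ℂ) X]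
    [IsManifold 𝓘(ℂ, Fin n → ℂ) ω X] [MeasurableSpace X] [BorelSpace X]
    -- a holomorphic vector bundle `E` of rank `r` and a holomorphic line bundle `L`
    (E : X → Type*) [TopologicalSpace (TotalSpace (Fin r → ℂ) E)]
    [∀ x, AddCommGroup (E x)] [∀ x, Module ℂ (E x)] [∀ x, TopologicalSpace (E x)]
    [FiberBundle (Fin r → ℂ) E] [VectorBundle ℂ (Fin r → ℂ) E]
    [ContMDiffVectorBundle ω (Fin r → ℂ) E 𝓘(ℂ, Fin n → ℂ)]
    (L : X → Type*) [TopologicalSpace (TotalSpace ℂ L)]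
    [∀ x, AddCommGroup (L x)] [∀ x, Module ℂ (L x)] [∀ x, TopologicalSpace (L x)]
    [FiberBundle ℂ L] [VectorBundle ℂ ℂ L]
    [ContMDiffVectorBundle ω ℂ L 𝓘(ℂ, Fin n → ℂ)]
    -- a holomorphic section `φ` of `Hom(L, E)`
    (φ : CoupledVortex.HolomorphicHom 𝓘(ℂ, Fin n → ℂ) (Fin r → ℂ) E L)
    -- a Kähler metric `g` on `X`
    (g : CoupledVortex.HermitianMetric 𝓘(ℂ, Fin n → ℂ) (Fin n → ℂ)
      (TangentSpace 𝓘(ℂ, Fin n → ℂ) : X → Type _))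
    (hg : CoupledVortex.IsKaehler g)
    -- smooth functions `t`, `t'`, whose averages are `s`, `s'`
    (t t' : X → ℝ) (ht : ContMDiff 𝓘(ℝ, Fin n → ℂ) 𝓘(ℝ, ℝ) ∞ t)
    (ht' : ContMDiff 𝓘(ℝ, Fin n → ℂ) 𝓘(ℝ, ℝ) ∞ t')
    (s s' σ : ℝ) (hs : s = ⨍ x, t x ∂(CoupledVortex.kaehlerVolume g))
    (hs' : s' = ⨍ x, t' x ∂(CoupledVortex.kaehlerVolume g))
    (hσ : σ = 4 * Real.pi / (s - s')) (hσ_pos : 0 < σ) :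
    (∃ (H : CoupledVortex.HermitianMetric 𝓘(ℂ, Fin n → ℂ) (Fin r → ℂ) E)
      (K : CoupledVortex.HermitianMetric 𝓘(ℂ, Fin n → ℂ) ℂ L),
      CoupledVortex.CoupledVortexEquations g φ t t' H K) ↔
    ∃ h : CoupledVortex.HermitianMetric (𝓘(ℂ, Fin n → ℂ).prod 𝓘(ℂ, ℂ)) ((Fin r → ℂ) × ℂ)
        (CoupledVortex.ExtFiber φ),
      CoupledVortex.IsSU2Invariant h ∧
        CoupledVortex.DeformedHermitianEinstein g σ s s' t t' h := by
  have hss : 4 * Real.pi / σ = s - s' := by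
    rw [hσ, div_div_cancel₀ (by positivity)]
  have hc : 0 < 2 * Real.pi / σ := by positivity
  constructor
  · rintro ⟨H, K, hHK⟩
    exact ⟨CoupledVortex.splitMetric φ H K hc, CoupledVortex.isSU2Invariant_splitMetric H K hc,
      (CoupledVortex.deformedHermitianEinstein_iff g t t' hσ_pos hss H K rfl).2 hHK⟩
  · rintro ⟨h, hinv, hDHE⟩
    obtain ⟨H, K, hh⟩ := hinv.exists_eq_splitForm hc
    exact ⟨H, K, (CoupledVortex.deformedHermitianEinstein_iff g t t' hσ_pos hss H K hh).1 hDHE⟩
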